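/- Write $\Delta$ for the discriminant of a number field, and say that a finite abelian group $G$ appears as a torsion group over $K$ if some elliptic curve $E$ over $K$ has $E(K)_{\mathrm{tors}}\cong G$. (1) $\mathbb{Z}/2\mathbb{Z}\oplus\mathbb{Z}/10\mathbb{Z}$ appears as a torsion group over the quadratic field $\mathbb{Q}(\sqrt{-2})$, and $\mathbb{Q}(\sqrt{-2})$ is the quadratic field of smallest $|\Delta|$ with this property: every quadratic field $K$ over which this group appears satisfies $|\Delta_K|\ge|\Delta_{\mathbb{Q}(\sqrt{-2})}|$, with equality only if $K\cong\mathbb{Q}(\sqrt{-2})$. (2) Let $X_1(2,10)$ be given by its model $y^2=x^3+x^2-x$, whose cusps are the point at infinity and the affine points with $x(x-1)(x+1)(x^2+x-1)(x^2-4x-1)=0$. Over $\mathbb{Q}(\sqrt{-7})$ and over $\mathbb{Q}(\sqrt5)$ this elliptic curve has rank $0$ and all its rational points are cusps, with $X_1(2,10)(\mathbb{Q}(\sqrt{-7}))\cong\mathbb{Z}/6\mathbb{Z}$ and $X_1(2,10)(\mathbb{Q}(\sqrt5))\cong\mathbb{Z}/2\mathbb{Z}\oplus\mathbb{Z}/6\mathbb{Z}$.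 Over $\mathbb{Q}(\sqrt{-2})$ it has rank $1$. (3) The curve $$y^2+\frac{5}{11}xy+\frac{6}{121}y=x^3+\frac{6}{121}x^2$$ over $\mathbb{Q}(\sqrt{-2})$ is an elliptic curve whose torsion group over $\mathbb{Q}(\sqrt{-2})$ is isomorphic to $\mathbb{Z}/2\mathbb{Z}\oplus\mathbb{Z}/10\mathbb{Z}$ and is generated by the points $\left(\frac{-2-8\sqrt{-2}}{121},\frac{20\sqrt{-2}-28}{1331}\right)$ and $\left(\frac{6}{11},-\frac{72}{121}\right)$. -/

import Mathlib

/-- The field `ℚ(√d)`, as the subfield of `ℂ` generated over `ℚ` by the square roots of `d`. -/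
noncomputable def QSqrt (d : ℤ) : IntermediateField ℚ ℂ :=
  IntermediateField.adjoin ℚ {z : ℂ | z ^ 2 = (d : ℂ)}

theorem QSqrt.finite_roots (d : ℤ) : {z : ℂ | z ^ 2 = (d : ℂ)}.Finite := by
  have h : {z : ℂ | z ^ 2 = (d : ℂ)} = ((Polynomial.nthRootsFinset 2 (d : ℂ) : Finset ℂ) : Set ℂ) := by
    ext z
    simp
  rw [h]
  exact Finset.finite_toSet _

instance QSqrt.instNumberField (d : ℤ) : NumberField (QSqrt d) where
  to_charZero := inferInstance
  to_finiteDimensional := by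
    have : Finite {z : ℂ | z ^ 2 = (d : ℂ)} := (QSqrt.finite_roots d).to_subtype
    unfold QSqrt
    refine IntermediateField.finiteDimensional_adjoin fun z hz => ?_
    refine IsIntegral.of_pow (n := 2) (by norm_num) ?_
    rw [show z ^ 2 = algebraMap ℚ ℂ (d : ℚ) by simpa using hz]
    exact isIntegral_algebraMap

/-- `ℚ(√d)` contains a square root of `d`. -/
theorem QSqrt.exists_sq_eq (d : ℤ) : ∃ s : QSqrt d, s ^ 2 = (d : QSqrt d) := by
  obtain ⟨z, hz⟩ := IsAlgClosed.exists_pow_nat_eq (d : ℂ) (n := 2) (by norm_num)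
  refine ⟨⟨z, IntermediateField.subset_adjoin ℚ _ hz⟩, ?_⟩
  apply Subtype.ext
  simpa using hz

noncomputable instance QSqrt.instDecidableEq (d : ℤ) : DecidableEq (QSqrt d) :=
  Classical.decEq _

/-- `ℤ/mℤ ⊕ ℤ/nℤ` appears as a torsion group over `K`: it is isomorphic to the full torsion
subgroup of `E(K)` for some elliptic curve `E` over `K`. -/
def AppearsAsTorsion (K : Type*) [Field K] [DecidableEq K] (m n : ℕ) : Prop :=
  ∃ E : WeierstrassCurve K, E.IsElliptic ∧
    Nonempty (AddCommGroup.torsion E.toAffine.Point ≃+ ZMod m × ZMod n)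

/-- The curve `y² = x³ + x² - x` over `K`, a model of the modular curve `X₁(2,10)`. -/
def X1_2_10 (K : Type*) [Field K] : WeierstrassCurve K where
  a₁ := 0
  a₂ := 1
  a₃ := 0
  a₄ := -1
  a₆ := 0

/-- The cusps of `X₁(2,10)` among its `K`-rational points: the point at infinity, and the affine
points whose `x`-coordinate satisfies `x(x-1)(x+1)(x²+x-1)(x²-4x-1) = 0`. -/
def X1_2_10.IsCusp {K : Type*} [Field K] : (X1_2_10 K).toAffine.Point → Prop
  | .zero => True
  | .some x _ _ => x * (x - 1) * (x + 1) * (x ^ 2 + x - 1) * (x ^ 2 - 4 * x - 1) = 0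

/-- The rank of the Mordell-Weil group `E(K)`, as a cardinal. -/
noncomputable def WeierstrassCurve.mordellWeilRank {K : Type*} [Field K] [DecidableEq K]
    (E : WeierstrassCurve K) : Cardinal :=
  Module.rank ℤ E.toAffine.Point

/-- The curve `y² + (5/11)xy + (6/121)y = x³ + (6/121)x²` over `ℚ(√-2)`. -/
noncomputable def exampleCurve : WeierstrassCurve (QSqrt (-2)) where
  a₁ := 5 / 11
  a₂ := 6 / 121
  a₃ := 6 / 121
  a₄ := 0
  a₆ := 0

/-! Write E for y² = x³ + x² - x, T = (0, 0) and A = (1, 1). A curve over K with torsion ℤ/2 ⊕ ℤ/10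
yields a noncuspidal K-point of E. Moving a point of order 5 to the origin gives a Tate normal form
with parameter t; a 2-torsion point makes t a rational function of some r; full 2-torsion makes the
discriminant of the 2-division cubic a square, and this is the equation of E at x = 2r - 1
(`exists_noncusp_of_tate`). By Stickelberger's congruence a quadratic field with |Δ| ≤ 8 contains √d
for d = -1, 2, -3, 5, -7 or -2, so minimality follows once E has only cusps for the first five d.

Let σ be the conjugation of K = ℚ(√d). In 2P = (P + σP) + (P - σP) the first summand is rational and
the second comes from the twist d v² = x³ + x² - x. A descent by 2-isogeny over ℚ shows that every
affine point with x ≠ 0 on these curves is, up to T, a double; since doubling raises heights to the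
fourth power up to the factor 100, only a small search remains
(`rational_points_of_trivialDescent`). So E(ℚ) has six points and each of the five twists only ∞ and
T. As T is not a double over a quadratic field, E(K) is generated by A and E(K)[2]
(`exists_eq_add`). This gives rank 0, cuspidality and the group structure, which depends only on
whether √5 lies in K.

For d = -2 the twist also contains C = (-2, √-2). The descent now shows that T and C represent all
anti-invariant points modulo doubles (`exists_decomposition`). Infinite descent with the naive
height then bounds the rank by 1, and the 2-adic valuations of x(2ⁿC) show that C has infinite
order.

For the explicit curve, 17 splits in ℚ(√-2), torsion injects into the reduction
(`exists_injective_reduction`), and the reduction has 20 points. The two given points already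
generate a group of order 20. -/

set_option linter.unusedSectionVars false

/-! ### The x-coordinates of P + Q and P - Q -/

section

namespace WeierstrassCurve.Affine.Point

open MvPolynomial

section

variable {F : Type*} [Field F] {W : WeierstrassCurve.Affine F}

lemma addSubMap_eval (W : WeierstrassCurve F) (a b c : F) :
    (fun i ↦ (addSubMap W i).eval ![a, b, c]) =
      ![a ^ 2 - W.b₄ * a * c - W.b₆ * b * c - W.b₈ * c ^ 2,
        2 * b * a + W.b₂ * a * c + W.b₄ * b * c + W.b₆ * c ^ 2, b ^ 2 - 4 * a * c] := by
  ext i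
  fin_cases i <;> simp [addSubMap]

lemma sq_two_mul_add {x y : F} (h : W.Equation x y) :
    (2 * y + W.a₁ * x + W.a₃) ^ 2 = 4 * x ^ 3 + W.b₂ * x ^ 2 + 2 * W.b₄ * x + W.b₆ := by
  rw [equation_iff] at h
  simp only [b₂, b₄, b₆]
  linear_combination 4 * h

lemma sub_negY (x y : F) : y - W.negY x y = 2 * y + W.a₁ * x + W.a₃ := by
  rw [negY]; ring

end

variable {F : Type*} [Field F] [DecidableEq F] {W : WeierstrassCurve.Affine F}

/-- This is the duplication formula. The scalar is (2y + a₁x + a₃)², except at 2-torsion points,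
where it vanishes and the square of the partial derivative in x takes over; that one is nonzero by
nonsingularity. -/
lemma exists_addSubMap_eval_sym2x_self {x y : F} (h : W.Nonsingular x y) :
    ∃ c : F, c ≠ 0 ∧ (fun i ↦ (addSubMap W i).eval ((some x y h).sym2x (some x y h))) =
      c • (some x y h + some x y h).sym2x 0 := by
  have he := sq_two_mul_add h.1
  have h3 := (W.equation_iff x y).1 h.1
  rw [sym2x_some_some, addSubMap_eval]
  by_cases hy : y = W.negY x y
  · rw [add_self_of_Y_eq hy, sym2x_zero_zero]
    have h0 : 2 * y + W.a₁ * x + W.a₃ = 0 := by rw [← sub_negY, ← hy, sub_self]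
    have h1 := (W.nonsingular_iff x y).1 h
    have h2 : W.a₁ * y - (3 * x ^ 2 + 2 * W.a₂ * x + W.a₄) ≠ 0 :=
      sub_ne_zero.2 (h1.2.resolve_right (not_not.2 hy))
    refine ⟨(W.a₁ * y - (3 * x ^ 2 + 2 * W.a₂ * x + W.a₄)) ^ 2, pow_ne_zero 2 h2, ?_⟩
    rw [h0] at he
    ext i
    fin_cases i
    · simp only [b₂, b₄, b₆, b₈] at he ⊢
      simp
      linear_combination (8 * x + W.a₁ ^ 2 + 4 * W.a₂) * h3 +
        (W.a₁ * (3 * x ^ 2 + 2 * W.a₂ * x + W.a₄ - W.a₁ * y) -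
          (W.a₂ + 2 * x) * (2 * y + W.a₁ * x + W.a₃)) * h0
    · simp
      linear_combination -he
    · simp; ring
  · rw [add_self_of_Y_ne hy, sym2x_some_zero]
    have h0 : 2 * y + W.a₁ * x + W.a₃ ≠ 0 := by rw [← sub_negY]; exact sub_ne_zero.2 hy
    refine ⟨(2 * y + W.a₁ * x + W.a₃) ^ 2, pow_ne_zero 2 h0, ?_⟩
    rw [slope_of_Y_ne rfl hy, sub_negY, addX]
    ext i
    fin_cases i
    · simp only [b₂, b₄, b₆, b₈] at he ⊢
      simp
      generalize hη : 2 * y + W.a₁ * x + W.a₃ = η at h0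
      field_simp
      rw [← hη]
      linear_combination (8 * x + W.a₁ ^ 2 + 4 * W.a₂) * h3
    · simp
      linear_combination -he
    · simp; ring

/-- The two curve equations are solved for a₆ and a₄, the latter thanks to x₁ ≠ x₂. What remains is
an identity of rational functions in free variables. -/
lemma addSubMap_eval_sym2x_of_X_ne {x₁ y₁ x₂ y₂ : F} (h₁ : W.Nonsingular x₁ y₁)
    (h₂ : W.Nonsingular x₂ y₂) (hx : x₁ ≠ x₂) :
    (fun i ↦ (addSubMap W i).eval ((some x₁ y₁ h₁).sym2x (some x₂ y₂ h₂))) =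
      ((x₁ - x₂) ^ 2) • (some x₁ y₁ h₁ + some x₂ y₂ h₂).sym2x (some x₁ y₁ h₁ - some x₂ y₂ h₂) := by
  have e₁ := (W.equation_iff x₁ y₁).1 h₁.1
  have e₂ := (W.equation_iff x₂ y₂).1 h₂.1
  have h0 := sub_ne_zero.2 hx
  rw [sub_eq_add_neg (some x₁ y₁ h₁), neg_some, add_of_X_ne hx, add_of_X_ne hx, sym2x_some_some,
    sym2x_some_some, addSubMap_eval, slope_of_X_ne hx, slope_of_X_ne hx]
  simp only [addX, negY, b₂, b₄, b₆, b₈]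
  clear h₁ h₂
  generalize W.a₁ = a₁ at *
  generalize W.a₂ = a₂ at *
  generalize W.a₃ = a₃ at *
  generalize W.a₄ = a₄ at *
  generalize W.a₆ = a₆ at *
  have h₆ : a₆ = y₁ ^ 2 + a₁ * x₁ * y₁ + a₃ * y₁ - (x₁ ^ 3 + a₂ * x₁ ^ 2 + a₄ * x₁) := by
    linear_combination -e₁
  have h₄ : a₄ = (y₁ ^ 2 + a₁ * x₁ * y₁ + a₃ * y₁ - (x₁ ^ 3 + a₂ * x₁ ^ 2) -
      (y₂ ^ 2 + a₁ * x₂ * y₂ + a₃ * y₂ - (x₂ ^ 3 + a₂ * x₂ ^ 2))) / (x₁ - x₂) := by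
    rw [eq_div_iff h0]
    linear_combination e₂ - e₁
  clear e₁ e₂
  subst h₆
  subst h₄
  ext i
  fin_cases i
  · simp
    field_simp
    ring
  · simp
    field_simp
    ring
  · simp; ring

/-- The map `addSubMap W` sends `(x(P) * x(Q) : x(P) + x(Q) : 1)` to
`(x(P+Q) * x(P-Q) : x(P+Q) + x(P-Q) : 1)`. -/
theorem exists_addSubMap_eval_sym2x (P Q : W.Point) :
    ∃ c : F, c ≠ 0 ∧ (fun i ↦ (addSubMap W i).eval (P.sym2x Q)) = c • (P + Q).sym2x (P - Q) := by
  match P, Q with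
  | 0, 0 => exact ⟨1, one_ne_zero, by
      rw [sym2x_zero_zero, addSubMap_eval]; ext i; fin_cases i <;> simp⟩
  | 0, some x y h => exact ⟨1, one_ne_zero, by
      rw [zero_add, zero_sub, sym2x_neg_right, sym2x_zero_some, sym2x_some_some, addSubMap_eval]
      ext i; fin_cases i <;> simp <;> ring⟩
  | some x y h, 0 => exact ⟨1, one_ne_zero, by
      rw [add_zero, sub_zero, sym2x_some_zero, sym2x_some_some, addSubMap_eval]
      ext i; fin_cases i <;> simp <;> ring⟩
  | some x₁ y₁ h₁, some x₂ y₂ h₂ =>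
    by_cases hx : x₁ = x₂
    · rcases X_eq_iff (h₁ := h₁) (h₂ := h₂) |>.1 hx with he | he
      · rw [he, sub_self]
        exact exists_addSubMap_eval_sym2x_self h₂
      · rw [he, neg_add_cancel, sym2x_neg_left, ← neg_add', sym2x_neg_right, sym2x_comm 0]
        exact exists_addSubMap_eval_sym2x_self h₂
    · exact ⟨_, pow_ne_zero 2 (sub_ne_zero.2 hx), addSubMap_eval_sym2x_of_X_ne h₁ h₂ hx⟩

end WeierstrassCurve.Affine.Point

end

/-! ### The coordinate u = 1/x near infinity -/

namespace WeierstrassCurve.Affine.Point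

section InvX

variable {F : Type*} [Field F] {W : WeierstrassCurve.Affine F}

/-- The inverse of the `x`-coordinate of a point, with value `0` at infinity. -/
noncomputable def invX (P : W.Point) : F := P.xRep 1 / P.xRep 0

@[simp]
lemma invX_zero : invX (0 : W.Point) = 0 := by simp [invX]

@[simp]
lemma invX_some {x y : F} (h : W.Nonsingular x y) : invX (some x y h) = x⁻¹ := by simp [invX]

lemma invX_neg (P : W.Point) : invX (-P) = invX P := by simp [invX]

lemma eq_zero_of_invX_eq_zero {P : W.Point} (h0 : P.xRep 0 ≠ 0) (h : invX P = 0) : P = 0 := by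
  match P with
  | 0 => rfl
  | some x y hP =>
    simp at h h0
    exact absurd h h0

/-- The addition-subtraction identity is rewritten in the chart u = 1/x. `D` is its normalised first
coordinate, so `D ≠ 0` says that neither P + Q nor P - Q has x = 0, and u(P ± Q) become the roots of
an explicit quadratic. -/
lemma invX_add_sub [DecidableEq F] {P Q : W.Point} (hP : P.xRep 0 ≠ 0) (hQ : Q.xRep 0 ≠ 0)
    {D : F} (hD : D = 1 - W.b₄ * invX P * invX Q - W.b₆ * (invX P + invX Q) * (invX P * invX Q) -
      W.b₈ * (invX P * invX Q) ^ 2) (hD0 : D ≠ 0) :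
    (P + Q).xRep 0 ≠ 0 ∧ (P - Q).xRep 0 ≠ 0 ∧
      D * (invX (P + Q) + invX (P - Q)) = 2 * (invX P + invX Q) + W.b₂ * (invX P * invX Q) +
        W.b₄ * (invX P + invX Q) * (invX P * invX Q) + W.b₆ * (invX P * invX Q) ^ 2 ∧
      D * (invX (P + Q) * invX (P - Q)) = (invX P - invX Q) ^ 2 := by
  obtain ⟨c, hc, h⟩ := exists_addSubMap_eval_sym2x P Q
  simp only [invX] at *
  rw [sym2x, addSubMap_eval, sym2x] at h
  have e0 := congrFun h 0
  have e1 := congrFun h 1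
  have e2 := congrFun h 2
  simp at e0 e1 e2
  set a := P.xRep 0
  set b := P.xRep 1
  set a' := Q.xRep 0
  set b' := Q.xRep 1
  set r := (P + Q).xRep 0
  set t := (P + Q).xRep 1
  set r' := (P - Q).xRep 0
  set t' := (P - Q).xRep 1
  have e0' : (a * a') ^ 2 * D = c * (r * r') := by
    rw [← e0, hD]; field_simp; ring
  have hne : c * (r * r') ≠ 0 := by
    rw [← e0']; exact mul_ne_zero (pow_ne_zero 2 (mul_ne_zero hP hQ)) hD0
  have hr : r ≠ 0 := fun h ↦ hne (by rw [h]; ring)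
  have hr' : r' ≠ 0 := fun h ↦ hne (by rw [h]; ring)
  have haa := pow_ne_zero 2 (mul_ne_zero hP hQ)
  refine ⟨hr, hr', ?_, ?_⟩
  · apply mul_left_cancel₀ haa
    rw [← mul_assoc, e0']
    field_simp
    linear_combination -e1
  · apply mul_left_cancel₀ haa
    rw [← mul_assoc, e0']
    field_simp
    linear_combination -e2

end InvX

/-! ### Ultrametric estimates for points reducing to infinity -/

section Nonarchimedean

variable {F : Type*} [NormedField F] [IsUltrametricDist F] {W : WeierstrassCurve.Affine F}

/-- Points reducing to the point at infinity. -/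
def InFormal (P : W.Point) : Prop := P.xRep 0 ≠ 0 ∧ ‖invX P‖ < 1

lemma inFormal_zero : InFormal (0 : W.Point) := by simp [InFormal]

lemma inFormal_some {x y : F} (h : W.Nonsingular x y) : InFormal (some x y h) ↔ 1 < ‖x‖ := by
  simp only [InFormal, xRep_some, invX_some, norm_inv]
  constructor
  · rintro ⟨h0, h1⟩
    simp at h0
    exact (inv_lt_one₀ (norm_pos_iff.2 h0)).1 h1
  · intro h
    have h0 : 0 < ‖x‖ := zero_lt_one.trans h
    exact ⟨by simpa using norm_pos_iff.1 h0, (inv_lt_one₀ h0).2 h⟩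

/-- Integrality of the coefficients of a Weierstrass equation. -/
structure NormLEOne (W : WeierstrassCurve F) : Prop where
  a₁ : ‖W.a₁‖ ≤ 1
  a₂ : ‖W.a₂‖ ≤ 1
  a₃ : ‖W.a₃‖ ≤ 1
  a₄ : ‖W.a₄‖ ≤ 1
  a₆ : ‖W.a₆‖ ≤ 1

lemma norm_add_le_of_le {a b : F} {r : ℝ} (ha : ‖a‖ ≤ r) (hb : ‖b‖ ≤ r) : ‖a + b‖ ≤ r :=
  (IsUltrametricDist.norm_add_le_max a b).trans (max_le ha hb)

lemma norm_sub_le_of_le {a b : F} {r : ℝ} (ha : ‖a‖ ≤ r) (hb : ‖b‖ ≤ r) : ‖a - b‖ ≤ r := by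
  rw [sub_eq_add_neg]; exact norm_add_le_of_le ha (by rwa [norm_neg])

lemma norm_mul_le_of_le_one_left {a b : F} {r : ℝ} (ha : ‖a‖ ≤ 1) (hb : ‖b‖ ≤ r) :
    ‖a * b‖ ≤ r := by
  rw [norm_mul]
  exact (mul_le_of_le_one_left (norm_nonneg _) ha).trans hb

lemma norm_intCast_le_one (n : ℤ) : ‖(n : F)‖ ≤ 1 := IsUltrametricDist.norm_intCast_le_one F n

lemma norm_ofNat_le_one (n : ℕ) [n.AtLeastTwo] : ‖(OfNat.ofNat n : F)‖ ≤ 1 := by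
  simpa using IsUltrametricDist.norm_natCast_le_one F (OfNat.ofNat n)

lemma norm_mul_le_one {a b : F} (ha : ‖a‖ ≤ 1) (hb : ‖b‖ ≤ 1) : ‖a * b‖ ≤ 1 :=
  norm_mul_le_of_le_one_left ha hb

lemma norm_pow_le_one' {a : F} (ha : ‖a‖ ≤ 1) (n : ℕ) : ‖a ^ n‖ ≤ 1 := by
  rw [norm_pow]; exact pow_le_one₀ (norm_nonneg _) ha

lemma norm_eq_one_of_sub {a b : F} (ha : ‖a‖ = 1) (h : ‖a - b‖ < 1) : ‖b‖ = 1 := by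
  have h1 := IsUltrametricDist.norm_eq_of_add_norm_lt_max (x := a) (y := -b)
    (by rw [← sub_eq_add_neg, ha]; exact h.trans_le (le_max_left _ _))
  rw [← norm_neg, ← h1, ha]

variable (hW : NormLEOne W)
include hW

lemma NormLEOne.b₂ : ‖W.b₂‖ ≤ 1 :=
  norm_add_le_of_le (norm_pow_le_one' hW.a₁ 2) (norm_mul_le_one (norm_ofNat_le_one 4) hW.a₂)

lemma NormLEOne.b₄ : ‖W.b₄‖ ≤ 1 :=
  norm_add_le_of_le (norm_mul_le_one (norm_ofNat_le_one 2) hW.a₄) (norm_mul_le_one hW.a₁ hW.a₃)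

lemma NormLEOne.b₆ : ‖W.b₆‖ ≤ 1 :=
  norm_add_le_of_le (norm_pow_le_one' hW.a₃ 2) (norm_mul_le_one (norm_ofNat_le_one 4) hW.a₆)

lemma NormLEOne.b₈ : ‖W.b₈‖ ≤ 1 := by
  refine norm_sub_le_of_le (norm_add_le_of_le (norm_sub_le_of_le (norm_add_le_of_le ?_ ?_) ?_) ?_) ?_
  · exact norm_mul_le_one (norm_pow_le_one' hW.a₁ 2) hW.a₆
  · exact norm_mul_le_one (norm_mul_le_one (norm_ofNat_le_one 4) hW.a₂) hW.a₆
  · exact norm_mul_le_one (norm_mul_le_one hW.a₁ hW.a₃) hW.a₄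
  · exact norm_mul_le_one hW.a₂ (norm_pow_le_one' hW.a₃ 2)
  · exact norm_pow_le_one' hW.a₄ 2

/-- Modulo terms of size M² the factor D is 1, so u(P + Q) and u(P - Q) have sum close to 2(u(P) +
u(Q)) and product of size at most M². Using u = 1/x in place of the formal parameter -x/y avoids
power series. -/
lemma InFormal.add_sub [DecidableEq F] {P Q : W.Point} (hP : InFormal P) (hQ : InFormal Q) {M : ℝ}
    (hM : M < 1) (hPM : ‖invX P‖ ≤ M) (hQM : ‖invX Q‖ ≤ M) :
    InFormal (P + Q) ∧ ‖invX (P + Q)‖ ≤ M ∧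
      ‖invX (P + Q) + invX (P - Q) - 2 * (invX P + invX Q)‖ ≤ M ^ 2 := by
  have hM0 : 0 ≤ M := (norm_nonneg _).trans hPM
  have hMM : M ^ 2 ≤ M := by nlinarith
  obtain ⟨D, hD⟩ : ∃ D, D = 1 - W.b₄ * invX P * invX Q -
      W.b₆ * (invX P + invX Q) * (invX P * invX Q) - W.b₈ * (invX P * invX Q) ^ 2 := ⟨_, rfl⟩
  have hS : ‖invX P + invX Q‖ ≤ M := norm_add_le_of_le hPM hQM
  have hV : ‖invX P * invX Q‖ ≤ M ^ 2 := by
    rw [norm_mul, sq]; exact mul_le_mul hPM hQM (norm_nonneg _) hM0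
  have hV1 : ‖invX P * invX Q‖ ≤ 1 := hV.trans (hMM.trans hM.le)
  have hD1 : ‖1 - D‖ ≤ M ^ 2 := by
    rw [show 1 - D = W.b₄ * (invX P * invX Q) +
      (W.b₆ * (invX P + invX Q)) * (invX P * invX Q) +
        (W.b₈ * (invX P * invX Q)) * (invX P * invX Q) by rw [hD]; ring]
    refine norm_add_le_of_le (norm_add_le_of_le ?_ ?_) ?_
    · exact norm_mul_le_of_le_one_left hW.b₄ hV
    · exact norm_mul_le_of_le_one_left (norm_mul_le_one hW.b₆ (hS.trans hM.le)) hV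
    · exact norm_mul_le_of_le_one_left (norm_mul_le_one hW.b₈ hV1) hV
  have hDn : ‖D‖ = 1 := norm_eq_one_of_sub norm_one (hD1.trans_lt (hMM.trans_lt hM))
  have hD0 : D ≠ 0 := by rw [← norm_pos_iff, hDn]; exact one_pos
  obtain ⟨h1, h2, h3, h4⟩ := invX_add_sub hP.1 hQ.1 hD hD0
  set u := invX (P + Q)
  set v := invX (P - Q)
  have key : ‖u + v - 2 * (invX P + invX Q)‖ ≤ M ^ 2 := by
    have : ‖D * (u + v - 2 * (invX P + invX Q))‖ ≤ M ^ 2 := by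
      rw [show D * (u + v - 2 * (invX P + invX Q)) = (2 * (invX P + invX Q)) * (1 - D) +
        W.b₂ * (invX P * invX Q) + (W.b₄ * (invX P + invX Q)) * (invX P * invX Q) +
        (W.b₆ * (invX P * invX Q)) * (invX P * invX Q) by rw [mul_sub, h3]; ring]
      refine norm_add_le_of_le (norm_add_le_of_le (norm_add_le_of_le ?_ ?_) ?_) ?_
      · exact norm_mul_le_of_le_one_left
          (norm_mul_le_one (norm_ofNat_le_one 2) (hS.trans hM.le)) hD1
      · exact norm_mul_le_of_le_one_left hW.b₂ hV
      · exact norm_mul_le_of_le_one_left (norm_mul_le_one hW.b₄ (hS.trans hM.le)) hV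
      · exact norm_mul_le_of_le_one_left (norm_mul_le_one hW.b₆ hV1) hV
    rwa [norm_mul, hDn, one_mul] at this
  have hsum : ‖u + v‖ ≤ M := by
    rw [show u + v = (u + v - 2 * (invX P + invX Q)) + 2 * (invX P + invX Q) by ring]
    exact norm_add_le_of_le (key.trans hMM) (norm_mul_le_of_le_one_left (norm_ofNat_le_one 2) hS)
  have hprod : ‖u * v‖ ≤ M ^ 2 := by
    have : ‖D * (u * v)‖ ≤ M ^ 2 := by
      rw [h4, norm_pow]
      exact pow_le_pow_left₀ (norm_nonneg _) (norm_sub_le_of_le hPM hQM) 2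
    rwa [norm_mul, hDn, one_mul] at this
  -- A Newton polygon argument: a root u with ‖u‖ > M would violate u² = (u + v)u - uv.
  have hu : ‖u‖ ≤ M := by
    by_contra! h
    have h5 : ‖u ^ 2‖ ≤ max ‖(u + v) * u‖ ‖u * v‖ := by
      rw [show u ^ 2 = (u + v) * u - u * v by ring, sub_eq_add_neg, ← norm_neg (u * v)]
      exact IsUltrametricDist.norm_add_le_max _ _
    rw [norm_pow, norm_mul (u + v)] at h5
    rcases le_max_iff.1 h5 with h6 | h6 <;> nlinarith [norm_nonneg u]
  exact ⟨⟨h1, hu.trans_lt hM⟩, hu, key⟩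

/-- The function n² satisfies the recursion f(n + 2) + f(n) = 2(f(n + 1) + 1), and
`InFormal.add_sub` gives the same recursion for u(nP)/u(P) up to an error of size ‖u(P)‖. -/
lemma InFormal.nsmul [DecidableEq F] {P : W.Point} (hP : InFormal P) (n : ℕ) :
    InFormal (n • P) ∧ ‖invX (n • P)‖ ≤ ‖invX P‖ ∧
      ‖invX (n • P) - (n : F) ^ 2 * invX P‖ ≤ ‖invX P‖ ^ 2 := by
  induction n using Nat.twoStepInduction with
  | zero => simp [inFormal_zero]
  | one => simp [hP]
  | more n ih ih' =>
    obtain ⟨h1, h2, h3⟩ := InFormal.add_sub hW ih'.1 hP hP.2 ih'.2.1 le_rfl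
    rw [← succ_nsmul] at h1 h2 h3
    refine ⟨h1, h2, ?_⟩
    rw [succ_nsmul P n, add_sub_cancel_right, ← succ_nsmul] at h3
    rw [show invX ((n + 2) • P) - ((n + 2 : ℕ) : F) ^ 2 * invX P =
      (invX ((n + 1 + 1) • P) + invX (n • P) - 2 * (invX ((n + 1) • P) + invX P)) +
        2 * (invX ((n + 1) • P) - ((n + 1 : ℕ) : F) ^ 2 * invX P) -
        (invX (n • P) - (n : F) ^ 2 * invX P) by push_cast; ring]
    exact norm_sub_le_of_le (norm_add_le_of_le h3
      (norm_mul_le_of_le_one_left (norm_ofNat_le_one 2) ih'.2.2)) ih.2.2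

/-- If (2k + 1)P = 0 then (k + 1)P = -kP, so both have the same u. Subtracting the two quadratic
estimates leaves (k + 1)² - k² = 2k + 1, a bound linear in the order instead of quadratic. -/
lemma InFormal.norm_natCast_le [DecidableEq F] {P : W.Point} (hP : InFormal P) (hP0 : P ≠ 0) (k : ℕ)
    (hk : (2 * k + 1) • P = 0) : ‖((2 * k + 1 : ℕ) : F)‖ ≤ ‖invX P‖ := by
  have h1 : invX ((k + 1) • P) = invX (k • P) := by
    rw [← invX_neg (k • P)]
    congr 1
    rw [eq_neg_iff_add_eq_zero, ← add_nsmul, ← hk]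
    congr 1
    ring
  have h2 := (hP.nsmul hW (k + 1)).2.2
  have h3 := (hP.nsmul hW k).2.2
  have h4 : ‖((2 * k + 1 : ℕ) : F) * invX P‖ ≤ ‖invX P‖ ^ 2 := by
    rw [show ((2 * k + 1 : ℕ) : F) * invX P = (invX (k • P) - (k : F) ^ 2 * invX P) -
      (invX ((k + 1) • P) - ((k + 1 : ℕ) : F) ^ 2 * invX P) by rw [h1]; push_cast; ring]
    exact norm_sub_le_of_le h3 h2
  have h5 : 0 < ‖invX P‖ := norm_pos_iff.2 fun h ↦ hP0 (eq_zero_of_invX_eq_zero hP.1 h)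
  rw [norm_mul, sq] at h4
  exact le_of_mul_le_mul_right h4 h5

lemma InFormal.two_nsmul_ne_zero [DecidableEq F] {P : W.Point} (hP : InFormal P) (hP0 : P ≠ 0)
    (h2 : ‖(2 : F)‖ = 1) : 2 • P ≠ 0 := by
  intro h
  have h3 := (hP.nsmul hW 2).2.2
  have h5 : 0 < ‖invX P‖ := norm_pos_iff.2 fun h ↦ hP0 (eq_zero_of_invX_eq_zero hP.1 h)
  rw [h, invX_zero, zero_sub, norm_neg, norm_mul, norm_pow, Nat.cast_ofNat, h2] at h3
  nlinarith [hP.2]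

/-- Two distinct integral points with the same nonsingular reduction differ by a point reducing to
the point at infinity. -/
lemma inFormal_sub [DecidableEq F] {x₁ y₁ x₂ y₂ : F} (h₁ : W.Nonsingular x₁ y₁)
    (h₂ : W.Nonsingular x₂ y₂) (hx₁ : ‖x₁‖ ≤ 1) (hx₂ : ‖x₂‖ ≤ 1) (hy₁ : ‖y₁‖ ≤ 1)
    (hx : ‖x₁ - x₂‖ < 1) (hy : ‖y₁ - y₂‖ < 1)
    (hns : ‖2 * y₁ + W.a₁ * x₁ + W.a₃‖ = 1 ∨
      ‖3 * x₁ ^ 2 + 2 * W.a₂ * x₁ + W.a₄ - W.a₁ * y₁‖ = 1) :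
    InFormal (some x₁ y₁ h₁ - some x₂ y₂ h₂) := by
  have e₁ := (W.equation_iff x₁ y₁).1 h₁.1
  have e₂ := (W.equation_iff x₂ y₂).1 h₂.1
  -- A nonintegral slope dominates the x-coordinate of the sum through its square, so it suffices to
  -- show that the slope for P - Q is nonintegral.
  have large : ∀ l : F, 1 < ‖l‖ → 1 < ‖W.addX x₁ x₂ l‖ := by
    intro l hl
    have h1 : ‖W.addX x₁ x₂ l - l ^ 2‖ ≤ ‖l‖ := by
      rw [addX, show l ^ 2 + W.a₁ * l - W.a₂ - x₁ - x₂ - l ^ 2 = W.a₁ * l - W.a₂ - x₁ - x₂ by ring]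
      exact norm_sub_le_of_le (norm_sub_le_of_le (norm_sub_le_of_le
        (norm_mul_le_of_le_one_left hW.a₁ le_rfl) (hW.a₂.trans hl.le)) (hx₁.trans hl.le))
        (hx₂.trans hl.le)
    have h2 : ‖W.addX x₁ x₂ l‖ = ‖l ^ 2‖ := by
      have := IsUltrametricDist.norm_eq_of_add_norm_lt_max (x := W.addX x₁ x₂ l) (y := -l ^ 2) (by
        rw [← sub_eq_add_neg, norm_neg]
        refine lt_max_of_lt_right (h1.trans_lt ?_)
        rw [norm_pow]
        nlinarith)
      rwa [norm_neg] at this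
    rw [h2, norm_pow]
    nlinarith
  by_cases heq : some x₁ y₁ h₁ = some x₂ y₂ h₂
  · rw [heq, sub_self]; exact inFormal_zero
  by_cases hxe : x₁ = x₂
  · subst hxe
    have h3 : y₁ = W.negY x₁ y₂ :=
      (Y_eq_of_X_eq h₁.1 h₂.1 rfl).resolve_left fun h ↦ heq (by subst h; rfl)
    have h4 : W.negY x₁ y₂ ≠ W.negY x₁ (W.negY x₁ y₂) := by
      rw [negY_negY]; intro h; exact heq ((some.injEq ..).mpr ⟨rfl, h3.trans h⟩)
    subst h3
    have h5 : W.negY x₁ y₂ - y₂ = 2 * W.negY x₁ y₂ + W.a₁ * x₁ + W.a₃ := by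
      rw [← sub_negY, negY_negY]
    rw [sub_eq_add_neg, neg_some, add_self_of_Y_ne h4, inFormal_some]
    apply large
    rw [slope_of_Y_ne rfl h4, sub_negY, norm_div]
    rw [h5] at hy
    rw [hns.resolve_left hy.ne, one_lt_div (norm_pos_iff.2 _)]
    · exact hy
    · rw [← sub_negY]; exact sub_ne_zero.2 h4
  · rw [sub_eq_add_neg, neg_some, add_of_X_ne hxe, inFormal_some]
    apply large
    rw [slope_of_X_ne hxe, norm_div, one_lt_div (norm_pos_iff.2 (sub_ne_zero.2 hxe)), negY,
      show y₁ - (-y₂ - W.a₁ * x₂ - W.a₃) = y₁ + y₂ + W.a₁ * x₂ + W.a₃ by ring]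
    rcases hns with h | h
    · refine hx.trans_eq (norm_eq_one_of_sub h ?_).symm
      rw [show 2 * y₁ + W.a₁ * x₁ + W.a₃ - (y₁ + y₂ + W.a₁ * x₂ + W.a₃) =
        (y₁ - y₂) + W.a₁ * (x₁ - x₂) by ring]
      refine (IsUltrametricDist.norm_add_le_max _ _).trans_lt (max_lt hy ?_)
      exact (norm_mul_le_of_le_one_left hW.a₁ le_rfl).trans_lt hx
    -- Here only the x-derivative is known to be a unit. The difference of the two equations
    -- expresses x₁ - x₂, up to a unit, as y₁ - y₂ times the numerator of the slope, and y₁ - y₂ is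
    -- small.
    · have h6 : (y₁ - y₂) * (y₁ + y₂ + W.a₁ * x₂ + W.a₃) = (x₁ - x₂) *
          (x₁ ^ 2 + x₁ * x₂ + x₂ ^ 2 + W.a₂ * (x₁ + x₂) + W.a₄ - W.a₁ * y₁) := by
        linear_combination e₁ - e₂
      have h7 : ‖x₁ ^ 2 + x₁ * x₂ + x₂ ^ 2 + W.a₂ * (x₁ + x₂) + W.a₄ - W.a₁ * y₁‖ = 1 := by
        refine norm_eq_one_of_sub h ?_
        rw [show 3 * x₁ ^ 2 + 2 * W.a₂ * x₁ + W.a₄ - W.a₁ * y₁ -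
          (x₁ ^ 2 + x₁ * x₂ + x₂ ^ 2 + W.a₂ * (x₁ + x₂) + W.a₄ - W.a₁ * y₁) =
          (2 * x₁ + x₂ + W.a₂) * (x₁ - x₂) by ring]
        refine (norm_mul_le_of_le_one_left ?_ le_rfl).trans_lt hx
        exact norm_add_le_of_le (norm_add_le_of_le
          (norm_mul_le_one (norm_ofNat_le_one 2) hx₁) hx₂) hW.a₂
      have h8 := congrArg norm h6
      rw [norm_mul, norm_mul, h7, mul_one] at h8
      have h9 : 0 < ‖x₁ - x₂‖ := norm_pos_iff.2 (sub_ne_zero.2 hxe)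
      rw [← h8] at h9 ⊢
      have h10 := pos_of_mul_pos_right h9 (norm_nonneg _)
      exact mul_lt_of_lt_one_left h10 hy

end Nonarchimedean

/-! ### Torsion under reduction at an odd prime -/

section Padic

variable {p : ℕ} [hp : Fact p.Prime]

/-- For large x the equation (2y + a₁x + a₃)² = 4x³ + ⋯ makes three times the valuation of x even.
Over ℚ_p, where valuations are integers, the valuation of x therefore cannot be -1. -/
lemma InFormal.norm_invX_ne {W : WeierstrassCurve.Affine ℚ_[p]} (hW : NormLEOne W) (hp2 : p ≠ 2)
    {P : W.Point} (hP : InFormal P) : ‖invX P‖ ≠ (p : ℝ)⁻¹ := by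
  have hp1 : (1 : ℝ) < p := mod_cast hp.out.one_lt
  match P with
  | 0 =>
    rw [invX_zero, norm_zero]
    exact (inv_pos.2 (zero_lt_one.trans hp1)).ne
  | some x y h =>
    intro hx
    rw [invX_some, norm_inv, inv_inj] at hx
    have hx1 : 1 < ‖x‖ := hx ▸ hp1
    have h4 : ‖(4 : ℚ_[p])‖ = 1 := by
      have := (Padic.norm_natCast_eq_one_iff (p := p) (n := 4)).2
        (((Nat.coprime_primes hp.out Nat.prime_two).2 hp2).pow_right 2)
      exact_mod_cast this
    have h5 : ‖4 * x ^ 3‖ = ‖x‖ ^ 3 := by rw [norm_mul, h4, norm_pow, one_mul]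
    have h6 : ‖W.b₂ * x ^ 2 + (2 * W.b₄) * x + W.b₆‖ ≤ ‖x‖ ^ 2 := by
      have h1 : (1 : ℝ) ≤ ‖x‖ ^ 2 := one_le_pow₀ hx1.le
      refine norm_add_le_of_le (norm_add_le_of_le ?_ ?_) (hW.b₆.trans h1)
      · exact norm_mul_le_of_le_one_left hW.b₂ (norm_pow _ _).le
      · refine (norm_mul_le_of_le_one_left
          (norm_mul_le_one (norm_ofNat_le_one 2) hW.b₄) le_rfl).trans ?_
        nlinarith
    have h7 : ‖2 * y + W.a₁ * x + W.a₃‖ ^ 2 = ‖x‖ ^ 3 := by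
      rw [← norm_pow, sq_two_mul_add h.1, ← h5]
      rw [show 4 * x ^ 3 + W.b₂ * x ^ 2 + 2 * W.b₄ * x + W.b₆ = 4 * x ^ 3 +
        (W.b₂ * x ^ 2 + (2 * W.b₄) * x + W.b₆) by ring]
      have hlt : ‖W.b₂ * x ^ 2 + (2 * W.b₄) * x + W.b₆‖ < ‖4 * x ^ 3‖ := by
        rw [h5]
        refine h6.trans_lt ?_
        exact pow_lt_pow_right₀ hx1 (by norm_num)
      rw [IsUltrametricDist.norm_add_eq_max_of_norm_ne_norm hlt.ne', max_eq_left hlt.le]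
    have hn := Padic.norm_eq_zpow_neg_valuation
      (p := p) (x := 2 * y + W.a₁ * x + W.a₃) (by
        intro h0
        rw [h0, norm_zero] at h7
        have : 0 < ‖x‖ ^ 3 := by positivity
        rw [← h7] at this
        norm_num at this)
    rw [hn, hx, ← zpow_natCast, ← zpow_mul, ← zpow_natCast] at h7
    have := zpow_right_injective₀ (zero_lt_one.trans hp1) hp1.ne' h7
    push_cast at this
    omega

/-- A multiple of P has prime order q. For q ≠ p the estimates contradict that q is a unit; for q =
p they force ‖u‖ = 1/p, which the parity of the valuation excludes. -/
lemma InFormal.eq_zero_of_isOfFinAddOrder [DecidableEq ℚ_[p]] {W : WeierstrassCurve.Affine ℚ_[p]} (hW : NormLEOne W)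
    (hp2 : p ≠ 2) {P : W.Point} (hP : InFormal P) (hfin : IsOfFinAddOrder P) : P = 0 := by
  by_contra hP0
  have hn : 0 < addOrderOf P := hfin.addOrderOf_pos
  have hn1 : addOrderOf P ≠ 1 := by rwa [Ne, AddMonoid.addOrderOf_eq_one_iff]
  set q := (addOrderOf P).minFac with hq
  have hqp : q.Prime := Nat.minFac_prime hn1
  obtain ⟨m, hm⟩ := Nat.minFac_dvd (addOrderOf P)
  have hR := (hP.nsmul hW m).1
  have hm0 : 0 < m := Nat.pos_of_ne_zero fun h ↦ by rw [h] at hm; omega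
  have hR0 : m • P ≠ 0 := by
    intro h
    have h1 := Nat.le_of_dvd hm0 (addOrderOf_dvd_of_nsmul_eq_zero h)
    have := hqp.two_le
    rw [← hq] at hm
    nlinarith
  have hqR : q • (m • P) = 0 := by rw [← mul_nsmul', ← hm, addOrderOf_nsmul_eq_zero]
  rcases hqp.eq_two_or_odd' with h2 | ⟨k, hk⟩
  · refine hR.two_nsmul_ne_zero hW hR0 ?_ (h2 ▸ hqR)
    have := (Padic.norm_natCast_eq_one_iff (p := p) (n := 2)).2
      ((Nat.coprime_primes hp.out Nat.prime_two).2 hp2)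
    exact_mod_cast this
  · have h3 := hR.norm_natCast_le hW hR0 k (hk ▸ hqR)
    rw [← hk] at h3
    by_cases hpq : q = p
    · rw [hpq, Padic.norm_p] at h3
      have hn := Padic.norm_eq_zpow_neg_valuation (p := p) (x := invX (m • P))
        fun h ↦ hR0 (eq_zero_of_invX_eq_zero hR.1 h)
      have hp1 : (1 : ℝ) < p := mod_cast hp.out.one_lt
      have h4 := hR.2
      have h5 := hR.norm_invX_ne hW hp2
      rw [hn] at h3 h4 h5
      rw [← zpow_neg_one] at h3 h5
      rw [← zpow_zero (p : ℝ)] at h4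
      have h6 := (zpow_le_zpow_iff_right₀ hp1).1 h3
      have h7 := (zpow_lt_zpow_iff_right₀ hp1).1 h4
      exact h5 (by congr 1; omega)
    · rw [Padic.norm_natCast_eq_one_iff.2 ((Nat.coprime_primes hp.out hqp).2 (Ne.symm hpq))] at h3
      exact absurd hR.2 h3.not_gt

lemma norm_Y_le_one {F : Type*} [NormedField F] [IsUltrametricDist F] {W : WeierstrassCurve.Affine F}
    (hW : NormLEOne W) {x y : F} (h : W.Equation x y) (hx : ‖x‖ ≤ 1) : ‖y‖ ≤ 1 := by
  by_contra! hy
  have h1 := (W.equation_iff x y).1 h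
  have h2 : y ^ 2 = x ^ 3 + W.a₂ * x ^ 2 + W.a₄ * x + W.a₆ - (W.a₁ * x + W.a₃) * y := by
    linear_combination h1
  have h3 : ‖y ^ 2‖ ≤ ‖y‖ := by
    rw [h2]
    refine norm_sub_le_of_le ((norm_add_le_of_le (norm_add_le_of_le (norm_add_le_of_le ?_ ?_) ?_)
      hW.a₆).trans hy.le) ?_
    · exact norm_pow_le_one' hx 3
    · exact norm_mul_le_one hW.a₂ (norm_pow_le_one' hx 2)
    · exact norm_mul_le_one hW.a₄ hx
    · exact norm_mul_le_of_le_one_left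
        (norm_add_le_of_le (norm_mul_le_one hW.a₁ hx) hW.a₃) le_rfl
  rw [norm_pow] at h3
  nlinarith

lemma normLEOne_map (W : WeierstrassCurve ℤ_[p]) :
    NormLEOne (W.map (algebraMap ℤ_[p] ℚ_[p])) where
  a₁ := W.a₁.2
  a₂ := W.a₂.2
  a₃ := W.a₃.2
  a₄ := W.a₄.2
  a₆ := W.a₆.2

lemma equation_of_map (W : WeierstrassCurve ℤ_[p]) {x y : ℤ_[p]}
    (h : (W.map (algebraMap ℤ_[p] ℚ_[p])).toAffine.Equation x y) :
    (W.map PadicInt.toZMod).toAffine.Equation (PadicInt.toZMod x) (PadicInt.toZMod y) :=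
  Equation.map PadicInt.toZMod
    ((map_equation W (f := algebraMap ℤ_[p] ℚ_[p]) (IsFractionRing.injective _ _) x y).1 h)

/-- Torsion injects under good reduction at an odd prime. -/
theorem exists_injective_reduction [DecidableEq ℚ_[p]] (W : WeierstrassCurve ℤ_[p]) (hp2 : p ≠ 2)
    (hns : ∀ x y : ZMod p, (W.map PadicInt.toZMod).toAffine.Equation x y →
      (W.map PadicInt.toZMod).toAffine.Nonsingular x y) :
    ∃ f : AddCommGroup.torsion (W.map (algebraMap ℤ_[p] ℚ_[p])).toAffine.Point →
      Option {xy : ZMod p × ZMod p // (W.map PadicInt.toZMod).toAffine.Equation xy.1 xy.2},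
      Function.Injective f := by
  classical
  have hW := normLEOne_map W
  let f : (W.map (algebraMap ℤ_[p] ℚ_[p])).toAffine.Point →
      Option {xy : ZMod p × ZMod p // (W.map PadicInt.toZMod).toAffine.Equation xy.1 xy.2} :=
    fun P ↦ match P with
    | 0 => none
    | some x y h => if hx : ‖x‖ ≤ 1 then
        Option.some ⟨(PadicInt.toZMod ⟨x, hx⟩, PadicInt.toZMod ⟨y, norm_Y_le_one hW h.1 hx⟩),
          equation_of_map W h.1⟩
      else none
  have hnone : ∀ P, f P = none → InFormal P := by
    intro P hP
    match P with
    | 0 => exact inFormal_zero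
    | some x y h =>
      rw [inFormal_some]
      by_contra! hx
      simp [f, hx] at hP
  -- Equal reductions put P - Q near infinity, where there is no nonzero torsion. Hence f need not
  -- be known to be additive.
  have key : ∀ P Q, f P = f Q → IsOfFinAddOrder P → IsOfFinAddOrder Q → InFormal (P - Q) := by
    intro P Q hPQ hPt hQt
    by_cases hP : f P = none
    · rw [InFormal.eq_zero_of_isOfFinAddOrder hW hp2 (hnone P hP) hPt,
        InFormal.eq_zero_of_isOfFinAddOrder hW hp2 (hnone Q (hPQ ▸ hP)) hQt, sub_zero]
      exact inFormal_zero
    match P, Q with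
    | 0, _ => exact absurd rfl hP
    | some x₁ y₁ h₁, 0 => exact absurd hPQ hP
    | some x₁ y₁ h₁, some x₂ y₂ h₂ =>
      have hx₁ : ‖x₁‖ ≤ 1 := by
        by_contra h
        exact hP (by simp [f, h])
      have hx₂ : ‖x₂‖ ≤ 1 := by
        by_contra h
        exact hP (by rw [hPQ]; simp [f, h])
      have hy₁ := norm_Y_le_one hW h₁.1 hx₁
      have hy₂ := norm_Y_le_one hW h₂.1 hx₂
      obtain ⟨X₁, rfl⟩ : ∃ X : ℤ_[p], (X : ℚ_[p]) = x₁ := ⟨⟨x₁, hx₁⟩, rfl⟩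
      obtain ⟨Y₁, rfl⟩ : ∃ Y : ℤ_[p], (Y : ℚ_[p]) = y₁ := ⟨⟨y₁, hy₁⟩, rfl⟩
      obtain ⟨X₂, rfl⟩ : ∃ X : ℤ_[p], (X : ℚ_[p]) = x₂ := ⟨⟨x₂, hx₂⟩, rfl⟩
      obtain ⟨Y₂, rfl⟩ : ∃ Y : ℤ_[p], (Y : ℚ_[p]) = y₂ := ⟨⟨y₂, hy₂⟩, rfl⟩
      simp only [f, dif_pos hx₁, dif_pos hx₂, Option.some.injEq, Subtype.mk.injEq,
        Prod.mk.injEq] at hPQ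
      have t2 : PadicInt.toZMod (2 : ℤ_[p]) = 2 := map_ofNat PadicInt.toZMod 2
      have t3 : PadicInt.toZMod (3 : ℤ_[p]) = 3 := map_ofNat PadicInt.toZMod 3
      have c2 : ((2 : ℤ_[p]) : ℚ_[p]) = 2 := rfl
      have c3 : ((3 : ℤ_[p]) : ℚ_[p]) = 3 := rfl
      have hlt : ∀ a b : ℤ_[p], PadicInt.toZMod a = PadicInt.toZMod b →
          ‖(a : ℚ_[p]) - b‖ < 1 := by
        intro a b hab
        have h0 : a - b ∈ RingHom.ker (PadicInt.toZMod (p := p)) := by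
          rw [RingHom.mem_ker, map_sub, hab, sub_self]
        rwa [PadicInt.ker_toZMod, IsLocalRing.mem_maximalIdeal, PadicInt.mem_nonunits,
          PadicInt.norm_def, PadicInt.coe_sub] at h0
      have hone : ∀ a : ℤ_[p], PadicInt.toZMod a ≠ 0 → ‖(a : ℚ_[p])‖ = 1 := by
        intro a ha
        have h0 : a ∉ RingHom.ker (PadicInt.toZMod (p := p)) := ha
        rw [PadicInt.ker_toZMod, IsLocalRing.mem_maximalIdeal, PadicInt.mem_nonunits] at h0
        exact le_antisymm a.2 (not_lt.1 h0)
      refine inFormal_sub hW h₁ h₂ hx₁ hx₂ hy₁ (hlt X₁ X₂ hPQ.1) (hlt Y₁ Y₂ hPQ.2) ?_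
      have h3 := hns _ _ (equation_of_map W h₁.1)
      rw [nonsingular_iff'] at h3
      rcases h3.2 with h4 | h4
      · right
        have h5 := hone (3 * X₁ ^ 2 + 2 * W.a₂ * X₁ + W.a₄ - W.a₁ * Y₁) (by
          intro h6
          apply h4
          simp [t2, t3] at h6 ⊢
          linear_combination -h6)
        simpa [c2, c3] using h5
      · left
        have h5 := hone (2 * Y₁ + W.a₁ * X₁ + W.a₃) (by
          intro h6
          apply h4
          simpa [t2] using h6)
        simpa [c2] using h5
  refine ⟨fun P ↦ f P.1, fun P Q hPQ ↦ ?_⟩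
  have h1 := key P.1 Q.1 hPQ P.2 Q.2
  exact Subtype.ext (sub_eq_zero.1
    (InFormal.eq_zero_of_isOfFinAddOrder hW hp2 h1 (AddSubgroup.sub_mem _ P.2 Q.2)))

end Padic

end WeierstrassCurve.Affine.Point

/-! ### Heights and infinite descent -/

section

namespace WeierstrassCurve.Affine.Point

open Height

variable {K : Type*} [Field K] [DecidableEq K] [NumberField K] {W : WeierstrassCurve.Affine K}

/-- The naive height of a point is nonnegative, and satisfies the approximate parallelogram law. -/
theorem exists_abs_logHeight_xRep_parallelogram [W.IsElliptic] :
    ∃ C : ℝ, ∀ P Q : W.Point, |logHeight (P + Q).xRep + logHeight (P - Q).xRep -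
      2 * (logHeight P.xRep + logHeight Q.xRep)| ≤ C := by
  obtain ⟨C₁, h₁⟩ := abs_logHeight_addSubMap_sub_two_mul_logHeight_le W
  obtain ⟨C₂, h₂⟩ := abs_logHeight_sym2_sub_le K
  have eta : ∀ P : W.Point, ![P.xRep 0, P.xRep 1] = P.xRep := fun P ↦ by
    ext i; fin_cases i <;> rfl
  have h₃ : ∀ P Q : W.Point,
      |logHeight (P.sym2x Q) - (logHeight P.xRep + logHeight Q.xRep)| ≤ C₂ := fun P Q ↦ by
    have := h₂ (by rw [eta]; exact xRep_ne_zero P) (by rw [eta]; exact xRep_ne_zero Q)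
      (a := P.xRep 0) (b := P.xRep 1) (c := Q.xRep 0) (d := Q.xRep 1)
    rwa [eta, eta] at this
  refine ⟨C₁ + 3 * C₂, fun P Q ↦ ?_⟩
  obtain ⟨c, hc, h⟩ := exists_addSubMap_eval_sym2x P Q
  have h4 := h₁ (P.sym2x Q)
  rw [h, logHeight_smul_eq_logHeight _ hc] at h4
  have h5 := h₃ P Q
  have h6 := h₃ (P + Q) (P - Q)
  rw [abs_le] at *
  constructor <;> linarith [h4.1, h4.2, h5.1, h5.2, h6.1, h6.2]

/-- Northcott's property leaves finitely many x, and the points over a given x are P and -P. -/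
theorem finite_logHeight_xRep_le (B : ℝ) : {P : W.Point | logHeight P.xRep ≤ B}.Finite := by
  have hfin : {x : K | logHeight₁ x ≤ B}.Finite := Northcott.finite_le B
  have h2 : {v : Fin 2 → K | ∃ x, logHeight₁ x ≤ B ∧ v = ![x, 1]}.Finite := by
    refine (hfin.image fun x ↦ ![x, 1]).subset ?_
    rintro v ⟨x, hx, rfl⟩
    exact ⟨x, hx, rfl⟩
  refine Set.Finite.of_finite_fibers (fun P : W.Point ↦ P.xRep) ?_ ?_
  · refine (h2.union (Set.finite_singleton ![1, 0])).subset ?_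
    rintro _ ⟨P, hP, rfl⟩
    match P with
    | 0 => exact .inr rfl
    | some x y h =>
      refine .inl ⟨x, ?_, rfl⟩
      rw [logHeight₁_eq_logHeight]
      exact hP
  · rintro _ ⟨P, hP, rfl⟩
    refine (Set.toFinite {P, -P}).subset ?_
    rintro Q ⟨_, hQ⟩
    exact xRep_eq_xRep_iff.1 hQ

end WeierstrassCurve.Affine.Point

/-- Infinite descent: let `h` be a height on an abelian group, and let `G` be a subgroup every
element of which is twice an element of `G` up to finitely many elements of a saturated
subgroup `S`. Then `G` is contained in `S`. -/
theorem AddSubgroup.le_of_descent {A : Type*} [AddCommGroup A] (h : A → ℝ) (h0 : ∀ P, 0 ≤ h P)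
    (hpar : ∃ C : ℝ, ∀ P Q, |h (P + Q) + h (P - Q) - 2 * (h P + h Q)| ≤ C)
    (hfin : ∀ B : ℝ, {P | h P ≤ B}.Finite) {G S : AddSubgroup A}
    (hS : ∀ (n : ℕ) (P : A), n ≠ 0 → n • P ∈ S → P ∈ S) {T : Set A} (hT : T.Finite) (hTS : T ⊆ S)
    (hdesc : ∀ P ∈ G, ∃ R ∈ G, ∃ t ∈ T, P = t + 2 • R) : G ≤ S := by
  by_contra hGS
  obtain ⟨P₀, hP₀G, hP₀S⟩ := SetLike.not_le_iff_exists.1 hGS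
  obtain ⟨C, hC⟩ := hpar
  obtain ⟨D, hD⟩ : ∃ D : ℝ, ∀ t ∈ T, h t ≤ D := (hT.image h).bddAbove.imp fun D hD t ht ↦
    hD ⟨t, ht, rfl⟩
  choose! f hfG t htT hft using hdesc
  -- The parallelogram law gives 4h(R) ≤ h(2R) + O(1) and h(P - t) ≤ 2h(P) + O(1), hence a
  -- contraction by 1/2.
  have hstep : ∀ P ∈ G, h (f P) ≤ h P / 2 + (|C| / 2 + |D| / 2 + h 0 / 4) := by
    intro P hP
    have h1 := abs_le.1 (hC (f P) (f P))
    have h2 := abs_le.1 (hC P (t P))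
    have h3 : f P + f P = P - t P := by
      rw [← two_nsmul]; nth_rewrite 2 [hft P hP]; abel
    rw [h3, sub_self] at h1
    have h4 := hD _ (htT P hP)
    linarith [h0 (P + t P), le_abs_self C, le_abs_self D, abs_nonneg C, abs_nonneg D, h0 0]
  set E := |C| / 2 + |D| / 2 + h 0 / 4 with hE
  -- The value 2E is the fixed point of s ↦ s/2 + E, so the whole orbit of P₀ stays below B.
  set B := max (h P₀) (2 * E)
  have hmem : ∀ n : ℕ, f^[n] P₀ ∈ G ∧ f^[n] P₀ ∉ S ∧ h (f^[n] P₀) ≤ B := by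
    intro n
    induction n with
    | zero => exact ⟨hP₀G, hP₀S, le_max_left _ _⟩
    | succ n ih =>
      rw [Function.iterate_succ_apply']
      obtain ⟨h1, h2, h3⟩ := ih
      refine ⟨hfG _ h1, fun h4 ↦ h2 ?_, (hstep _ h1).trans ?_⟩
      · rw [hft _ h1]
        exact S.add_mem (hTS (htT _ h1)) (S.nsmul_mem h4 2)
      · have : 2 * E ≤ B := le_max_right _ _
        linarith
  have hiter : ∀ n k : ℕ, f^[n] P₀ - 2 ^ k • f^[n + k] P₀ ∈ S := by
    intro n k
    induction k with
    | zero => simp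
    | succ k ih =>
      have h1 := hft _ (hmem (n + k)).1
      have h2 : f^[n] P₀ - 2 ^ (k + 1) • f^[n + (k + 1)] P₀ =
          (f^[n] P₀ - 2 ^ k • f^[n + k] P₀) + 2 ^ k • t (f^[n + k] P₀) := by
        rw [← add_assoc, Function.iterate_succ_apply', pow_succ, mul_nsmul']
        nth_rewrite 2 [h1]
        rw [nsmul_add]
        abel
      rw [h2]
      exact S.add_mem ih (S.nsmul_mem (hTS (htT _ (hmem _).1)) _)
  -- The orbit lies in a finite set, so it repeats. Going once around the cycle puts (2^(k+1) - 1)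
  -- times an orbit point in S, and saturation then contradicts the choice of P₀.
  obtain ⟨i, j, hij, heq⟩ : ∃ i j : ℕ, i < j ∧ f^[i] P₀ = f^[j] P₀ := by
    have := (hfin B).to_subtype
    obtain ⟨i, j, hne, heq⟩ := Finite.exists_ne_map_eq_of_infinite
      (fun n : ℕ ↦ (⟨f^[n] P₀, (hmem n).2.2⟩ : {P | h P ≤ B}))
    rw [Subtype.mk.injEq] at heq
    rcases hne.lt_or_gt with h | h
    · exact ⟨i, j, h, heq⟩
    · exact ⟨j, i, h, heq.symm⟩
  obtain ⟨k, rfl⟩ := Nat.exists_eq_add_of_lt hij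
  have h1 := hiter i (k + 1)
  rw [← add_assoc, ← heq] at h1
  refine (hmem i).2.1 (hS (2 ^ (k + 1) - 1) _ ?_ ?_)
  · have : 2 ≤ 2 ^ (k + 1) := by rw [pow_succ]; have := Nat.one_le_two_pow (n := k); omega
    omega
  · rw [sub_nsmul _ Nat.one_le_two_pow, one_nsmul, ← sub_eq_add_neg, ← neg_sub]
    exact S.neg_mem h1

end

/-! ### The 2-descent over ℚ on d y² = x³ + x² - x -/

/-- First step of descent by a `2`-isogeny: the square class of the `x`-coordinate. -/
theorem exists_squarefree_of_sq_eq_mul {a b : ℤ} {x y : ℚ} (hx : x ≠ 0)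
    (h : y ^ 2 = x * (x ^ 2 + a * x + b)) :
    ∃ c k e t : ℤ, Squarefree c ∧ c ∣ b ∧ e ≠ 0 ∧ k ≠ 0 ∧ IsCoprime k e ∧ IsCoprime c e ∧
      x = c * k ^ 2 / e ^ 2 ∧ c ^ 2 * k ^ 4 + a * c * k ^ 2 * e ^ 2 + b * e ^ 4 = c * t ^ 2 := by
  set m := x.num with hm
  set n : ℤ := (x.den : ℤ) with hn
  have hn0 : (n : ℚ) ≠ 0 := by simp [hn]
  have hn0' : 0 < n := by simp [hn, x.den_pos]
  have hm0 : m ≠ 0 := Rat.num_ne_zero.2 hx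
  have hxmn : x = m / n := by simp [hm, hn, Rat.num_div_den]
  have hcop : IsCoprime m n := by
    rw [Int.isCoprime_iff_nat_coprime]
    simpa [hm, hn] using x.reduced
  obtain ⟨z, hz⟩ : ∃ z : ℤ, (z : ℚ) = y * n ^ 2 := by
    have h1 : IsSquare (((n * (m * (m ^ 2 + a * m * n + b * n ^ 2)) : ℤ)) : ℚ) := by
      refine ⟨y * n ^ 2, ?_⟩
      rw [← sq, mul_pow, h, hxmn]
      push_cast
      field_simp
    rw [Rat.isSquare_intCast_iff] at h1
    obtain ⟨z, hz⟩ := h1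
    have h2 : (z : ℚ) ^ 2 = (y * n ^ 2) ^ 2 := by
      rw [mul_pow, h, hxmn, sq, ← Int.cast_mul, ← hz]
      push_cast
      field_simp
    rcases sq_eq_sq_iff_eq_or_eq_neg.1 h2 with h3 | h3
    · exact ⟨z, h3⟩
    · exact ⟨-z, by push_cast; linear_combination -h3⟩
  have hz2 : n * (m * (m ^ 2 + a * m * n + b * n ^ 2)) = z ^ 2 := by
    have : ((n * (m * (m ^ 2 + a * m * n + b * n ^ 2)) : ℤ) : ℚ) = (z ^ 2 : ℤ) := by
      push_cast
      rw [hz, mul_pow, h, hxmn]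
      field_simp
    exact_mod_cast this
  have hcop2 : IsCoprime n (m * (m ^ 2 + a * m * n + b * n ^ 2)) := by
    refine hcop.symm.mul_right ?_
    rw [show m ^ 2 + a * m * n + b * n ^ 2 = m ^ 2 + n * (a * m + b * n) by ring]
    exact (hcop.symm.pow_right).add_mul_left_right _
  -- The denominator n is coprime to its cofactor in a square and is positive, so it is itself a
  -- square.
  obtain ⟨e, he⟩ : ∃ e : ℤ, n = e ^ 2 := by
    obtain ⟨e, he | he⟩ := Int.sq_of_isCoprime hcop2 hz2
    · exact ⟨e, he⟩
    · nlinarith [sq_nonneg e]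
  have he0 : e ≠ 0 := by rintro rfl; simp [he] at hn0'
  have hcope : IsCoprime m e := by
    rw [he] at hcop
    exact hcop.of_isCoprime_of_dvd_right (dvd_pow_self e two_ne_zero)
  obtain ⟨z₁, rfl⟩ : e ∣ z := by
    rw [← Int.pow_dvd_pow_iff two_ne_zero, ← hz2, he]
    exact dvd_mul_right _ _
  have hz₁ : m * (m ^ 2 + a * m * n + b * n ^ 2) = z₁ ^ 2 := by
    rw [mul_pow, ← he] at hz2
    exact mul_left_cancel₀ hn0'.ne' hz2
  obtain ⟨c, k, hc, hmk⟩ : ∃ c k : ℤ, Squarefree c ∧ m = c * k ^ 2 := by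
    obtain ⟨c, k, h1, h2⟩ := Nat.sq_mul_squarefree m.natAbs
    rcases Int.natAbs_eq m with h3 | h3
    · exact ⟨c, k, Int.squarefree_natCast.2 h2, by rw [h3, ← h1]; push_cast; ring⟩
    · exact ⟨-c, k, by rwa [← Int.squarefree_natAbs, Int.natAbs_neg, Int.natAbs_natCast], by rw [h3, ← h1]; push_cast; ring⟩
  have hk0 : k ≠ 0 := by rintro rfl; simp at hmk; exact hm0 hmk
  have hc0 : c ≠ 0 := hc.ne_zero
  obtain ⟨z₂, rfl⟩ : k ∣ z₁ := by
    rw [← Int.pow_dvd_pow_iff two_ne_zero, ← hz₁, hmk]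
    exact ⟨c * ((c * k ^ 2) ^ 2 + a * (c * k ^ 2) * n + b * n ^ 2), by ring⟩
  have hz₂ : c * (m ^ 2 + a * m * n + b * n ^ 2) = z₂ ^ 2 := by
    apply mul_left_cancel₀ (pow_ne_zero 2 hk0)
    linear_combination hz₁ - (m ^ 2 + a * m * n + b * n ^ 2) * hmk
  obtain ⟨t, rfl⟩ : c ∣ z₂ := (hc.dvd_pow_iff_dvd two_ne_zero).1 (hz₂ ▸ dvd_mul_right _ _)
  have ht : m ^ 2 + a * m * n + b * n ^ 2 = c * t ^ 2 := by
    apply mul_left_cancel₀ hc0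
    rw [hz₂]; ring
  have hce : IsCoprime c e := hcope.of_isCoprime_of_dvd_left (hmk ▸ dvd_mul_right _ _)
  refine ⟨c, k, e, t, hc, ?_, he0, hk0, ?_, hce, ?_, ?_⟩
  · have h1 : c ∣ b * n ^ 2 := by
      rw [show b * n ^ 2 = c * (t ^ 2 - k ^ 2 * (m + a * n)) by
        rw [mul_sub, ← ht, ← mul_assoc, ← hmk]; ring]
      exact dvd_mul_right _ _
    rw [he, ← pow_mul] at h1
    exact hce.pow_right.dvd_of_dvd_mul_right h1
  · exact hcope.of_isCoprime_of_dvd_left (hmk ▸ Dvd.intro_left (c * k) (by ring))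
  · rw [hxmn, he, hmk]; push_cast; ring
  · rw [← ht, he, hmk]; ring

/-- The polynomial identity bounding the common factors in the duplication formula. -/
theorem sq_add_sq_sq_dvd {r s m n : ℤ} (hrs : IsCoprime r s)
    (h : m * (4 * r * s * (r ^ 2 + r * s - s ^ 2)) = n * (r ^ 2 + s ^ 2) ^ 2) :
    (r ^ 2 + s ^ 2) ^ 2 ∣ 100 * m := by
  have key : ∀ r s : ℤ, m * (4 * r * s * (r ^ 2 + r * s - s ^ 2)) = n * (r ^ 2 + s ^ 2) ^ 2 →
      (r ^ 2 + s ^ 2) ^ 2 ∣ 100 * m * s ^ 8 := by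
    intro r s h
    refine ⟨4 * s * ((7 * s - r) ^ 2 * s - 10 * s ^ 3 - 2 * (7 * s - r) * (r ^ 2 + s ^ 2)) * m +
      (2 * r - s) * (-r ^ 3 + 7 * r ^ 2 * s - r * s ^ 2 + 12 * s ^ 3) * n, ?_⟩
    linear_combination (2 * r - s) * (-r ^ 3 + 7 * r ^ 2 * s - r * s ^ 2 + 12 * s ^ 3) * h
  have h1 := key r s h
  have h2 := key s (-r) (by linear_combination h)
  rw [show s ^ 2 + (-r) ^ 2 = r ^ 2 + s ^ 2 by ring, show (-r) ^ 8 = r ^ 8 by ring] at h2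
  obtain ⟨u, v, huv⟩ := (hrs.pow (m := 8) (n := 8))
  have h3 : 100 * m = u * (100 * m * r ^ 8) + v * (100 * m * s ^ 8) := by
    linear_combination (-100 * m) * huv
  rw [h3]
  exact dvd_add (h2.mul_left u) (h1.mul_left v)

/-- The local conditions which make the `2`-descent on `d y² = x³ + x² - x` trivial. -/
structure TrivialDescent (d : ℤ) : Prop where
  ne_zero : d ≠ 0
  left : ∀ {c k e t : ℤ}, Squarefree c → c ∣ -d ^ 2 → IsCoprime k e → IsCoprime c e →
    c ^ 2 * k ^ 4 + d * c * k ^ 2 * e ^ 2 + -d ^ 2 * e ^ 4 = c * t ^ 2 → c = 1 ∨ c = -1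
  right : ∀ {c k e t : ℤ}, Squarefree c → c ∣ 5 * d ^ 2 → IsCoprime k e → IsCoprime c e →
    c ^ 2 * k ^ 4 + (-2 * d) * c * k ^ 2 * e ^ 2 + 5 * d ^ 2 * e ^ 4 = c * t ^ 2 → 0 < c →
    c = 1 ∨ c = 5

/-- The height of a rational number. -/
def Rat.height (x : ℚ) : ℕ := max x.num.natAbs x.den

/-- The substitution X = dx, Y = d²v gives Y² = X(X² + dX - d²), and `hd.left` leaves only the
square classes ±1 for X. -/
theorem eq_sq_or_neg_sq {d : ℤ} (hd : TrivialDescent d) {x v : ℚ} (hx : x ≠ 0)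
    (h : d * v ^ 2 = x ^ 3 + x ^ 2 - x) : ∃ w : ℚ, d * x = w ^ 2 ∨ d * x = -w ^ 2 := by
  have hd0 : (d : ℚ) ≠ 0 := mod_cast hd.ne_zero
  obtain ⟨c, k, e, t, hc, hcb, he, hk, hke, hce, hx', ht⟩ :=
    exists_squarefree_of_sq_eq_mul (a := d) (b := -d ^ 2) (x := d * x) (y := d ^ 2 * v)
      (mul_ne_zero hd0 hx) (by push_cast; linear_combination d ^ 3 * h)
  rcases hd.left hc hcb hke hce ht with rfl | rfl
  · exact ⟨k / e, .inl (by rw [hx']; push_cast; ring)⟩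
  · exact ⟨k / e, .inr (by rw [hx']; push_cast; ring)⟩

/-- Twice the slope parameter of a point with square `x`-coordinate lies on the isogenous curve. -/
theorem exists_squarefree_of_isogenous {d : ℤ} (hd0 : d ≠ 0) {w z : ℚ}
    (h : z ^ 2 = w ^ 4 + d * w ^ 2 - d ^ 2) :
    ∃ c k e t : ℤ, Squarefree c ∧ c ∣ 5 * d ^ 2 ∧ IsCoprime k e ∧ IsCoprime c e ∧
      c ^ 2 * k ^ 4 + (-2 * d) * c * k ^ 2 * e ^ 2 + 5 * d ^ 2 * e ^ 4 = c * t ^ 2 ∧ 0 < c ∧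
      e ≠ 0 ∧ k ≠ 0 ∧ 2 * w ^ 2 + d + 2 * z = c * k ^ 2 / e ^ 2 := by
  have hd0' : (d : ℚ) ≠ 0 := mod_cast hd0
  have h5 : (2 * w ^ 2 + d + 2 * z) * (2 * w ^ 2 + d - 2 * z) = 5 * d ^ 2 := by
    linear_combination -4 * h
  have hX : 2 * w ^ 2 + d + 2 * z ≠ 0 := by
    intro h0
    rw [h0, zero_mul] at h5
    exact mul_ne_zero (by norm_num) (pow_ne_zero 2 hd0') h5.symm
  obtain ⟨c, k, e, t, hc, hcb, he, hk, hke, hce, hx', ht⟩ :=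
    exists_squarefree_of_sq_eq_mul (a := -2 * d) (b := 5 * d ^ 2)
      (y := 2 * w * (2 * w ^ 2 + d + 2 * z)) hX (by
        push_cast
        linear_combination (-4 * (2 * w ^ 2 + d + 2 * z)) * h)
  refine ⟨c, k, e, t, hc, hcb, hke, hce, ht, ?_, he, hk, hx'⟩
  -- The isogenous quadratic X² - 2dX + 5d² = (X - d)² + 4d² is positive definite, so negative
  -- classes do not occur.
  have h6 : 0 < c * t ^ 2 := by
    rw [← ht, show c ^ 2 * k ^ 4 + -2 * d * c * k ^ 2 * e ^ 2 + 5 * d ^ 2 * e ^ 4 =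
      (c * k ^ 2 - d * e ^ 2) ^ 2 + 4 * (d * e ^ 2) ^ 2 by ring]
    have : d * e ^ 2 ≠ 0 := mul_ne_zero hd0 (pow_ne_zero 2 he)
    positivity
  exact pos_of_mul_pos_left h6 (sq_nonneg t)

/-- An explicit half of a point of the curve `d y² = x³ + x² - x`. -/
theorem exists_half_of_sq {d : ℚ} (hd : d ≠ 0) {w z u : ℚ}
    (h : z ^ 2 = w ^ 4 + d * w ^ 2 - d ^ 2) (hu : 2 * w ^ 2 + d + 2 * z = u ^ 2) :
    ∃ x v : ℚ, x ≠ 0 ∧ v ≠ 0 ∧ d * v ^ 2 = x ^ 3 + x ^ 2 - x ∧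
      w ^ 2 / d * (4 * (x ^ 3 + x ^ 2 - x)) = (x ^ 2 + 1) ^ 2 := by
  have h5 : (2 * w ^ 2 + d + 2 * z) * (2 * w ^ 2 + d - 2 * z) = 5 * d ^ 2 := by
    linear_combination -4 * h
  have hu0 : u ≠ 0 := by
    rintro rfl
    rw [hu] at h5
    simp at h5
    exact hd h5
  have hz : z = (u ^ 2 - 2 * w ^ 2 - d) / 2 := by linear_combination (1 / 2) * hu
  have h6 : u ^ 4 - 4 * u ^ 2 * w ^ 2 - 2 * d * u ^ 2 + 5 * d ^ 2 = 0 := by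
    rw [hz] at h
    linear_combination 4 * h
  -- The line Y = uX through the 2-torsion point meets Y² = X(X² + dX - d²) where X² - (u² - d)X -
  -- d² = 0. By `h6` its discriminant is (2wu)², and this X is one of its roots.
  obtain ⟨X, hX⟩ : ∃ X, X = (u ^ 2 - d) / 2 + w * u := ⟨_, rfl⟩
  have h7 : X ^ 2 + d * X - d ^ 2 = u ^ 2 * X := by
    rw [hX]; linear_combination (-1 / 4) * h6
  have hX0 : X ≠ 0 := by
    rintro rfl
    simp at h7
    exact hd h7
  have h8 : X ^ 2 + d ^ 2 = 2 * w * u * X := by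
    linear_combination -h7 + 2 * X * hX
  refine ⟨X / d, X * u / d ^ 2, div_ne_zero hX0 hd, div_ne_zero (mul_ne_zero hX0 hu0)
    (pow_ne_zero 2 hd), ?_, ?_⟩
  · field_simp
    linear_combination -h7
  · have e1 : (X / d) ^ 3 + (X / d) ^ 2 - X / d = u ^ 2 * X ^ 2 / d ^ 3 := by
      field_simp
      linear_combination h7
    have e2 : (X / d) ^ 2 + 1 = 2 * w * u * X / d ^ 2 := by
      field_simp
      linear_combination h8
    rw [e1, e2]
    field_simp
    ring

/-- A negative square class of dx is made positive by adding (0, 0), i.e. x ↦ -1/x. The isogenous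
class 5 is turned into 1 by z ↦ -z, because the two conjugate factors multiply to 5d². -/
theorem exists_half {d : ℤ} (hd : TrivialDescent d) {x v : ℚ} (hx : x ≠ 0)
    (h : d * v ^ 2 = x ^ 3 + x ^ 2 - x) :
    ∃ x₁ v₁ : ℚ, x₁ ≠ 0 ∧ d * v₁ ^ 2 = x₁ ^ 3 + x₁ ^ 2 - x₁ ∧
      (x * (4 * (x₁ ^ 3 + x₁ ^ 2 - x₁)) = (x₁ ^ 2 + 1) ^ 2 ∨
        -1 / x * (4 * (x₁ ^ 3 + x₁ ^ 2 - x₁)) = (x₁ ^ 2 + 1) ^ 2) := by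
  have hd0 : (d : ℚ) ≠ 0 := mod_cast hd.ne_zero
  have key : ∀ x v w : ℚ, x ≠ 0 → d * v ^ 2 = x ^ 3 + x ^ 2 - x → d * x = w ^ 2 →
      ∃ x₁ v₁ : ℚ, x₁ ≠ 0 ∧ d * v₁ ^ 2 = x₁ ^ 3 + x₁ ^ 2 - x₁ ∧
        x * (4 * (x₁ ^ 3 + x₁ ^ 2 - x₁)) = (x₁ ^ 2 + 1) ^ 2 := by
    intro x v w hx h hw
    have hw0 : w ≠ 0 := by
      rintro rfl
      exact mul_ne_zero hd0 hx (by simpa using hw)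
    have hxw : x = w ^ 2 / d := by rw [← hw]; field_simp
    obtain ⟨z, hz⟩ : ∃ z, z = d ^ 2 * v / w := ⟨_, rfl⟩
    have hz2 : z ^ 2 = w ^ 4 + d * w ^ 2 - d ^ 2 := by
      have h1 : w ^ 2 * (w ^ 4 + d * w ^ 2 - d ^ 2) = (d ^ 2 * v) ^ 2 := by
        rw [show w ^ 4 = (w ^ 2) ^ 2 by ring, ← hw]
        linear_combination (-d ^ 3) * h
      rw [hz, div_pow, ← h1]
      field_simp
    have h5 : (2 * w ^ 2 + d + 2 * z) * (2 * w ^ 2 + d - 2 * z) = 5 * d ^ 2 := by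
      linear_combination -4 * hz2
    obtain ⟨c, k, e, t, hc, hcb, hke, hce, ht, hc0, he, hk, hX⟩ :=
      exists_squarefree_of_isogenous hd.ne_zero hz2
    have he' : (e : ℚ) ≠ 0 := mod_cast he
    have hk' : (k : ℚ) ≠ 0 := mod_cast hk
    rcases hd.right hc hcb hke hce ht hc0 with rfl | rfl
    · obtain ⟨x₁, v₁, h1, -, h2, h3⟩ := exists_half_of_sq hd0 (u := k / e) hz2 (by rw [hX]; push_cast; ring)
      exact ⟨x₁, v₁, h1, h2, hxw ▸ h3⟩
    · obtain ⟨x₁, v₁, h1, -, h2, h3⟩ := exists_half_of_sq hd0 (w := w) (z := -z) (u := d * e / k)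
        (by rw [← hz2]; ring) (by
          rw [hX] at h5
          push_cast at h5
          field_simp at h5 ⊢
          linear_combination h5)
      exact ⟨x₁, v₁, h1, h2, hxw ▸ h3⟩
  obtain ⟨w, hw | hw⟩ := eq_sq_or_neg_sq hd hx h
  · obtain ⟨x₁, v₁, h1, h2, h3⟩ := key x v w hx h hw
    exact ⟨x₁, v₁, h1, h2, .inl h3⟩
  · have hw0 : w ≠ 0 := by
      rintro rfl
      exact mul_ne_zero hd0 hx (by simpa using hw)
    obtain ⟨x₁, v₁, h1, h2, h3⟩ := key (-1 / x) (v / x ^ 2) (d / w)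
      (div_ne_zero (by norm_num) hx) (by field_simp; linear_combination h) (by
        field_simp; linear_combination -hw)
    exact ⟨x₁, v₁, h1, h2, .inr h3⟩

/-- With x₁ = r/s in lowest terms, the numerator (r² + s²)² of the doubling formula loses at most a
factor 100 when the fraction is reduced. -/
theorem Rat.height_pow_four_le {x x₁ : ℚ} (hx : x ≠ 0)
    (h : x * (4 * (x₁ ^ 3 + x₁ ^ 2 - x₁)) = (x₁ ^ 2 + 1) ^ 2) :
    x₁.height ^ 4 ≤ 100 * x.num.natAbs ∧ x₁.height ^ 4 ≤ 100 * x.height := by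
  suffices h0 : x₁.height ^ 4 ≤ 100 * x.num.natAbs from
    ⟨h0, h0.trans (Nat.mul_le_mul_left _ (le_max_left _ _))⟩
  set r := x₁.num with hr
  set s : ℤ := (x₁.den : ℤ) with hs
  have hs0 : (s : ℚ) ≠ 0 := by simp [hs]
  have hx1 : x₁ = r / s := by simp [hr, hs, Rat.num_div_den]
  have hcop : IsCoprime r s := by
    rw [Int.isCoprime_iff_nat_coprime]
    simpa [hr, hs] using x₁.reduced
  have hn0 : (x.den : ℚ) ≠ 0 := by simp
  have hdvd := sq_add_sq_sq_dvd (m := x.num) (n := x.den) hcop (by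
    have : (x.num : ℚ) * (4 * r * s * (r ^ 2 + r * s - s ^ 2)) = x.den * (r ^ 2 + s ^ 2) ^ 2 := by
      rw [← Rat.num_div_den x, hx1] at h
      field_simp at h
      linear_combination h
    exact_mod_cast this)
  have hm0 : 100 * x.num ≠ 0 := mul_ne_zero (by norm_num) (Rat.num_ne_zero.2 hx)
  have h1 := Nat.le_of_dvd (Int.natAbs_pos.2 hm0) (Int.natAbs_dvd_natAbs.2 hdvd)
  rw [Int.natAbs_mul] at h1
  refine le_trans ?_ h1
  rw [Int.natAbs_pow, show 4 = 2 * 2 by norm_num, pow_mul]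
  refine Nat.pow_le_pow_left ?_ 2
  have h2 : ((r ^ 2 + s ^ 2).natAbs : ℤ) = (r.natAbs : ℤ) ^ 2 + (s.natAbs : ℤ) ^ 2 := by
    rw [Int.natAbs_of_nonneg (by positivity), Int.natCast_natAbs, Int.natCast_natAbs, sq_abs, sq_abs]
  have h3 : (r ^ 2 + s ^ 2).natAbs = r.natAbs ^ 2 + s.natAbs ^ 2 := by exact_mod_cast h2
  rw [h3, Rat.height]
  rcases max_choice x₁.num.natAbs x₁.den with h4 | h4 <;> rw [h4]
  · exact Nat.le_add_right _ _
  · simp [hs]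

/-- The rational points on a quadratic twist of `y² = x³ + x² - x` with trivial `2`-descent. -/
theorem rational_points_of_trivialDescent {d : ℤ} (hd : TrivialDescent d)
    (hsmall : ∀ r ∈ Finset.Icc (-4 : ℤ) 4, ∀ s ∈ Finset.Icc (1 : ℤ) 4, r ≠ 0 →
      IsSquare (d * r * s * (r ^ 2 + r * s - s ^ 2)) → d = 1 ∧ (r = s ∨ r = -s)) {x v : ℚ}
    (h : d * v ^ 2 = x ^ 3 + x ^ 2 - x) : x = 0 ∨ d = 1 ∧ (x = 1 ∨ x = -1) := by
  induction hN : x.height using Nat.strong_induction_on generalizing x v with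
  | _ N ih =>
  by_cases hx : x = 0
  · exact .inl hx
  right
  obtain ⟨x₁, v₁, hx₁, h₁, hdbl⟩ := exists_half hd hx h
  have hht : x₁.height ^ 4 ≤ 100 * x.height := by
    rcases hdbl with h2 | h2
    · exact (Rat.height_pow_four_le hx h2).2
    · have h3 := (Rat.height_pow_four_le (div_ne_zero (by norm_num) hx) h2).1
      refine h3.trans (Nat.mul_le_mul_left _ ?_)
      have : (-1 / x).num.natAbs = x.den := by
        rw [neg_div, one_div, Rat.num_neg_eq_neg_num, Int.natAbs_neg, Rat.num_inv]
        simp [Int.natAbs_mul, Int.natAbs_sign_of_ne_zero (Rat.num_ne_zero.2 hx)]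
      rw [this]
      exact le_max_right _ _
  have h1 : d = 1 ∧ (x₁ = 1 ∨ x₁ = -1) := by
    by_cases hlt : x₁.height < N
    · exact (ih _ hlt h₁ rfl).resolve_left hx₁
    -- If the half is not smaller, then H⁴ ≤ 100 H, while H ≥ 5 would give H³ ≥ 125. This is where
    -- the search bound 4 comes from.
    · have hle : x₁.height ≤ 4 := by
        by_contra! h5
        rw [hN] at hht
        have h6 : x₁.height ^ 4 ≤ 100 * x₁.height := hht.trans (Nat.mul_le_mul_left _ (not_lt.1 hlt))
        have h7 : 5 ^ 3 ≤ x₁.height ^ 3 := Nat.pow_le_pow_left h5 3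
        nlinarith
      have hr : x₁.num.natAbs ≤ 4 := (le_max_left _ _).trans hle
      have hs : x₁.den ≤ 4 := (le_max_right _ _).trans hle
      have hs0 := x₁.den_pos
      have hs0' : (x₁.den : ℚ) ≠ 0 := by simp
      obtain ⟨h2, h3⟩ := hsmall x₁.num (by rw [Finset.mem_Icc]; omega) x₁.den
        (by rw [Finset.mem_Icc]; omega) (Rat.num_ne_zero.2 hx₁) (by
          have gen : ∀ R S : ℚ, x₁ * S = R →
              d * R * S * (R ^ 2 + R * S - S ^ 2) = (d * v₁ * S ^ 2) * (d * v₁ * S ^ 2) := by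
            rintro R S rfl
            linear_combination (-d * S ^ 4) * h₁
          rw [← Rat.isSquare_intCast_iff]
          refine ⟨d * v₁ * x₁.den ^ 2, ?_⟩
          rw [← gen _ _ (Rat.mul_den_eq_num x₁)]
          push_cast
          ring)
      refine ⟨h2, ?_⟩
      rw [← Rat.num_div_den x₁]
      rcases h3 with h3 | h3
      · left; rw [h3]; push_cast; field_simp
      · right; rw [h3]; push_cast; field_simp
  refine ⟨h1.1, ?_⟩
  rcases h1.2 with rfl | rfl
  · rcases hdbl with h2 | h2
    · left; linarith
    · right; field_simp at h2; linarith
  · rcases hdbl with h2 | h2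
    · left; linarith
    · right; field_simp at h2; linarith

theorem Squarefree.dvd_of_dvd_sq {c n : ℤ} (hc : Squarefree c) (h : c ∣ n ^ 2) : c ∣ n :=
  (hc.dvd_pow_iff_dvd two_ne_zero).1 h

theorem Int.eq_of_dvd_prime {p : ℕ} (hp : p.Prime) {c : ℤ} (h : c ∣ p) :
    c = 1 ∨ c = -1 ∨ c = p ∨ c = -p := by
  have h2 : c.natAbs ∣ p := by simpa using Int.natAbs_dvd_natAbs.2 h
  rcases (Nat.dvd_prime hp).1 h2 with h3 | h3 <;> omega

/-- If p divided c, it would divide t, and cancelling p² would leave k⁴ ± k²e² - e⁴ ≡ 0 mod p. By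
`hA` then p divides e, against coprimality with c. -/
theorem left_of_prime {p : ℕ} (hp : p.Prime) {d : ℤ} (hd : d = p ∨ d = -p)
    (hA : ∀ a b : ZMod p, a ^ 4 + a ^ 2 * b ^ 2 - b ^ 4 = 0 ∨ a ^ 4 - a ^ 2 * b ^ 2 - b ^ 4 = 0 →
      b = 0) {c k e t : ℤ} (hc : Squarefree c) (hcd : c ∣ -d ^ 2) (hce : IsCoprime c e)
    (h : c ^ 2 * k ^ 4 + d * c * k ^ 2 * e ^ 2 + -d ^ 2 * e ^ 4 = c * t ^ 2) : c = 1 ∨ c = -1 := by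
  have hp0 : (p : ℤ) ≠ 0 := mod_cast hp.ne_zero
  have hpp : Prime (p : ℤ) := Nat.prime_iff_prime_int.1 hp
  have hcp : c ∣ p := by
    have := hc.dvd_of_dvd_sq (dvd_neg.1 hcd)
    rcases hd with rfl | rfl
    · exact this
    · exact dvd_neg.1 this
  have key : ∀ ε δ : ℤ, ε ^ 2 = 1 → δ ^ 2 = 1 → c = ε * p → d = δ * p → False := by
    rintro ε δ hε hδ rfl rfl
    have h1 : p * (k ^ 4 + δ * ε * k ^ 2 * e ^ 2 - e ^ 4) = ε * t ^ 2 := by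
      apply mul_left_cancel₀ hp0
      linear_combination h - p ^ 2 * k ^ 4 * hε + p ^ 2 * e ^ 4 * hδ
    have h2 : (p : ℤ) ∣ t := by
      refine hpp.dvd_of_dvd_pow (n := 2) ⟨ε * (k ^ 4 + δ * ε * k ^ 2 * e ^ 2 - e ^ 4), ?_⟩
      linear_combination (-t ^ 2) * hε - ε * h1
    obtain ⟨t, rfl⟩ := h2
    have h3 : k ^ 4 + δ * ε * k ^ 2 * e ^ 2 - e ^ 4 = p * (ε * t ^ 2) := by
      apply mul_left_cancel₀ hp0
      linear_combination h1
    have h4 := congrArg (Int.cast : ℤ → ZMod p) h3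
    push_cast at h4
    rw [CharP.cast_eq_zero, zero_mul] at h4
    have h5 : (e : ZMod p) = 0 := by
      apply hA k
      have h6 : (δ * ε) ^ 2 = 1 := by rw [mul_pow, hε, hδ, one_mul]
      rcases sq_eq_one_iff.1 h6 with h7 | h7
      · have h9 := congrArg (Int.cast : ℤ → ZMod p) h7
        push_cast at h9
        left; rw [h9] at h4; linear_combination h4
      · have h9 := congrArg (Int.cast : ℤ → ZMod p) h7
        push_cast at h9
        right; rw [h9] at h4; linear_combination h4
    rw [ZMod.intCast_zmod_eq_zero_iff_dvd] at h5
    have h8 := hce.of_isCoprime_of_dvd_right h5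
    exact hpp.not_isUnit (h8.isUnit_of_dvd' (Dvd.intro_left ε rfl) dvd_rfl)
  rcases Int.eq_of_dvd_prime hp hcp with h1 | h1 | h1 | h1
  · exact .inl h1
  · exact .inr h1
  · rcases hd with h2 | h2
    · exact (key 1 1 rfl rfl (by simp [h1]) (by simp [h2])).elim
    · exact (key 1 (-1) rfl rfl (by simp [h1]) (by simp [h2])).elim
  · rcases hd with h2 | h2
    · exact (key (-1) 1 rfl rfl (by simp [h1]) (by simp [h2])).elim
    · exact (key (-1) (-1) rfl rfl (by simp [h1]) (by simp [h2])).elim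

theorem eq_or_eq_of_dvd_five {c : ℤ} (hc : 0 < c) (h : c ∣ 5) : c = 1 ∨ c = 5 := by
  rcases Int.eq_of_dvd_prime Nat.prime_five (by exact_mod_cast h) with h | h | h | h <;> omega

/-- As before, p ∣ c forces p ∣ t; after cancellation the equation is the one that `hB` declares
insoluble with p ∤ e. If p ∤ c, only the factor 5 is left for c. -/
theorem right_of_prime {p : ℕ} (hp : p.Prime) {d δ : ℤ} (hδ : δ ^ 2 = 1) (hd : d = δ * p)
    (hB : ∀ k e t c : ℤ, c = 1 ∨ c = 5 → ¬ (p : ℤ) ∣ e →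
      (c * k ^ 2 - δ * e ^ 2) ^ 2 + 4 * e ^ 4 = p * (c * t ^ 2) → False)
    {c k e t : ℤ} (hc : Squarefree c) (hcd : c ∣ 5 * d ^ 2) (hce : IsCoprime c e)
    (h : c ^ 2 * k ^ 4 + (-2 * d) * c * k ^ 2 * e ^ 2 + 5 * d ^ 2 * e ^ 4 = c * t ^ 2)
    (hc0 : 0 < c) : c = 1 ∨ c = 5 := by
  have hp0 : (p : ℤ) ≠ 0 := mod_cast hp.ne_zero
  have hpp : Prime (p : ℤ) := Nat.prime_iff_prime_int.1 hp
  have hcd' : c ∣ 5 * p ^ 2 := by rwa [hd, mul_pow, hδ, one_mul] at hcd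
  by_cases hpc : (p : ℤ) ∣ c
  · exfalso
    obtain ⟨c, rfl⟩ := hpc
    have hc1 : 0 < c := pos_of_mul_pos_right hc0 (by positivity)
    have hpc1 : IsCoprime (p : ℤ) c := by
      rw [hpp.coprime_iff_not_dvd]
      rintro ⟨c', rfl⟩
      exact hpp.not_isUnit (hc p ⟨c', by ring⟩)
    have hc5 : c ∣ 5 := by
      have h1 : c ∣ 5 * p ^ 2 := (Dvd.intro_left _ rfl).trans hcd'
      exact hpc1.symm.pow_right.dvd_of_dvd_mul_right h1
    have hpe : ¬ (p : ℤ) ∣ e := by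
      intro h8
      exact hpp.not_isUnit ((hce.of_isCoprime_of_dvd_right h8).isUnit_of_dvd'
        (Dvd.intro _ rfl) dvd_rfl)
    subst hd
    have h1 : p * ((c * k ^ 2 - δ * e ^ 2) ^ 2 + 4 * e ^ 4) = c * t ^ 2 := by
      apply mul_left_cancel₀ hp0
      linear_combination h - 4 * p ^ 2 * e ^ 4 * hδ
    have h2 : (p : ℤ) ∣ t := by
      have : (p : ℤ) ∣ c * t ^ 2 := ⟨_, h1.symm⟩
      exact hpp.dvd_of_dvd_pow (hpc1.dvd_of_dvd_mul_left this)
    obtain ⟨t, rfl⟩ := h2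
    refine hB k e t c (eq_or_eq_of_dvd_five hc1 hc5) hpe (mul_left_cancel₀ hp0 ?_)
    linear_combination h1
  · refine eq_or_eq_of_dvd_five hc0 ?_
    have h1 : IsCoprime (p : ℤ) c := (hpp.coprime_iff_not_dvd).2 hpc
    exact h1.symm.pow_right.dvd_of_dvd_mul_right hcd'

theorem trivialDescent_of_sq_eq_one {d : ℤ} (hd : d ^ 2 = 1) : TrivialDescent d where
  ne_zero := by rintro rfl; norm_num at hd
  left _ h _ _ _ := by
    rw [hd, dvd_neg] at h
    exact Int.isUnit_iff.1 (isUnit_of_dvd_one h)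
  right _ h _ _ _ hc := by
    rw [hd, mul_one] at h
    exact eq_or_eq_of_dvd_five hc h

theorem trivialDescent_two : TrivialDescent 2 where
  ne_zero := by norm_num
  left hc h _ hce := left_of_prime Nat.prime_two (.inl rfl) (by decide) hc h hce
  right hc h _ hce he hc0 := by
    refine right_of_prime Nat.prime_two (one_pow 2) (by norm_num) ?_ hc h hce he hc0
    intro k e t c hc hpe h9
    have h4 := congrArg (Int.cast : ℤ → ZMod 8) h9
    push_cast at h4
    -- For p = 2 the obstruction is visible only modulo 8, where 4e = 0 expresses that e is even.
    have hdec : ∀ k e t : ZMod 8, ((k ^ 2 - e ^ 2) ^ 2 + 4 * e ^ 4 = 2 * t ^ 2 ∨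
        (5 * k ^ 2 - e ^ 2) ^ 2 + 4 * e ^ 4 = 2 * (5 * t ^ 2)) → 4 * e = 0 := by decide
    have h5 : ((4 * e : ℤ) : ZMod 8) = 0 := by
      push_cast
      apply hdec k e t
      rcases hc with rfl | rfl
      · left; simpa using h4
      · right; simpa using h4
    rw [ZMod.intCast_zmod_eq_zero_iff_dvd] at h5
    apply hpe
    push_cast at h5 ⊢
    omega

/-- Modulo p the left side is a sum of the two squares a² and (2b²)². For p = 3 and 7, where -1 is a
nonresidue, it vanishes only trivially. -/
theorem right_aux {p : ℕ} (hB : ∀ a b : ZMod p, a ^ 2 + 4 * b ^ 4 = 0 → b = 0) {δ : ℤ}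
    (k e t c : ℤ) (hpe : ¬ (p : ℤ) ∣ e)
    (h : (c * k ^ 2 - δ * e ^ 2) ^ 2 + 4 * e ^ 4 = p * (c * t ^ 2)) : False := by
  rw [← ZMod.intCast_zmod_eq_zero_iff_dvd] at hpe
  apply hpe
  have h4 := congrArg (Int.cast : ℤ → ZMod p) h
  push_cast at h4
  rw [CharP.cast_eq_zero, zero_mul] at h4
  exact hB _ _ h4

theorem trivialDescent_neg_three : TrivialDescent (-3) where
  ne_zero := by norm_num
  left hc h _ hce := left_of_prime Nat.prime_three (.inr rfl) (by decide) hc h hce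
  right hc h _ hce he hc0 := right_of_prime Nat.prime_three (δ := -1) (by norm_num) (by norm_num)
    (fun k e t c _ h1 h2 ↦ right_aux (by decide) k e t c h1 h2) hc h hce he hc0

theorem trivialDescent_neg_seven : TrivialDescent (-7) where
  ne_zero := by norm_num
  left hc h _ hce := left_of_prime Nat.prime_seven (.inr rfl) (by decide) hc h hce
  right hc h _ hce he hc0 := right_of_prime Nat.prime_seven (δ := -1) (by norm_num) (by norm_num)
    (fun k e t c _ h1 h2 ↦ right_aux (by decide) k e t c h1 h2) hc h hce he hc0

theorem trivialDescent_five : TrivialDescent 5 where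
  ne_zero := by norm_num
  left hc h _ hce := left_of_prime Nat.prime_five (.inl rfl) (by decide) hc h hce
  -- Here 5d² = 5³, so squarefreeness alone gives c ∣ 5.
  right hc h _ _ _ hc0 := eq_or_eq_of_dvd_five hc0
    ((hc.dvd_pow_iff_dvd (n := 3) (by norm_num)).1 (by norm_num at h ⊢; exact h))

theorem rational_points_one {x v : ℚ} (h : v ^ 2 = x ^ 3 + x ^ 2 - x) :
    x = 0 ∨ x = 1 ∨ x = -1 :=
  (rational_points_of_trivialDescent (d := 1) (trivialDescent_of_sq_eq_one (by norm_num))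
    (by decide +kernel) (by simpa using h)).imp_right And.right

theorem rational_points_twist {d : ℤ} (hd : d ∈ ({-1, 2, -3, 5, -7} : Set ℤ)) {x v : ℚ}
    (h : d * v ^ 2 = x ^ 3 + x ^ 2 - x) : x = 0 := by
  rcases hd with rfl | rfl | rfl | rfl | rfl
  · exact (rational_points_of_trivialDescent (trivialDescent_of_sq_eq_one (by norm_num))
      (by decide +kernel) h).resolve_right (by norm_num)
  · exact (rational_points_of_trivialDescent trivialDescent_two
      (by decide +kernel) h).resolve_right (by norm_num)
  · exact (rational_points_of_trivialDescent trivialDescent_neg_three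
      (by decide +kernel) h).resolve_right (by norm_num)
  · exact (rational_points_of_trivialDescent trivialDescent_five
      (by decide +kernel) h).resolve_right (by norm_num)
  · exact (rational_points_of_trivialDescent trivialDescent_neg_seven
      (by decide +kernel) h).resolve_right (by norm_num)

/-! ### Conjugation in quadratic fields and its action on points -/

section

open WeierstrassCurve WeierstrassCurve.Affine

namespace WeierstrassCurve.Affine.Point

variable {F K : Type*} [Field F] [Field K] [DecidableEq F] [DecidableEq K]

/-- The homomorphism on points induced by a homomorphism of fields. -/
noncomputable def mapHom {W : WeierstrassCurve F} {W' : WeierstrassCurve K} (f : F →+* K)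
    (hf : W.map f = W') : W.toAffine.Point →+ W'.toAffine.Point where
  toFun P := match P with
    | 0 => 0
    | some x y h => some (f x) (f y) (hf ▸ (map_nonsingular W f.injective x y).2 h)
  map_zero' := rfl
  map_add' := by
    subst hf
    rintro (_ | ⟨x₁, y₁, h₁⟩) (_ | ⟨x₂, y₂, h₂⟩)
    any_goals rfl
    by_cases hxy : x₁ = x₂ ∧ y₁ = W.toAffine.negY x₂ y₂
    · rw [add_of_Y_eq hxy.left hxy.right]
      exact (add_of_Y_eq (congr_arg _ hxy.left) (by rw [hxy.right, map_negY])).symm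
    · simpa only [add_some hxy, ← map_addX, ← map_addY, ← map_slope] using!
        (add_some fun h ↦ hxy ⟨f.injective h.1, f.injective (W.toAffine.map_negY f .. ▸ h).2⟩).symm

variable {W : WeierstrassCurve F} {W' : WeierstrassCurve K} (f : F →+* K) (hf : W.map f = W')

lemma mapHom_some {x y : F} (h : W.toAffine.Nonsingular x y) :
    mapHom f hf (some x y h) = some (f x) (f y) (hf ▸ (map_nonsingular W f.injective x y).2 h) :=
  rfl

lemma mapHom_injective : Function.Injective (mapHom f hf) := by
  rintro (_ | _) (_ | _) h
  any_goals contradiction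
  · rfl
  · simpa only [some.injEq] using ⟨f.injective (some.inj h).left, f.injective (some.inj h).right⟩

end WeierstrassCurve.Affine.Point

/-- The nontrivial automorphism of a quadratic field containing a square root `s` of `d`. -/
structure QuadraticConj (K : Type*) [Field K] [CharZero K] (d : ℤ) where
  s : K
  s_sq : s ^ 2 = d
  s_ne_zero : s ≠ 0
  σ : K →+* K
  σ_σ : ∀ x, σ (σ x) = x
  σ_s : σ s = -s
  fixed : ∀ x, σ x = x → ∃ q : ℚ, x = q

/-- The nontrivial automorphism of a quadratic field. -/
theorem exists_quadratic_automorphism {K : Type*} [Field K] [NumberField K]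
    (hK : Module.finrank ℚ K = 2) : ∃ σ : K ≃ₐ[ℚ] K, σ ≠ 1 ∧ (∀ g : K ≃ₐ[ℚ] K, g = 1 ∨ g = σ) ∧
      (∀ x, σ (σ x) = x) ∧ ∀ x, σ x = x → ∃ q : ℚ, x = q := by
  have : Algebra.IsQuadraticExtension ℚ K := ⟨hK⟩
  have hcard : Nat.card (K ≃ₐ[ℚ] K) = 2 := by rw [IsGalois.card_aut_eq_finrank, hK]
  obtain ⟨σ, hσ⟩ : ∃ σ : K ≃ₐ[ℚ] K, σ ≠ 1 := by
    by_contra! h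
    have : Subsingleton (K ≃ₐ[ℚ] K) := ⟨fun a b ↦ (h a).trans (h b).symm⟩
    rw [Nat.card_of_subsingleton (1 : K ≃ₐ[ℚ] K)] at hcard
    norm_num at hcard
  have hσ2 : σ * σ = 1 := by
    have : σ ^ Nat.card (K ≃ₐ[ℚ] K) = 1 := pow_card_eq_one'
    rwa [hcard, sq] at this
  have hall : ∀ g : K ≃ₐ[ℚ] K, g = 1 ∨ g = σ := by
    intro g
    by_contra! h
    have hc : ({1, σ, g} : Set (K ≃ₐ[ℚ] K)).ncard = 3 := by
      rw [Set.ncard_eq_three]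
      exact ⟨1, σ, g, hσ.symm, h.1.symm, h.2.symm, rfl⟩
    have := Set.ncard_le_card ({1, σ, g} : Set (K ≃ₐ[ℚ] K))
    omega
  have hfix : ∀ x, σ x = x → ∃ q : ℚ, x = q := by
    intro x hx
    have hb : x ∈ (⊥ : IntermediateField ℚ K) := by
      rw [IsGalois.mem_bot_iff_fixed]
      intro g
      rcases hall g with rfl | rfl
      · rfl
      · exact hx
    obtain ⟨q, hq⟩ := IntermediateField.mem_bot.1 hb
    exact ⟨q, by rw [← hq]; simp⟩
  exact ⟨σ, hσ, hall, fun x ↦ DFunLike.congr_fun hσ2 x, hfix⟩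

theorem nonempty_quadraticConj {K : Type*} [Field K] [NumberField K]
    (hK : Module.finrank ℚ K = 2) {d : ℤ} (hd : ∀ q : ℚ, q ^ 2 ≠ d) {s : K} (hs : s ^ 2 = d) :
    ∃ q : QuadraticConj K d, q.s = s := by
  obtain ⟨σ, -, -, hσ2, hfix⟩ := exists_quadratic_automorphism hK
  have hs0 : s ≠ 0 := by
    rintro rfl
    apply hd 0
    have : ((0 : ℚ) : K) ^ 2 = ((d : ℚ) : K) := by push_cast; exact hs
    exact_mod_cast this
  refine ⟨⟨s, hs, hs0, σ.toRingEquiv.toRingHom, hσ2, ?_, hfix⟩, rfl⟩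
  have h1 : σ s ^ 2 = s ^ 2 := by rw [← map_pow, hs]; simp
  rcases sq_eq_sq_iff_eq_or_eq_neg.1 h1 with h2 | h2
  · obtain ⟨q, rfl⟩ := hfix s h2
    exact absurd (by exact_mod_cast hs) (hd q)
  · exact h2

namespace QuadraticConj

variable {K : Type*} [Field K] [CharZero K] {d : ℤ} (Q : QuadraticConj K d)
include Q

lemma anti {y : K} (hy : Q.σ y = -y) : ∃ v : ℚ, y = v * Q.s := by
  obtain ⟨v, hv⟩ := Q.fixed (y / Q.s) (by rw [map_div₀, hy, Q.σ_s, neg_div_neg_eq])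
  exact ⟨v, by rw [← hv, div_mul_cancel₀ _ Q.s_ne_zero]⟩

end QuadraticConj

end

/-! ### Explicit addition on X₁(2,10) and its cusps -/

section

open WeierstrassCurve WeierstrassCurve.Affine

namespace X1_2_10

variable {K : Type*} [Field K]

lemma Δ_eq : (X1_2_10 K).Δ = 80 := by
  simp only [X1_2_10, Δ, b₂, b₄, b₆, b₈]; norm_num

instance isElliptic [CharZero K] : (X1_2_10 K).IsElliptic where
  isUnit := by rw [Δ_eq]; exact (by norm_num : (80 : K) ≠ 0).isUnit

lemma equation_iff {x y : K} :
    (X1_2_10 K).toAffine.Equation x y ↔ y ^ 2 = x ^ 3 + x ^ 2 - x := by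
  rw [Affine.equation_iff]
  simp only [X1_2_10]
  constructor <;> intro h <;> linear_combination h

lemma negY_eq (x y : K) : (X1_2_10 K).toAffine.negY x y = -y := by
  simp [Affine.negY, X1_2_10]

variable [CharZero K]

/-- An affine point on `y² = x³ + x² - x`. -/
noncomputable def pt (x y : K) (h : y ^ 2 = x ^ 3 + x ^ 2 - x) : (X1_2_10 K).toAffine.Point :=
  .some x y (equation_iff_nonsingular.1 (equation_iff.2 h))

lemma eq_zero_or_pt (P : (X1_2_10 K).toAffine.Point) : P = 0 ∨ ∃ x y h, P = pt x y h := by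
  match P with
  | 0 => exact .inl rfl
  | .some x y h => exact .inr ⟨x, y, equation_iff.1 h.1, rfl⟩

lemma pt_ne_zero (x y : K) (h) : pt x y h ≠ 0 := Point.some_ne_zero _

lemma pt_inj {x y x' y' : K} {h h'} : pt x y h = pt x' y' h' ↔ x = x' ∧ y = y' := by
  simp [pt]

lemma neg_pt (x y : K) (h) : -pt x y h = pt x (-y) (by rw [neg_sq, h]) := by
  rw [pt, Point.neg_some, pt, Point.some.injEq]
  exact ⟨rfl, negY_eq x y⟩

variable [DecidableEq K]

/-- The slope is an input fixed by a division-free equation, so that concrete sums become polynomial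
checks. -/
lemma pt_add_pt {x₁ y₁ x₂ y₂ : K} {h₁ h₂} (hx : x₁ ≠ x₂) {l x₃ y₃ : K} (hl : l * (x₁ - x₂) = y₁ - y₂)
    (hx₃ : x₃ = l ^ 2 - 1 - x₁ - x₂) (hy₃ : y₃ = -(l * (x₃ - x₁) + y₁)) :
    ∃ h, pt x₁ y₁ h₁ + pt x₂ y₂ h₂ = pt x₃ y₃ h := by
  have hsl : (X1_2_10 K).toAffine.slope x₁ x₂ y₁ y₂ = l := by
    rw [slope_of_X_ne hx, div_eq_iff (sub_ne_zero.2 hx), hl]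
  have h := Point.add_of_X_ne (h₁ := equation_iff_nonsingular.1 (equation_iff.2 h₁))
    (h₂ := equation_iff_nonsingular.1 (equation_iff.2 h₂)) hx
  have hX : (X1_2_10 K).toAffine.addX x₁ x₂ l = x₃ := by
    rw [addX, hx₃]; simp [X1_2_10]
  have hY : (X1_2_10 K).toAffine.addY x₁ x₂ y₁ l = y₃ := by
    rw [addY, negAddY, negY_eq, hX, hy₃]
  simp only [hsl] at h
  have hns := nonsingular_add (equation_iff_nonsingular.1 (equation_iff.2 h₁))
    (equation_iff_nonsingular.1 (equation_iff.2 h₂)) (fun hxy ↦ hx hxy.1)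
  rw [hsl, hX, hY] at hns
  refine ⟨equation_iff.1 hns.1, ?_⟩
  rw [pt, pt, h, pt, Point.some.injEq]
  exact ⟨hX, hY⟩

lemma two_nsmul_pt {x y : K} {h} (hy : y ≠ 0) {l x₃ y₃ : K} (hl : l * (2 * y) = 3 * x ^ 2 + 2 * x - 1)
    (hx₃ : x₃ = l ^ 2 - 1 - x - x) (hy₃ : y₃ = -(l * (x₃ - x) + y)) :
    ∃ h', 2 • pt x y h = pt x₃ y₃ h' := by
  have hne : y ≠ (X1_2_10 K).toAffine.negY x y := by
    rw [negY_eq]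
    exact fun h ↦ hy (self_eq_neg.1 h)
  have hsl : (X1_2_10 K).toAffine.slope x x y y = l := by
    rw [slope_of_Y_ne rfl hne, div_eq_iff (sub_ne_zero.2 hne), negY_eq, sub_neg_eq_add, ← two_mul, hl]
    simp only [X1_2_10]
    ring
  have hns' := equation_iff_nonsingular.1 (equation_iff.2 h)
  have h2 := Point.add_self_of_Y_ne (h₁ := hns') hne
  have hX : (X1_2_10 K).toAffine.addX x x l = x₃ := by
    rw [addX, hx₃]; simp [X1_2_10]
  have hY : (X1_2_10 K).toAffine.addY x x y l = y₃ := by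
    rw [addY, negAddY, negY_eq, hX, hy₃]
  simp only [hsl] at h2
  have hns := nonsingular_add hns' hns' (fun hxy ↦ hne hxy.2)
  rw [hsl, hX, hY] at hns
  refine ⟨equation_iff.1 hns.1, ?_⟩
  rw [two_nsmul, pt, h2, pt, Point.some.injEq]
  exact ⟨hX, hY⟩

lemma two_nsmul_pt_eq_zero_iff {x y : K} {h} : 2 • pt x y h = 0 ↔ y = 0 := by
  constructor
  · intro h0
    by_contra hy
    obtain ⟨h', h1⟩ := two_nsmul_pt (h := h) hy (l := (3 * x ^ 2 + 2 * x - 1) / (2 * y))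
      (by field_simp) rfl rfl
    exact pt_ne_zero _ _ _ (h1.symm.trans h0)
  · rintro rfl
    rw [two_nsmul]
    nth_rewrite 1 [← neg_neg (pt x 0 h)]
    rw [neg_pt, neg_add_eq_zero, pt_inj]
    simp

variable (K) in
/-- The rational `2`-torsion point. -/
noncomputable def ptT : (X1_2_10 K).toAffine.Point := pt 0 0 (by ring)

variable (K) in
/-- A rational point of order `3`. -/
noncomputable def ptA : (X1_2_10 K).toAffine.Point := pt 1 1 (by ring)

lemma two_nsmul_ptT : 2 • ptT K = 0 := two_nsmul_pt_eq_zero_iff.2 rfl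

lemma three_nsmul_ptA : 3 • ptA K = 0 := by
  obtain ⟨h, h2⟩ := two_nsmul_pt (x := (1 : K)) (y := 1) (h := by ring) one_ne_zero (l := 2)
    (x₃ := 1) (y₃ := -1) (by norm_num) (by norm_num) (by norm_num)
  rw [succ_nsmul, ptA, h2, ← eq_neg_iff_add_eq_zero, neg_pt, pt_inj]
  exact ⟨rfl, rfl⟩

/-- Adding (±1-multiples of) A to T gives x = -1. Adding them to a 2-torsion point with x² + x = 1
gives abscissa 2x + 3, a root of X² - 4X - 1. -/
lemma isCusp_add {a : ℤ} (ha : a = 0 ∨ a = 1 ∨ a = -1) {P : (X1_2_10 K).toAffine.Point}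
    (hP : 2 • P = 0) : IsCusp (a • ptA K + P) := by
  rcases eq_zero_or_pt P with rfl | ⟨x, y, h, rfl⟩
  · rw [add_zero]
    rcases ha with rfl | rfl | rfl
    · rw [zero_smul]; trivial
    · rw [one_smul]; simp [IsCusp, ptA, pt]
    · rw [neg_one_smul, ptA, neg_pt]; simp [IsCusp, pt]
  rw [two_nsmul_pt_eq_zero_iff] at hP
  subst hP
  have hx : x * (x ^ 2 + x - 1) = 0 := by linear_combination -h
  have key : ∀ ε : K, ε ^ 2 = 1 → ∀ h₁, IsCusp (pt 1 ε h₁ + pt x 0 h) := by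
    intro ε hε h₁
    have h1x : 1 - x ≠ 0 := by
      intro h0
      have : x = 1 := by linear_combination -h0
      rw [this] at hx
      norm_num at hx
    obtain ⟨h₃, h4⟩ := pt_add_pt (h₁ := h₁) (h₂ := h) (fun h ↦ h1x (by rw [h, sub_self]))
      (l := ε / (1 - x)) (by field_simp; ring) rfl rfl
    rw [h4]
    simp only [IsCusp, pt]
    rw [div_pow, hε]
    rcases mul_eq_zero.1 hx with rfl | hx
    · norm_num
    · rw [mul_eq_zero]
      right
      have hinv : 1 / (1 - x) ^ 2 = 5 + 3 * x := by
        field_simp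
        linear_combination (-3 * x + 4) * hx
      rw [hinv]
      linear_combination 4 * hx
  rcases ha with rfl | rfl | rfl
  · rw [zero_smul, zero_add]
    simp only [IsCusp, pt]
    linear_combination ((x - 1) * (x + 1) * (x ^ 2 - 4 * x - 1)) * hx
  · rw [one_smul]; exact key 1 (one_pow 2) _
  · rw [neg_one_smul, ptA, neg_pt]; exact key (-1) (by norm_num) _

end X1_2_10

end

/-! ### Points over a quadratic field from ℚ and from the twist -/

section

open WeierstrassCurve WeierstrassCurve.Affine

namespace X1_2_10

variable {K : Type*} [Field K] [CharZero K] [DecidableEq K]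

variable (K) in
lemma map_eq (f : K →+* K) : (X1_2_10 K).map f = X1_2_10 K := by
  ext <;> simp [X1_2_10, WeierstrassCurve.map]

/-- The action of an endomorphism of `K` on the points of `y² = x³ + x² - x`. -/
noncomputable def conj (f : K →+* K) : (X1_2_10 K).toAffine.Point →+ (X1_2_10 K).toAffine.Point :=
  Point.mapHom f (map_eq K f)

lemma conj_pt (f : K →+* K) (x y : K) (h : y ^ 2 = x ^ 3 + x ^ 2 - x) :
    conj f (pt x y h) = pt (f x) (f y) (by rw [← map_pow, h]; simp) := rfl

lemma ptA_add_ptT : ∃ h, ptA K + ptT K = pt (-1) (1 : K) h :=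
  pt_add_pt (l := 1) one_ne_zero (by norm_num) (by norm_num) (by norm_num)

variable {d : ℤ} (Q : QuadraticConj K d)
include Q

lemma eq_of_conj_eq {P : (X1_2_10 K).toAffine.Point} (hP : conj Q.σ P = P) :
    ∃ a b : ℤ, P = a • ptA K + b • ptT K := by
  rcases eq_zero_or_pt P with rfl | ⟨x, y, h, rfl⟩
  · exact ⟨0, 0, by simp⟩
  rw [conj_pt, pt_inj] at hP
  obtain ⟨⟨x, rfl⟩, ⟨y, rfl⟩⟩ := And.intro (Q.fixed _ hP.1) (Q.fixed _ hP.2)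
  have hq : y ^ 2 = x ^ 3 + x ^ 2 - x := by exact_mod_cast h
  obtain ⟨h', hAT⟩ := ptA_add_ptT (K := K)
  rcases rational_points_one hq with rfl | rfl | rfl
  · have : y = 0 := by simpa using hq
    subst this
    exact ⟨0, 1, by rw [zero_smul, zero_add, one_smul, ptT, pt_inj]; simp⟩
  · have : y ^ 2 = 1 := by rw [hq]; norm_num
    rcases sq_eq_one_iff.1 this with rfl | rfl
    · exact ⟨1, 0, by rw [zero_smul, add_zero, one_smul, ptA, pt_inj]; simp⟩
    · exact ⟨-1, 0, by rw [zero_smul, add_zero, neg_one_smul, ptA, neg_pt, pt_inj]; simp⟩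
  · have : y ^ 2 = 1 := by rw [hq]; norm_num
    rcases sq_eq_one_iff.1 this with rfl | rfl
    · refine ⟨1, 1, ?_⟩
      rw [← smul_add, hAT, one_smul, pt_inj]; simp
    · refine ⟨-1, -1, ?_⟩
      rw [← smul_add, hAT, neg_one_smul, neg_pt, pt_inj]; simp

lemma eq_of_conj_eq_neg (hd : d ∈ ({-1, 2, -3, 5, -7} : Set ℤ)) {P : (X1_2_10 K).toAffine.Point}
    (hP : conj Q.σ P = -P) : P = 0 ∨ P = ptT K := by
  rcases eq_zero_or_pt P with rfl | ⟨x, y, h, rfl⟩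
  · exact .inl rfl
  right
  rw [conj_pt, neg_pt, pt_inj] at hP
  obtain ⟨⟨x, rfl⟩, ⟨v, rfl⟩⟩ := And.intro (Q.fixed _ hP.1) (Q.anti hP.2)
  have hq : d * v ^ 2 = x ^ 3 + x ^ 2 - x := by
    have : (d : K) * v ^ 2 = x ^ 3 + x ^ 2 - x := by rw [← h, mul_pow, Q.s_sq, mul_comm]
    exact_mod_cast this
  have hx := rational_points_twist hd hq
  subst hx
  have hd0 : (d : ℚ) ≠ 0 := by
    rcases hd with rfl | rfl | rfl | rfl | rfl <;> norm_num
  have hv : v = 0 := by simpa [hd0] using hq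
  subst hv
  rw [ptT, pt_inj]; simp

/-- A half of T would have x² = -1 and y² = -1 - 2x. Then σx = -x, and the rational number y·σy
would have square (-1 - 2x)(-1 + 2x) = 5. -/
lemma two_nsmul_ne_ptT {P : (X1_2_10 K).toAffine.Point} : 2 • P ≠ ptT K := by
  intro h2
  rcases eq_zero_or_pt P with rfl | ⟨x, y, h, rfl⟩
  · rw [smul_zero] at h2; exact pt_ne_zero _ _ _ h2.symm
  by_cases hy : y = 0
  · rw [two_nsmul_pt_eq_zero_iff.2 hy] at h2; exact pt_ne_zero _ _ _ h2.symm
  obtain ⟨h', h3⟩ := two_nsmul_pt (h := h) hy (l := (3 * x ^ 2 + 2 * x - 1) / (2 * y))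
    (by field_simp) rfl rfl
  rw [h3, ptT, pt_inj] at h2
  have hx : (x ^ 2 + 1) ^ 2 = 0 := by
    have h4 := h2.1
    field_simp at h4
    linear_combination h4 + (8 * x + 4) * h
  have hx2 : x ^ 2 = -1 := by
    have := pow_eq_zero_iff (two_ne_zero) |>.1 hx
    linear_combination this
  have hy2 : y ^ 2 = -1 - 2 * x := by rw [h]; linear_combination (x + 1) * hx2
  obtain ⟨q, hq⟩ := Q.fixed (y * Q.σ y) (by rw [map_mul, Q.σ_σ, mul_comm])
  have hσx : Q.σ x ^ 2 = -1 := by rw [← map_pow, hx2]; simp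
  have hσy : Q.σ y ^ 2 = -1 - 2 * Q.σ x := by rw [← map_pow, hy2, map_sub, map_mul, map_neg, map_one, map_ofNat]
  have hs : (x - Q.σ x) * (x + Q.σ x) = 0 := by linear_combination hx2 - hσx
  rcases mul_eq_zero.1 hs with hs | hs
  · obtain ⟨r, rfl⟩ := Q.fixed x (sub_eq_zero.1 hs).symm
    have : r ^ 2 = -1 := by exact_mod_cast hx2
    nlinarith [sq_nonneg r]
  · have h5 : (q : K) ^ 2 = 5 := by
      rw [← hq, mul_pow, hy2, hσy]
      linear_combination 2 * hs + 4 * x * hs - 4 * hx2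
    have h6 : q ^ 2 = ((5 : ℕ) : ℚ) := by exact_mod_cast h5
    have : IsSquare ((5 : ℕ) : ℚ) := ⟨q, by rw [← h6, sq]⟩
    rw [Rat.isSquare_natCast_iff] at this
    exact (by decide +kernel : ¬ IsSquare 5) this

/-- Here 2P = aA + (multiple of T). As 3A = 0, doubling P + aA leaves only a multiple of T, which
must vanish because T is not a double. -/
theorem exists_eq_add (hd : d ∈ ({-1, 2, -3, 5, -7} : Set ℤ)) (P : (X1_2_10 K).toAffine.Point) :
    ∃ a : ℤ, (a = 0 ∨ a = 1 ∨ a = -1) ∧ ∃ R, 2 • R = 0 ∧ P = a • ptA K + R := by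
  have hσσ : conj Q.σ (conj Q.σ P) = P := by
    rcases eq_zero_or_pt P with rfl | ⟨x, y, h, rfl⟩
    · simp
    · rw [conj_pt, conj_pt, pt_inj, Q.σ_σ, Q.σ_σ]; simp
  obtain ⟨a, b, hab⟩ := eq_of_conj_eq Q (P := P + conj Q.σ P) (by rw [map_add, hσσ, add_comm])
  have hanti := eq_of_conj_eq_neg Q hd (P := P - conj Q.σ P) (by rw [map_sub, hσσ, neg_sub])
  obtain ⟨c, hc⟩ : ∃ c : ℤ, P - conj Q.σ P = c • ptT K := by
    rcases hanti with h | h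
    · exact ⟨0, by rw [h, zero_smul]⟩
    · exact ⟨1, by rw [h, one_smul]⟩
  have h2P : 2 • P = a • ptA K + (b + c) • ptT K := by
    rw [add_smul, ← add_assoc, ← hab, ← hc, two_nsmul]; abel
  have hA3 : (3 : ℤ) • ptA K = 0 := by exact_mod_cast three_nsmul_ptA (K := K)
  have hT2 : (2 : ℤ) • ptT K = 0 := by exact_mod_cast two_nsmul_ptT (K := K)
  have h2R : 2 • (P + a • ptA K) = (b + c) • ptT K := by
    rw [smul_add, h2P]
    have : a • ptA K + (b + c) • ptT K + 2 • a • ptA K = (b + c) • ptT K + a • (3 : ℤ) • ptA K := by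
      module
    rw [this, hA3, smul_zero, add_zero]
  have h2R0 : 2 • (P + a • ptA K) = 0 := by
    rcases Int.even_or_odd' (b + c) with ⟨k, hk | hk⟩
    · rw [h2R, hk, mul_comm, mul_smul, hT2, smul_zero]
    · exact absurd (by rw [h2R, hk, add_smul, mul_comm, mul_smul, hT2, smul_zero, zero_add, one_smul])
        (two_nsmul_ne_ptT Q (P := P + a • ptA K))
  obtain ⟨e, he, m, hm⟩ : ∃ e : ℤ, (e = 0 ∨ e = 1 ∨ e = -1) ∧ ∃ m, -a = e + m * 3 := by
    have : (-a) % 3 = 0 ∨ (-a) % 3 = 1 ∨ (-a) % 3 = 2 := by omega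
    rcases this with h | h | h
    · exact ⟨0, by simp, (-a) / 3, by omega⟩
    · exact ⟨1, by simp, (-a) / 3, by omega⟩
    · exact ⟨-1, by simp, (-a) / 3 + 1, by omega⟩
  refine ⟨e, he, P + a • ptA K, h2R0, ?_⟩
  have : e • ptA K = (-a) • ptA K := by rw [hm, add_smul, mul_smul, hA3, smul_zero, add_zero]
  rw [this, neg_smul]; abel

theorem isCusp_of_twist (hd : d ∈ ({-1, 2, -3, 5, -7} : Set ℤ)) (P : (X1_2_10 K).toAffine.Point) :
    IsCusp P := by
  obtain ⟨a, ha, R, hR, rfl⟩ := exists_eq_add Q hd P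
  exact isCusp_add ha hR

theorem mordellWeilRank_eq_zero (hd : d ∈ ({-1, 2, -3, 5, -7} : Set ℤ)) :
    (X1_2_10 K).mordellWeilRank = 0 := by
  rw [WeierstrassCurve.mordellWeilRank, rank_eq_zero_iff]
  intro P
  refine ⟨6, by norm_num, ?_⟩
  obtain ⟨a, -, R, hR, rfl⟩ := exists_eq_add Q hd P
  have hA3 : (3 : ℤ) • ptA K = 0 := by exact_mod_cast three_nsmul_ptA (K := K)
  have hR2 : (2 : ℤ) • R = 0 := by exact_mod_cast hR
  have : (6 : ℤ) • (a • ptA K + R) = (2 * a) • (3 : ℤ) • ptA K + (3 : ℤ) • (2 : ℤ) • R := by module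
  rw [this, hA3, hR2, smul_zero, smul_zero, add_zero]

end X1_2_10

end

/-! ### The groups ℤ/6 and ℤ/2 ⊕ ℤ/6 -/

section

open WeierstrassCurve WeierstrassCurve.Affine

theorem AddCommGroup.nonempty_addEquiv_zmod {G : Type*} [AddCommGroup G] {b : G} {n : ℕ}
    (hb : addOrderOf b = n) (hgen : ∀ g, ∃ j : ℤ, g = j • b) : Nonempty (G ≃+ ZMod n) := by
  have hmem : ∀ g, g ∈ AddSubgroup.zmultiples b := fun g ↦ by
    obtain ⟨j, rfl⟩ := hgen g
    exact ⟨j, rfl⟩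
  have : IsAddCyclic G := ⟨b, hmem⟩
  have hcard : Nat.card G = n := by rw [← addOrderOf_eq_card_of_forall_mem_zmultiples hmem, hb]
  exact ⟨hcard ▸ (zmodAddCyclicAddEquiv this).symm⟩

theorem AddCommGroup.nonempty_addEquiv_zmod_two_prod {G : Type*} [AddCommGroup G] {a b : G} {n : ℕ}
    (ha : 2 • a = 0) (hab : a ∉ AddSubgroup.zmultiples b) (hb : addOrderOf b = n)
    (hgen : ∀ g, ∃ i j : ℤ, g = i • a + j • b) : Nonempty (G ≃+ ZMod 2 × ZMod n) := by
  let fa : ZMod 2 →+ G := ZMod.lift 2 ⟨zmultiplesHom G a, by simpa using (by exact_mod_cast ha : (2 : ℤ) • a = 0)⟩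
  let fb : ZMod n →+ G := ZMod.lift n ⟨zmultiplesHom G b, by
    simp [← hb]⟩
  have hfa : ∀ i : ℤ, fa i = i • a := fun i ↦ by simp [fa]
  have hfb : ∀ i : ℤ, fb i = i • b := fun i ↦ by simp [fb]
  refine ⟨(AddEquiv.ofBijective (fa.coprod fb) ⟨?_, fun g ↦ ?_⟩).symm⟩
  · rw [injective_iff_map_eq_zero]
    rintro ⟨x, y⟩ hxy
    obtain ⟨i, rfl⟩ := ZMod.intCast_surjective x
    obtain ⟨j, rfl⟩ := ZMod.intCast_surjective y
    rw [AddMonoidHom.coprod_apply, hfa, hfb] at hxy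
    have ha' : (2 : ℤ) • a = 0 := by exact_mod_cast ha
    have hi : (2 : ℤ) ∣ i := by
      by_contra hi
      obtain ⟨k, rfl⟩ : Odd i := by rwa [← Int.not_even_iff_odd, even_iff_two_dvd]
      rw [add_smul, mul_comm, mul_smul, ha', smul_zero, zero_add, one_smul] at hxy
      exact hab ⟨-j, by simp only [neg_smul]; rw [neg_eq_iff_add_eq_zero, add_comm, hxy]⟩
    have hi0 : i • a = 0 := by
      obtain ⟨k, rfl⟩ := hi
      rw [mul_comm, mul_smul, ha', smul_zero]
    rw [hi0, zero_add, ← addOrderOf_dvd_iff_zsmul_eq_zero, hb] at hxy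
    exact Prod.ext ((ZMod.intCast_zmod_eq_zero_iff_dvd i 2).2 (by exact_mod_cast hi))
      ((ZMod.intCast_zmod_eq_zero_iff_dvd j n).2 hxy)
  · obtain ⟨i, j, rfl⟩ := hgen g
    exact ⟨(i, j), by rw [AddMonoidHom.coprod_apply, hfa, hfb]⟩

namespace X1_2_10

variable {K : Type*} [Field K] [CharZero K] [DecidableEq K]

lemma addOrderOf_ptA_add_ptT : addOrderOf (ptA K + ptT K) = 6 := by
  have hA : addOrderOf (ptA K) = 3 := addOrderOf_eq_prime three_nsmul_ptA (pt_ne_zero _ _ _)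
  have hT : addOrderOf (ptT K) = 2 := addOrderOf_eq_prime two_nsmul_ptT (pt_ne_zero _ _ _)
  rw [(AddCommute.all _ _).addOrderOf_add_eq_mul_addOrderOf_of_coprime] <;> rw [hA, hT]
  norm_num

lemma ptA_eq_zsmul : ptA K = (4 : ℤ) • (ptA K + ptT K) := by
  have hA3 : (3 : ℤ) • ptA K = 0 := by exact_mod_cast three_nsmul_ptA (K := K)
  have hT2 : (2 : ℤ) • ptT K = 0 := by exact_mod_cast two_nsmul_ptT (K := K)
  calc ptA K = ptA K + (3 : ℤ) • ptA K + (2 : ℤ) • (2 : ℤ) • ptT K := by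
        rw [hA3, hT2, smul_zero, add_zero, add_zero]
    _ = _ := by module

lemma ptT_eq_zsmul : ptT K = (3 : ℤ) • (ptA K + ptT K) := by
  have hA3 : (3 : ℤ) • ptA K = 0 := by exact_mod_cast three_nsmul_ptA (K := K)
  have hT2 : (2 : ℤ) • ptT K = 0 := by exact_mod_cast two_nsmul_ptT (K := K)
  calc ptT K = ptT K + (3 : ℤ) • ptA K + (2 : ℤ) • ptT K := by rw [hA3, hT2, add_zero, add_zero]
    _ = _ := by module

variable {d : ℤ} (Q : QuadraticConj K d)
include Q

lemma sq_ne_five (hd : ∀ v : ℚ, d * v ^ 2 ≠ 5) (x : K) : x ^ 2 ≠ 5 := by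
  intro hx
  have hσ : Q.σ x ^ 2 = x ^ 2 := by rw [← map_pow, hx, map_ofNat]
  rcases sq_eq_sq_iff_eq_or_eq_neg.1 hσ with h | h
  · obtain ⟨q, rfl⟩ := Q.fixed x h
    have h6 : q ^ 2 = ((5 : ℕ) : ℚ) := by exact_mod_cast hx
    have : IsSquare ((5 : ℕ) : ℚ) := ⟨q, by rw [← h6, sq]⟩
    rw [Rat.isSquare_natCast_iff] at this
    exact (by decide +kernel : ¬ IsSquare 5) this
  · obtain ⟨v, rfl⟩ := Q.anti h
    rw [mul_pow, Q.s_sq] at hx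
    exact hd v (by rw [mul_comm]; exact_mod_cast hx)

theorem nonempty_addEquiv_zmod_six (hd : d ∈ ({-1, 2, -3, 5, -7} : Set ℤ))
    (h5 : ∀ v : ℚ, d * v ^ 2 ≠ 5) : Nonempty ((X1_2_10 K).toAffine.Point ≃+ ZMod 6) := by
  refine AddCommGroup.nonempty_addEquiv_zmod addOrderOf_ptA_add_ptT fun P ↦ ?_
  obtain ⟨a, -, R, hR, rfl⟩ := exists_eq_add Q hd P
  obtain ⟨b, rfl⟩ : ∃ b : ℤ, R = b • ptT K := by
    rcases eq_zero_or_pt R with rfl | ⟨x, y, h, rfl⟩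
    · exact ⟨0, by simp⟩
    · rw [two_nsmul_pt_eq_zero_iff] at hR
      subst hR
      have hx : x * (x ^ 2 + x - 1) = 0 := by linear_combination -h
      rcases mul_eq_zero.1 hx with rfl | hx
      · exact ⟨1, by rw [one_smul]; rfl⟩
      -- A root of x² + x - 1 would give (2x + 1)² = 5.
      · exact absurd (by linear_combination 4 * hx) (sq_ne_five Q h5 (2 * x + 1))
  refine ⟨a * 4 + b * 3, ?_⟩
  rw [add_smul, mul_smul, mul_smul, ← ptA_eq_zsmul, ← ptT_eq_zsmul]

end X1_2_10

theorem X1_2_10.nonempty_addEquiv_zmod_two_prod_six {K : Type*} [Field K] [CharZero K]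
    [DecidableEq K] (Q : QuadraticConj K 5) :
    Nonempty ((X1_2_10 K).toAffine.Point ≃+ ZMod 2 × ZMod 6) := by
  have hs : Q.s ^ 2 = 5 := by exact_mod_cast Q.s_sq
  let U : (X1_2_10 K).toAffine.Point := pt ((-1 + Q.s) / 2) 0 (by
    linear_combination (1 - Q.s) / 8 * hs)
  have hU : 2 • U = 0 := two_nsmul_pt_eq_zero_iff.2 rfl
  have hne : (-1 + Q.s) / 2 ≠ 0 := by
    intro h
    have : Q.s = 1 := by linear_combination 2 * h
    rw [this] at hs; norm_num at hs
  obtain ⟨h₃, hUT⟩ : ∃ h, U + ptT K = pt (-1 - (-1 + Q.s) / 2) 0 h :=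
    pt_add_pt hne (l := 0) (by norm_num) (by ring) (by ring)
  obtain ⟨h', hAT⟩ := ptA_add_ptT (K := K)
  refine AddCommGroup.nonempty_addEquiv_zmod_two_prod hU ?_ addOrderOf_ptA_add_ptT fun P ↦ ?_
  · rintro ⟨k, hk⟩
    -- Multiples of A + T are rational, hence fixed by conjugation, whereas the abscissa of U
    -- involves √5.
    have h1 : conj Q.σ (k • (ptA K + ptT K)) = k • (ptA K + ptT K) := by
      rw [map_zsmul, hAT, conj_pt]
      congr 1
      rw [pt_inj]; simp
    simp only at hk
    rw [hk, conj_pt, pt_inj, map_div₀, map_add, Q.σ_s, map_neg, map_one, map_ofNat] at h1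
    exact Q.s_ne_zero (by linear_combination -h1.1)
  · obtain ⟨a, -, R, hR, rfl⟩ := exists_eq_add Q (by simp) P
    obtain ⟨i, b, rfl⟩ : ∃ i b : ℤ, R = i • U + b • ptT K := by
      rcases eq_zero_or_pt R with rfl | ⟨x, y, h, rfl⟩
      · exact ⟨0, 0, by simp⟩
      rw [two_nsmul_pt_eq_zero_iff] at hR
      subst hR
      have hx : x * ((x - (-1 + Q.s) / 2) * (x - (-1 - (-1 + Q.s) / 2))) = 0 := by
        linear_combination -h - x / 4 * hs
      rcases mul_eq_zero.1 hx with rfl | hx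
      · exact ⟨0, 1, by rw [one_smul, zero_smul, zero_add]; rfl⟩
      rcases mul_eq_zero.1 hx with hx | hx
      · refine ⟨1, 0, ?_⟩
        rw [one_smul, zero_smul, add_zero, pt_inj]
        exact ⟨sub_eq_zero.1 hx, rfl⟩
      · refine ⟨1, 1, ?_⟩
        rw [one_smul, one_smul, hUT, pt_inj]
        exact ⟨sub_eq_zero.1 hx, rfl⟩
    refine ⟨i, a * 4 + b * 3, ?_⟩
    rw [add_smul (a * 4), mul_smul, mul_smul, ← ptA_eq_zsmul, ← ptT_eq_zsmul]
    abel

end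

/-! ### The descent for the twist by -2 -/

section

open WeierstrassCurve WeierstrassCurve.Affine

/-- The image of a class-two point of the isogenous curve, translated by `(-2, √-2)`. -/
theorem exists_square_add_class_two {w z u : ℚ} (h : z ^ 2 = w ^ 4 + -2 * w ^ 2 - (-2) ^ 2)
    (hu : 2 * w ^ 2 + -2 + 2 * z = 2 * u ^ 2) (hw : w ^ 2 ≠ 4) :
    ∃ z₃ u₃ : ℚ, z₃ ^ 2 = (2 * (z - w) / (4 - w ^ 2)) ^ 4 +
      -2 * (2 * (z - w) / (4 - w ^ 2)) ^ 2 - (-2) ^ 2 ∧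
      2 * (2 * (z - w) / (4 - w ^ 2)) ^ 2 + -2 + 2 * z₃ = u₃ ^ 2 := by
  have h4 : 4 - w ^ 2 ≠ 0 := fun h0 ↦ hw (by linarith)
  have hz : z = u ^ 2 + 1 - w ^ 2 := by linarith
  subst hz
  -- With t = wu this is the quartic of the class 2; on it all the quantities below are rational
  -- functions of u and t.
  have hq : 2 * (w * u) ^ 2 = u ^ 4 + 2 * u ^ 2 + 5 := by linear_combination -h
  have h5 : 2 * u ^ 2 * (4 - w ^ 2) = -((u ^ 2 - 1) * (u ^ 2 - 5)) := by linear_combination -hq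
  have hu0 : u ≠ 0 := by rintro rfl; norm_num at hq
  have hAB : (u ^ 2 - 1) * (u ^ 2 - 5) ≠ 0 := by
    rw [← neg_ne_zero, ← h5]
    positivity
  have hA := left_ne_zero_of_mul hAB
  have hB := right_ne_zero_of_mul hAB
  have hw₃ : 2 * (u ^ 2 + 1 - w ^ 2 - w) / (4 - w ^ 2) =
      -2 * (u ^ 4 - 5 - 2 * (w * u) * u) / ((u ^ 2 - 1) * (u ^ 2 - 5)) := by
    rw [div_eq_div_iff h4 hAB]
    linear_combination 2 * (u ^ 2 + 1 - w ^ 2 - w) * h5 + (4 - w ^ 2) * 2 * hq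
  rw [hw₃]
  generalize w * u = t at *
  obtain ⟨u₃, hu₃⟩ : ∃ u₃, u₃ = 2 * (t + 2 * u) / (u ^ 2 - 1) := ⟨_, rfl⟩
  obtain ⟨w₃, hw₃⟩ : ∃ w₃, w₃ = -2 * (u ^ 4 - 5 - 2 * t * u) / ((u ^ 2 - 1) * (u ^ 2 - 5)) := ⟨_, rfl⟩
  rw [← hw₃]
  refine ⟨(u₃ ^ 2 + 2 - 2 * w₃ ^ 2) / 2, u₃, ?_, by ring⟩
  have key : (u₃ ^ 2 + 2) ^ 2 + 16 - 4 * u₃ ^ 2 * w₃ ^ 2 = 0 := by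
    have : (u₃ ^ 2 + 2) ^ 2 + 16 - 4 * u₃ ^ 2 * w₃ ^ 2 = 
        ((u ^ 2 - 5) ^ 2 * (((2 * (t + 2 * u)) ^ 2 + 2 * (u ^ 2 - 1) ^ 2) ^ 2 +
          16 * (u ^ 2 - 1) ^ 4) - 4 * (2 * (t + 2 * u)) ^ 2 * (-2 * (u ^ 4 - 5 - 2 * t * u)) ^ 2) /
        ((u ^ 2 - 1) ^ 4 * (u ^ 2 - 5) ^ 2) := by
      rw [hu₃, hw₃]
      field_simp
    rw [this, div_eq_zero_iff]
    left
    linear_combination (8 * t ^ 2 * u ^ 4 - 208 * t ^ 2 * u ^ 2 + 200 * t ^ 2 + 192 * t * u ^ 5 -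
      1152 * t * u ^ 3 + 960 * t * u + 512 * u ^ 6 - 20 * u ^ 8 - 1832 * u ^ 4 + 1440 * u ^ 2 - 100) * hq
  linear_combination key / 4

/-- For p-adically large x the doubling formula is dominated by x⁴/(4x³) = x/4. -/
theorem Rat.padicValRat_double {x : ℚ} {p : ℕ} [Fact p.Prime] (hx : padicValRat p x < 0) :
    x ^ 3 + x ^ 2 - x ≠ 0 ∧ padicValRat p ((x ^ 2 + 1) ^ 2 / (4 * (x ^ 3 + x ^ 2 - x))) =
      padicValRat p x - padicValRat p 4 := by
  have hx0 : x ≠ 0 := by rintro rfl; simp at hx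
  have key : ∀ a b : ℚ, a ≠ 0 → padicValRat p a < 0 → 0 ≤ padicValRat p b →
      a + b ≠ 0 ∧ padicValRat p (a + b) = padicValRat p a := by
    intro a b ha h1 h2
    by_cases hb : b = 0
    · subst hb; simpa using ha
    have hab : a + b ≠ 0 := by
      intro h
      rw [show a = -b by linarith, padicValRat.neg] at h1
      omega
    exact ⟨hab, padicValRat.add_eq_of_lt hab ha hb (by omega)⟩
  obtain ⟨h1, h2⟩ := key (x ^ 2) 1 (pow_ne_zero 2 hx0) (by rw [padicValRat.pow]; push_cast; omega)
    (by simp)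
  obtain ⟨h3, h4⟩ := key x 1 hx0 hx (by simp)
  obtain ⟨h5, h6⟩ := key (x * (x + 1)) (-1) (mul_ne_zero hx0 h3)
    (by rw [padicValRat.mul hx0 h3]; omega) (by rw [padicValRat.neg]; simp)
  have hf : x ^ 3 + x ^ 2 - x = x * (x * (x + 1) + -1) := by ring
  rw [hf]
  refine ⟨mul_ne_zero hx0 h5, ?_⟩
  rw [padicValRat.div (pow_ne_zero 2 h1) (mul_ne_zero four_ne_zero (mul_ne_zero hx0 h5)),
    padicValRat.pow, padicValRat.mul four_ne_zero (mul_ne_zero hx0 h5), padicValRat.mul hx0 h5,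
    h2, h6, padicValRat.mul hx0 h3, h4, padicValRat.pow]
  push_cast
  ring

namespace X1_2_10

variable {K : Type*} [Field K] [CharZero K] [DecidableEq K]

lemma two_nsmul_pt_of_ne_zero {x y : K} {h} (hy : y ≠ 0) :
    ∃ y' h', 2 • pt x y h = pt ((x ^ 2 + 1) ^ 2 / (4 * (x ^ 3 + x ^ 2 - x))) y' h' := by
  obtain ⟨h', h1⟩ := two_nsmul_pt (h := h) hy (l := (3 * x ^ 2 + 2 * x - 1) / (2 * y))
    (x₃ := (x ^ 2 + 1) ^ 2 / (4 * (x ^ 3 + x ^ 2 - x))) (by field_simp) (by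
      rw [← h]; field_simp; linear_combination (32 * x + 16) * h) rfl
  exact ⟨_, h', h1⟩

lemma eq_or_eq_neg_of_x_eq {x x' y y' : K} {h h'} (hx : x = x') :
    pt x y h = pt x' y' h' ∨ pt x y h = -pt x' y' h' := by
  subst hx
  rcases sq_eq_sq_iff_eq_or_eq_neg.1 (h.trans h'.symm) with rfl | rfl
  · exact .inl rfl
  · exact .inr (neg_pt _ _ _).symm

variable (Q : QuadraticConj K (-2))
include Q

lemma s_sq_eq : Q.s ^ 2 = -2 := by exact_mod_cast Q.s_sq

lemma ptC_equation : Q.s ^ 2 = (-2) ^ 3 + (-2) ^ 2 - (-2 : K) := by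
  rw [s_sq_eq Q]; norm_num

/-- A point of infinite order over `ℚ(√-2)`. -/
noncomputable def ptC : (X1_2_10 K).toAffine.Point :=
  pt (-2) Q.s (ptC_equation Q)

lemma twistPt_equation {x v : ℚ} (h : -2 * v ^ 2 = x ^ 3 + x ^ 2 - x) :
    (v * Q.s) ^ 2 = (x : K) ^ 3 + (x : K) ^ 2 - x := by
  rw [mul_pow, s_sq_eq Q, mul_comm]; exact_mod_cast h

/-- A point of the twist of `y² = x³ + x² - x` by `-2`, as a point over `ℚ(√-2)`. -/
noncomputable def twistPt (x v : ℚ) (h : -2 * v ^ 2 = x ^ 3 + x ^ 2 - x) :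
    (X1_2_10 K).toAffine.Point :=
  pt (x : K) (v * Q.s) (twistPt_equation Q h)

lemma ptC_eq : ptC Q = twistPt Q (-2) 1 (by norm_num) := by
  rw [ptC, twistPt, pt_inj]; simp

lemma neg_twistPt (x v : ℚ) (h) : -twistPt Q x v h = twistPt Q x (-v) (by rw [neg_sq, h]) := by
  rw [twistPt, neg_pt, twistPt, pt_inj]; simp

/-- The points on which the nontrivial automorphism acts as negation. -/
noncomputable def antiInvariant : AddSubgroup (X1_2_10 K).toAffine.Point :=
  (conj Q.σ + AddMonoidHom.id _).ker

lemma mem_antiInvariant {P} : P ∈ antiInvariant Q ↔ conj Q.σ P = -P := by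
  rw [antiInvariant, AddMonoidHom.mem_ker, AddMonoidHom.add_apply, AddMonoidHom.id_apply,
    ← eq_neg_iff_add_eq_zero]

lemma twistPt_mem (x v : ℚ) (h) : twistPt Q x v h ∈ antiInvariant Q := by
  rw [mem_antiInvariant, twistPt, conj_pt, neg_pt, pt_inj, map_mul, Q.σ_s]
  simp

lemma eq_zero_or_twistPt {P} (hP : P ∈ antiInvariant Q) : P = 0 ∨ ∃ x v h, P = twistPt Q x v h := by
  rw [mem_antiInvariant] at hP
  rcases eq_zero_or_pt P with rfl | ⟨x, y, h, rfl⟩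
  · exact .inl rfl
  rw [conj_pt, neg_pt, pt_inj] at hP
  obtain ⟨⟨x, rfl⟩, ⟨v, rfl⟩⟩ := And.intro (Q.fixed _ hP.1) (Q.anti hP.2)
  have hq : -2 * v ^ 2 = x ^ 3 + x ^ 2 - x := by
    have : (-2 : K) * v ^ 2 = x ^ 3 + x ^ 2 - x := by rw [← h, mul_pow, s_sq_eq Q, mul_comm]
    exact_mod_cast this
  exact .inr ⟨x, v, hq, rfl⟩

lemma exists_half_twistPt {w z u x v : ℚ} (h : z ^ 2 = w ^ 4 + -2 * w ^ 2 - (-2) ^ 2)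
    (hu : 2 * w ^ 2 + -2 + 2 * z = u ^ 2) (hx : -2 * x = w ^ 2) (hv) :
    ∃ R ∈ antiInvariant Q, twistPt Q x v hv = 2 • R := by
  obtain ⟨x₁, v₁, -, hv0, h₁, h₂⟩ := exists_half_of_sq (by norm_num : (-2 : ℚ) ≠ 0) h hu
  obtain ⟨y', h', h2⟩ := two_nsmul_pt_of_ne_zero (x := (x₁ : K)) (y := v₁ * Q.s) (h := twistPt_equation Q h₁)
    (mul_ne_zero (by exact_mod_cast hv0) Q.s_ne_zero)
  have h4 : 4 * (x₁ ^ 3 + x₁ ^ 2 - x₁) ≠ 0 := by rw [← h₁]; positivity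
  have hxx : x = (x₁ ^ 2 + 1) ^ 2 / (4 * (x₁ ^ 3 + x₁ ^ 2 - x₁)) := by
    rw [eq_div_iff h4, ← h₂, ← hx]; ring
  rcases eq_or_eq_neg_of_x_eq (h := twistPt_equation Q hv) (h' := h')
    (by rw [hxx]; push_cast; rfl) with h5 | h5
  · exact ⟨_, twistPt_mem Q x₁ v₁ h₁, h5.trans h2.symm⟩
  · exact ⟨_, neg_mem (twistPt_mem Q x₁ v₁ h₁), by rw [smul_neg]; exact h5.trans (by rw [← h2]; rfl)⟩

/-- C has class 2 too, so adding it moves the point to the trivial class, where it is a double. The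
exception w² = 4 is x = -2, i.e. the point ±C itself. -/
lemma add_ptC_of_class_two {w z u x v : ℚ} (h : z ^ 2 = w ^ 4 + -2 * w ^ 2 - (-2) ^ 2)
    (hu : 2 * w ^ 2 + -2 + 2 * z = 2 * u ^ 2) (hx : -2 * x = w ^ 2) (hz : z * w = 4 * v) (hv) :
    ∃ R ∈ antiInvariant Q, ∃ b : ℤ, (b = 0 ∨ b = 1 ∨ b = -1) ∧
      twistPt Q x v hv = b • ptC Q + 2 • R := by
  by_cases hw : w ^ 2 = 4
  · have hx2 : (x : K) = ((-2 : ℚ) : K) := by rw [show x = -2 by linarith]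
    rw [ptC_eq]
    refine ⟨0, zero_mem _, ?_⟩
    rcases eq_or_eq_neg_of_x_eq (h := twistPt_equation Q hv)
      (h' := twistPt_equation Q (x := -2) (v := 1) (by norm_num)) hx2 with h5 | h5
    · exact ⟨1, by simp, by rw [one_smul, smul_zero, add_zero]; exact h5⟩
    · exact ⟨-1, by simp, by rw [neg_one_smul, smul_zero, add_zero]; exact h5⟩
  obtain ⟨z₃, u₃, h₃, hu₃⟩ := exists_square_add_class_two h hu hw
  have h4 : 4 - w ^ 2 ≠ 0 := fun h0 ↦ hw (by linarith)
  have hx2 : x + 2 ≠ 0 := fun h0 ↦ hw (by linarith)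
  have hne : (x : K) ≠ ((-2 : ℚ) : K) := by
    intro h0
    apply hx2
    rw [Rat.cast_inj.1 h0]; norm_num
  obtain ⟨m, hm⟩ : ∃ m, m = (v - 1) / (x + 2) := ⟨_, rfl⟩
  have hm' : m * (x + 2) = v - 1 := by rw [hm, div_mul_cancel₀ _ hx2]
  obtain ⟨h', hadd⟩ := pt_add_pt (h₁ := twistPt_equation Q hv)
    (h₂ := twistPt_equation Q (x := -2) (v := 1) (by norm_num)) hne (l := m * Q.s)
    (x₃ := ((-2 * m ^ 2 + 1 - x : ℚ) : K)) (y₃ := ((-(m * (-2 * m ^ 2 + 1 - x - x) + v) : ℚ) : K) * Q.s)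
    (by
      have : (m : K) * (x + 2) = v - 1 := by exact_mod_cast hm'
      push_cast
      linear_combination Q.s * this)
    (by push_cast; linear_combination (-m ^ 2 : K) * s_sq_eq Q) (by push_cast; ring)
  have hq : -2 * (-(m * (-2 * m ^ 2 + 1 - x - x) + v)) ^ 2 =
      (-2 * m ^ 2 + 1 - x) ^ 3 + (-2 * m ^ 2 + 1 - x) ^ 2 - (-2 * m ^ 2 + 1 - x) := by
    rw [mul_pow, s_sq_eq Q] at h'
    rw [mul_comm]
    exact_mod_cast h'
  obtain ⟨R, hR, h2R⟩ := exists_half_twistPt Q h₃ hu₃ (x := -2 * m ^ 2 + 1 - x) (by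
    have hm2 : m = (z * w - 4) / (2 * (4 - w ^ 2)) := by
      rw [hm, div_eq_div_iff hx2 (mul_ne_zero two_ne_zero h4)]
      linear_combination (-x - 2) * hz + 2 * (v - 1) * hx
    rw [hm2, show x = -w ^ 2 / 2 by linarith]
    field_simp
    linear_combination (w ^ 2 - 4) * h) hq
  refine ⟨R, hR, -1, by simp, ?_⟩
  rw [← h2R, neg_one_smul, eq_neg_add_iff_add_eq, add_comm, ptC_eq]
  exact hadd

/-- The possible classes are 1, 2, 5, 10. The conjugate factors multiply to 20, of class 5, so z ↦
-z exchanges 1 with 5 and 2 with 10. -/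
lemma exists_decomposition_of_sq {w x v : ℚ} (hx : -2 * x = w ^ 2) (hw : w ≠ 0) (hv) :
    ∃ R ∈ antiInvariant Q, ∃ b : ℤ, (b = 0 ∨ b = 1 ∨ b = -1) ∧
      twistPt Q x v hv = b • ptC Q + 2 • R := by
  obtain ⟨z, hz⟩ : ∃ z, z = 4 * v / w := ⟨_, rfl⟩
  have hzw : z * w = 4 * v := by rw [hz, div_mul_cancel₀ _ hw]
  have hq : z ^ 2 = w ^ 4 + -2 * w ^ 2 - (-2) ^ 2 := by
    apply mul_right_cancel₀ (pow_ne_zero 2 hw)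
    have hx' : x = -w ^ 2 / 2 := by linarith
    rw [hx'] at hv
    linear_combination (z * w + 4 * v) * hzw - 8 * hv
  have h5 : (2 * w ^ 2 + -2 + 2 * z) * (2 * w ^ 2 + -2 - 2 * z) = 20 := by
    linear_combination -4 * hq
  obtain ⟨c, k, e, t, hc, hcb, -, -, -, hc0, he, hk, hX⟩ :=
    exists_squarefree_of_isogenous (d := -2) (by norm_num) (w := w) (z := z) (by push_cast; exact hq)
  have he' : (e : ℚ) ≠ 0 := mod_cast he
  have hk' : (k : ℚ) ≠ 0 := mod_cast hk
  have hc4 : c = 1 ∨ c = 2 ∨ c = 5 ∨ c = 10 := by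
    have h10 : c ∣ 10 := by
      apply hc.dvd_of_dvd_sq
      exact hcb.trans (by norm_num)
    have : c ≤ 10 := Int.le_of_dvd (by norm_num) h10
    interval_cases c <;> revert h10 <;> decide
  have hq' : (-z) ^ 2 = w ^ 4 + -2 * w ^ 2 - (-2) ^ 2 := by rw [neg_sq, hq]
  push_cast at hX
  rcases hc4 with rfl | rfl | rfl | rfl
  · obtain ⟨R, hR, h⟩ := exists_half_twistPt Q hq (u := k / e) (by rw [hX]; push_cast; ring) hx hv
    exact ⟨R, hR, 0, by simp, by rw [zero_smul, zero_add, h]⟩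
  · exact add_ptC_of_class_two Q hq (u := k / e) (by rw [hX]; push_cast; ring) hx hzw hv
  · obtain ⟨R, hR, h⟩ := exists_half_twistPt Q hq' (u := 2 * e / k) (by
      rw [hX] at h5
      push_cast at h5
      field_simp at h5 ⊢
      linear_combination h5 / 10) hx hv
    exact ⟨R, hR, 0, by simp, by rw [zero_smul, zero_add, h]⟩
  · have hv' : -2 * (-v) ^ 2 = x ^ 3 + x ^ 2 - x := by rw [neg_sq, hv]
    obtain ⟨R, hR, b, hb, h⟩ := add_ptC_of_class_two Q hq' (u := e / k) (v := -v) (by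
      rw [hX] at h5
      push_cast at h5
      field_simp at h5 ⊢
      linear_combination h5 / 20) hx (by linear_combination -hzw) hv'
    refine ⟨-R, neg_mem hR, -b, by omega, ?_⟩
    rw [← neg_twistPt Q x v hv, neg_eq_iff_eq_neg] at h
    rw [h, neg_smul, smul_neg, neg_add]

theorem exists_decomposition {P} (hP : P ∈ antiInvariant Q) :
    ∃ R ∈ antiInvariant Q, ∃ a b : ℤ, (a = 0 ∨ a = 1) ∧ (b = 0 ∨ b = 1 ∨ b = -1) ∧
      P = a • ptT K + b • ptC Q + 2 • R := by
  rcases eq_zero_or_twistPt Q hP with rfl | ⟨x, v, h, rfl⟩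
  · exact ⟨0, zero_mem _, 0, 0, by simp⟩
  by_cases hx : x = 0
  · subst hx
    have hv : v = 0 := by simpa using h
    subst hv
    refine ⟨0, zero_mem _, 1, 0, by simp, by simp, ?_⟩
    rw [zero_smul, one_smul, smul_zero, add_zero, add_zero, twistPt, ptT, pt_inj]
    simp
  have hsq : ∃ w : ℚ, -2 * x = w ^ 2 ∨ -2 * x = -w ^ 2 := by
    obtain ⟨c, k, e, t, hc, hcb, -, -, -, hce, hx', ht⟩ :=
      exists_squarefree_of_sq_eq_mul (a := -2) (b := -(-2) ^ 2) (x := -2 * x) (y := 4 * v)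
        (mul_ne_zero (by norm_num) hx) (by push_cast; linear_combination -8 * h)
    rcases left_of_prime (d := -2) Nat.prime_two (.inr rfl) (by decide) hc hcb hce ht with rfl | rfl
    · exact ⟨k / e, .inl (by rw [hx']; push_cast; ring)⟩
    · exact ⟨k / e, .inr (by rw [hx']; push_cast; ring)⟩
  obtain ⟨w, hw | hw⟩ := hsq
  · have hw0 : w ≠ 0 := by
      rintro rfl
      exact hx (by linarith)
    obtain ⟨R, hR, b, hb, h'⟩ := exists_decomposition_of_sq Q hw hw0 h
    exact ⟨R, hR, 0, b, by simp, hb, by rw [h', zero_smul, zero_add]⟩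
  · have hw0 : w ≠ 0 := by
      rintro rfl
      exact hx (by linarith)
    have hxK : (x : K) ≠ 0 := by exact_mod_cast hx
    have h2 : -2 * (v / x ^ 2) ^ 2 = (-1 / x) ^ 3 + (-1 / x) ^ 2 - (-1 / x) := by
      field_simp
      linear_combination h
    -- If -2x is minus a square, P + T has abscissa -1/x and falls under the square case.
    obtain ⟨R, hR, b, hb, h'⟩ := exists_decomposition_of_sq Q (x := -1 / x) (w := 2 / w)
      (by field_simp; linear_combination hw) (by positivity) h2
    refine ⟨R, hR, 1, b, by simp, hb, ?_⟩
    obtain ⟨h3, hadd⟩ := pt_add_pt (h₁ := twistPt_equation Q h) (h₂ := (by ring : (0 : K) ^ 2 = _)) hxK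
      (l := v * Q.s / x) (x₃ := ((-1 / x : ℚ) : K)) (y₃ := ((v / x ^ 2 : ℚ) : K) * Q.s)
      (by field_simp; ring) (by
        push_cast
        rw [div_pow, twistPt_equation Q h]
        field_simp
        ring) (by push_cast; field_simp; ring)
    have hadd' : twistPt Q x v h + ptT K = b • ptC Q + 2 • R := hadd.trans h'
    have hT : ptT K + ptT K = 0 := by rw [← two_nsmul]; exact two_nsmul_ptT
    rw [one_smul, add_assoc, ← hadd', add_comm, add_assoc, hT, add_zero]

end X1_2_10

end

/-! ### Rank one over ℚ(√-2) -/

section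

open WeierstrassCurve WeierstrassCurve.Affine

namespace X1_2_10

variable {K : Type*} [Field K] [CharZero K] [DecidableEq K] (Q : QuadraticConj K (-2))

/-- 2C has abscissa -25/8, and each further doubling lowers the 2-adic valuation by 2. Hence the
points 2ⁿ⁺¹C are pairwise distinct. -/
lemma exists_two_pow_nsmul_ptC (n : ℕ) : ∃ (x : ℚ) (y : K) (h : _),
    2 ^ (n + 1) • ptC Q = pt (x : K) y h ∧ padicValRat 2 x = -3 - 2 * n := by
  induction n with
  | zero =>
    obtain ⟨y', h', h2⟩ := two_nsmul_pt_of_ne_zero (h := ptC_equation Q) Q.s_ne_zero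
    rw [zero_add, pow_one]
    refine ⟨-25 / 8, y', ?_, ?_, ?_⟩
    · convert h' using 2 <;> norm_num
    · rw [ptC, h2, pt_inj]
      norm_num
    · rw [padicValRat.div (by norm_num) (by norm_num), padicValRat.neg,
        show (8 : ℚ) = ((2 ^ 3 : ℕ) : ℚ) by norm_num, show (25 : ℚ) = ((25 : ℕ) : ℚ) by norm_num,
        padicValRat.of_nat, padicValRat.of_nat, padicValNat.prime_pow,
        padicValNat.eq_zero_of_not_dvd (by norm_num)]
      norm_num
  | succ n ih =>
    obtain ⟨x, y, h, h1, h2⟩ := ih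
    obtain ⟨h3, h4⟩ := Rat.padicValRat_double (p := 2) (x := x) (by omega)
    obtain ⟨y', h', h5⟩ := two_nsmul_pt_of_ne_zero (h := h) (by
      rintro rfl
      apply h3
      rw [zero_pow two_ne_zero] at h
      exact_mod_cast h.symm)
    rw [pow_succ, mul_comm, mul_smul, h1, h5]
    refine ⟨(x ^ 2 + 1) ^ 2 / (4 * (x ^ 3 + x ^ 2 - x)), y', by push_cast; exact h', ?_, ?_⟩
    · rw [pt_inj]; push_cast; exact ⟨rfl, rfl⟩
    · have : padicValRat 2 (4 : ℚ) = 2 := by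
        rw [show (4 : ℚ) = ((2 ^ 2 : ℕ) : ℚ) by norm_num, padicValRat.of_nat, padicValNat.prime_pow]
        rfl
      rw [h4, h2, this]
      push_cast; ring

lemma not_isOfFinAddOrder_ptC : ¬ IsOfFinAddOrder (ptC Q) := by
  intro hfin
  have := (finite_multiples.2 hfin).to_subtype
  obtain ⟨i, j, hne, heq⟩ := Finite.exists_ne_map_eq_of_infinite
    (fun n : ℕ ↦ (⟨2 ^ (n + 1) • ptC Q, (AddSubmonoid.mem_multiples_iff _ _).2 ⟨_, rfl⟩⟩ :
      AddSubmonoid.multiples (ptC Q)))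
  replace heq : 2 ^ (i + 1) • ptC Q = 2 ^ (j + 1) • ptC Q := congrArg Subtype.val heq
  obtain ⟨x, y, h, h1, h2⟩ := exists_two_pow_nsmul_ptC Q i
  obtain ⟨x', y', h', h3, h4⟩ := exists_two_pow_nsmul_ptC Q j
  rw [h1, h3, pt_inj, Rat.cast_inj] at heq
  rw [heq.1, h4] at h2
  omega

/-- The points with a nonzero multiple in the subgroup generated by `(-2, √-2)`. -/
noncomputable def saturation : AddSubgroup (X1_2_10 K).toAffine.Point where
  carrier := {P | ∃ n : ℕ, n ≠ 0 ∧ n • P ∈ AddSubgroup.zmultiples (ptC Q)}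
  zero_mem' := ⟨1, one_ne_zero, by simp⟩
  neg_mem' := fun ⟨n, hn, h⟩ ↦ ⟨n, hn, by rw [smul_neg]; exact neg_mem h⟩
  add_mem' := fun {P P'} ⟨n, hn, h⟩ ⟨m, hm, h'⟩ ↦ ⟨n * m, mul_ne_zero hn hm, by
    rw [smul_add, mul_smul n m P', mul_comm, mul_smul]
    exact add_mem (nsmul_mem h m) (nsmul_mem h' n)⟩

lemma mem_saturation_of_nsmul_mem {n : ℕ} {P} (hn : n ≠ 0) (h : n • P ∈ saturation Q) :
    P ∈ saturation Q := by
  obtain ⟨m, hm, h⟩ := h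
  exact ⟨m * n, mul_ne_zero hm hn, by rwa [mul_smul]⟩

lemma ptC_mem_saturation : ptC Q ∈ saturation Q :=
  ⟨1, one_ne_zero, by simp⟩

lemma mem_saturation_of_nsmul_eq_zero {n : ℕ} {P} (hn : n ≠ 0) (h : n • P = 0) :
    P ∈ saturation Q :=
  ⟨n, hn, by rw [h]; exact zero_mem _⟩

theorem mordellWeilRank_eq_one {K : Type*} [Field K] [NumberField K] [DecidableEq K]
    (Q : QuadraticConj K (-2)) : (X1_2_10 K).mordellWeilRank = 1 := by
  have hle : antiInvariant Q ≤ saturation Q := by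
    refine AddSubgroup.le_of_descent (fun P ↦ Height.logHeight P.xRep) (fun P ↦ ?_)
      Point.exists_abs_logHeight_xRep_parallelogram Point.finite_logHeight_xRep_le
      (fun n P hn ↦ mem_saturation_of_nsmul_mem Q hn)
      (T := (fun ab : ℤ × ℤ ↦ ab.1 • ptT K + ab.2 • ptC Q) '' (Set.Icc 0 1 ×ˢ Set.Icc (-1) 1))
      (Set.Finite.image _ ((Set.finite_Icc _ _).prod (Set.finite_Icc _ _))) ?_ ?_
    · positivity
    · rintro _ ⟨⟨a, b⟩, -, rfl⟩
      exact add_mem (zsmul_mem (mem_saturation_of_nsmul_eq_zero Q two_ne_zero two_nsmul_ptT) _)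
        (zsmul_mem (ptC_mem_saturation Q) _)
    · intro P hP
      obtain ⟨R, hR, a, b, ha, hb, h⟩ := exists_decomposition Q hP
      refine ⟨R, hR, _, ⟨(a, b), ⟨?_, ?_⟩, rfl⟩, h⟩
      · simp only [Set.mem_Icc]; omega
      · simp only [Set.mem_Icc]; omega
  -- P - σP is covered by the descent and P + σP is rational, hence torsion; their sum is 2P.
  have htop : ∀ P, P ∈ saturation Q := by
    intro P
    refine mem_saturation_of_nsmul_mem Q two_ne_zero ?_
    have hσσ : conj Q.σ (conj Q.σ P) = P := by
      rcases eq_zero_or_pt P with rfl | ⟨x, y, h, rfl⟩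
      · simp
      · rw [conj_pt, conj_pt, pt_inj, Q.σ_σ, Q.σ_σ]; simp
    obtain ⟨a, b, hab⟩ := eq_of_conj_eq Q (P := P + conj Q.σ P) (by rw [map_add, hσσ, add_comm])
    have h1 : P - conj Q.σ P ∈ saturation Q :=
      hle ((mem_antiInvariant Q).2 (by rw [map_sub, hσσ, neg_sub]))
    have h2 : P + conj Q.σ P ∈ saturation Q := by
      rw [hab]
      exact add_mem (zsmul_mem (mem_saturation_of_nsmul_eq_zero Q three_ne_zero three_nsmul_ptA) _)
        (zsmul_mem (mem_saturation_of_nsmul_eq_zero Q two_ne_zero two_nsmul_ptT) _)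
    have := add_mem h1 h2
    rwa [sub_add_add_cancel, ← two_nsmul] at this
  have hli : LinearIndepOn ℤ id {ptC Q} := LinearIndepOn.singleton' fun r hr ↦ by
    by_contra hr0
    exact not_isOfFinAddOrder_ptC Q (isOfFinAddOrder_iff_zsmul_eq_zero.2 ⟨r, hr0, hr⟩)
  rw [WeierstrassCurve.mordellWeilRank,
    ← rank_quotient_add_rank_of_isDomain (Submodule.span ℤ {ptC Q}), rank_span_set hli,
    Cardinal.mk_singleton, rank_eq_zero_iff.2, zero_add]
  intro x
  obtain ⟨P, rfl⟩ := Submodule.Quotient.mk_surjective _ x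
  obtain ⟨n, hn, h⟩ := htop P
  refine ⟨n, by exact_mod_cast hn, ?_⟩
  rw [← Submodule.Quotient.mk_smul, Submodule.Quotient.mk_eq_zero, Submodule.mem_span_singleton]
  obtain ⟨k, hk⟩ := h
  exact ⟨k, by simpa using hk⟩

end X1_2_10

end

/-! ### From ℤ/2 ⊕ ℤ/10 to a noncuspidal point -/

section

open WeierstrassCurve WeierstrassCurve.Affine

/-- The parameter of the Tate normal form of a curve with a point of order `5` and full
`2`-torsion comes from a noncuspidal point of `y² = x³ + x² - x`. -/
theorem exists_noncusp_of_tate {K : Type*} [Field K] [CharZero K] {t e₁ e₂ e₃ : K} (ht : t ≠ 0)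
    (h₁ : 4 * (e₁ + e₂ + e₃) = -((1 - t) ^ 2 - 4 * t))
    (h₂ : 2 * (e₁ * e₂ + e₁ * e₃ + e₂ * e₃) = -t * (1 - t)) (h₃ : 4 * (e₁ * e₂ * e₃) = -t ^ 2)
    (h₁₂ : e₁ ≠ e₂) (h₁₃ : e₁ ≠ e₃) (h₂₃ : e₂ ≠ e₃) :
    ∃ x y : K, y ^ 2 = x ^ 3 + x ^ 2 - x ∧
      x * (x - 1) * (x + 1) * (x ^ 2 + x - 1) * (x ^ 2 - 4 * x - 1) ≠ 0 := by
  have he : e₁ ≠ 0 := by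
    rintro rfl
    apply pow_ne_zero 2 ht
    linear_combination h₃
  have hroot : t ^ 2 * (e₁ + 1) ^ 2 - t * (6 * e₁ ^ 2 + 2 * e₁) + 4 * e₁ ^ 3 + e₁ ^ 2 = 0 := by
    linear_combination e₁ ^ 2 * h₁ - 2 * e₁ * h₂ + h₃
  -- As a quadratic in t, `hroot` has discriminant -16e₁⁵. Its t-derivative divided by 4e₁² is thus
  -- a square root r of -e₁.
  obtain ⟨r, hr⟩ : ∃ r, 2 * t * (e₁ + 1) ^ 2 - 6 * e₁ ^ 2 - 2 * e₁ = r * (4 * e₁ ^ 2) :=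
    ⟨(2 * t * (e₁ + 1) ^ 2 - 6 * e₁ ^ 2 - 2 * e₁) / (4 * e₁ ^ 2), by field_simp⟩
  have hre : e₁ = -r ^ 2 := by
    have : 16 * e₁ ^ 4 * (e₁ + r ^ 2) = 0 := by
      linear_combination 4 * (e₁ + 1) ^ 2 * hroot -
        (2 * t * (e₁ + 1) ^ 2 - 6 * e₁ ^ 2 - 2 * e₁ + r * (4 * e₁ ^ 2)) * hr
    have h0 : 16 * e₁ ^ 4 ≠ 0 := mul_ne_zero (by norm_num) (pow_ne_zero 4 he)
    linear_combination (mul_eq_zero.1 this).resolve_left h0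
  have hr0 : r ≠ 0 := by
    rintro rfl
    exact he (by rw [hre]; ring)
  have hr1 : r - 1 ≠ 0 := by
    intro h
    obtain rfl : r = 1 := by linear_combination h
    have : (8 : K) = 0 := by
      rw [hre] at hr
      linear_combination -hr
    norm_num at this
  have htr : t * (1 - r) ^ 2 = r ^ 2 * (2 * r - 1) := by
    -- For r = -1 one has e₁ = -1 and the quadratic in t becomes linear; it is then used directly.
    by_cases h : r + 1 = 0
    · obtain rfl : r = -1 := by linear_combination h
      rw [hre] at hroot
      linear_combination -hroot
    · apply mul_left_cancel₀ (pow_ne_zero 2 h)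
      rw [hre] at hr
      linear_combination hr / 2
  obtain ⟨D, hD⟩ : ∃ D, D = (e₁ - e₂) * (e₁ - e₃) * (e₂ - e₃) := ⟨_, rfl⟩
  have hD0 : D ≠ 0 := by
    rw [hD]
    exact mul_ne_zero (mul_ne_zero (sub_ne_zero.2 h₁₂) (sub_ne_zero.2 h₁₃)) (sub_ne_zero.2 h₂₃)
  have hdisc : 16 * D ^ 2 = t ^ 5 * (t ^ 2 - 11 * t - 1) := by
    obtain ⟨s₁, hs₁⟩ : ∃ s₁, s₁ = e₁ + e₂ + e₃ := ⟨_, rfl⟩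
    obtain ⟨s₂, hs₂⟩ : ∃ s₂, s₂ = e₁ * e₂ + e₁ * e₃ + e₂ * e₃ := ⟨_, rfl⟩
    obtain ⟨s₃, hs₃⟩ : ∃ s₃, s₃ = e₁ * e₂ * e₃ := ⟨_, rfl⟩
    have h : D ^ 2 = s₁ ^ 2 * s₂ ^ 2 - 4 * s₂ ^ 3 - 4 * s₁ ^ 3 * s₃ + 18 * s₁ * s₂ * s₃ -
        27 * s₃ ^ 2 := by
      rw [hD, hs₁, hs₂, hs₃]; ring
    rw [← hs₁] at h₁
    rw [← hs₂] at h₂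
    rw [← hs₃] at h₃
    have h₁' : s₁ = -((1 - t) ^ 2 - 4 * t) / 4 := by linear_combination h₁ / 4
    have h₂' : s₂ = -t * (1 - t) / 2 := by linear_combination h₂ / 2
    have h₃' : s₃ = -t ^ 2 / 4 := by linear_combination h₃ / 4
    rw [h, h₁', h₂', h₃']
    ring
  have hkey : 16 * D ^ 2 * (1 - r) ^ 14 =
      r ^ 10 * (2 * r - 1) ^ 5 * ((4 * r ^ 2 - 2 * r - 1) * (r ^ 2 - 3 * r + 1) ^ 2) := by
    calc 16 * D ^ 2 * (1 - r) ^ 14 = (t * (1 - r) ^ 2) ^ 5 * ((t * (1 - r) ^ 2) ^ 2 -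
          11 * (t * (1 - r) ^ 2) * (1 - r) ^ 2 - (1 - r) ^ 4) := by rw [hdisc]; ring
      _ = _ := by rw [htr]; ring
  have hne : r ^ 10 * (2 * r - 1) ^ 5 * ((4 * r ^ 2 - 2 * r - 1) * (r ^ 2 - 3 * r + 1) ^ 2) ≠ 0 := by
    rw [← hkey]
    refine mul_ne_zero (mul_ne_zero (by norm_num) (pow_ne_zero 2 hD0)) (pow_ne_zero _ ?_)
    rwa [← neg_sub, neg_ne_zero]
  have hA : 2 * r - 1 ≠ 0 := fun h ↦ hne (by rw [h]; ring)
  have hB : 4 * r ^ 2 - 2 * r - 1 ≠ 0 := fun h ↦ hne (by rw [h]; ring)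
  have hC : r ^ 2 - 3 * r + 1 ≠ 0 := fun h ↦ hne (by rw [h]; ring)
  -- Modulo squares, `hkey` says that (2r - 1)(4r² - 2r - 1) is a square, and the second factor is
  -- x² + x - 1 for x = 2r - 1.
  refine ⟨2 * r - 1, 4 * D * (1 - r) ^ 7 / (r ^ 5 * (2 * r - 1) ^ 2 * (r ^ 2 - 3 * r + 1)), ?_, ?_⟩
  · rw [div_pow, div_eq_iff (by positivity)]
    linear_combination hkey
  · have : (2 * r - 1) * (2 * r - 1 - 1) * (2 * r - 1 + 1) * ((2 * r - 1) ^ 2 + (2 * r - 1) - 1) *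
        ((2 * r - 1) ^ 2 - 4 * (2 * r - 1) - 1) =
        16 * ((2 * r - 1) * (r - 1) * r * (4 * r ^ 2 - 2 * r - 1) * (r ^ 2 - 3 * r + 1)) := by ring
    rw [this]
    exact mul_ne_zero (by norm_num) (mul_ne_zero (mul_ne_zero (mul_ne_zero (mul_ne_zero hA hr1) hr0)
      hB) hC)

/-- The coefficients of a cubic with three distinct roots. -/
theorem coeff_eq_of_roots {K : Type*} [Field K] {a b c d e₁ e₂ e₃ : K}
    (h₁ : a * e₁ ^ 3 + b * e₁ ^ 2 + c * e₁ + d = 0) (h₂ : a * e₂ ^ 3 + b * e₂ ^ 2 + c * e₂ + d = 0)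
    (h₃ : a * e₃ ^ 3 + b * e₃ ^ 2 + c * e₃ + d = 0) (h₁₂ : e₁ ≠ e₂) (h₁₃ : e₁ ≠ e₃) (h₂₃ : e₂ ≠ e₃) :
    a * (e₁ + e₂ + e₃) = -b ∧ a * (e₁ * e₂ + e₁ * e₃ + e₂ * e₃) = c ∧ a * (e₁ * e₂ * e₃) = -d := by
  have h₄ : a * (e₁ ^ 2 + e₁ * e₂ + e₂ ^ 2) + b * (e₁ + e₂) + c = 0 :=
    mul_left_cancel₀ (sub_ne_zero.2 h₁₂) (by linear_combination h₁ - h₂)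
  have h₅ : a * (e₁ ^ 2 + e₁ * e₃ + e₃ ^ 2) + b * (e₁ + e₃) + c = 0 :=
    mul_left_cancel₀ (sub_ne_zero.2 h₁₃) (by linear_combination h₁ - h₃)
  have h₆ : a * (e₁ + e₂ + e₃) + b = 0 :=
    mul_left_cancel₀ (sub_ne_zero.2 h₂₃) (by linear_combination h₄ - h₅)
  refine ⟨by linear_combination h₆, by linear_combination (e₁ + e₂) * h₆ - h₄, ?_⟩
  linear_combination h₁ - e₁ * h₄ + e₁ * e₂ * h₆

/-- The case of a general curve whose point `(0, 0)` has order `5`. -/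
theorem exists_noncusp_of_coeff {K : Type*} [Field K] [CharZero K] {a₁ a₂ a₃ e₁ e₂ e₃ : K}
    (ha₂ : a₂ ≠ 0) (ha₃ : a₃ ≠ 0) (h : a₃ ^ 2 - a₁ * a₂ * a₃ + a₂ ^ 3 = 0)
    (h₁ : 4 * (e₁ + e₂ + e₃) = -(a₁ ^ 2 + 4 * a₂))
    (h₂ : 4 * (e₁ * e₂ + e₁ * e₃ + e₂ * e₃) = 2 * (a₁ * a₃)) (h₃ : 4 * (e₁ * e₂ * e₃) = -a₃ ^ 2)
    (h₁₂ : e₁ ≠ e₂) (h₁₃ : e₁ ≠ e₃) (h₂₃ : e₂ ≠ e₃) :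
    ∃ x y : K, y ^ 2 = x ^ 3 + x ^ 2 - x ∧
      x * (x - 1) * (x + 1) * (x ^ 2 + x - 1) * (x ^ 2 - 4 * x - 1) ≠ 0 := by
  -- Scaling by u makes a₂ and a₃ equal, with common value -t; the order-5 relation then gives a₁ =
  -- 1 - t.
  obtain ⟨u, hu⟩ : ∃ u, u = a₃ / a₂ := ⟨_, rfl⟩
  have hu0 : u ≠ 0 := hu ▸ div_ne_zero ha₃ ha₂
  have h3 : a₃ = u * a₂ := by rw [hu, div_mul_cancel₀ _ ha₂]
  obtain ⟨t, ht⟩ : ∃ t, t = -a₂ / u ^ 2 := ⟨_, rfl⟩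
  have h2 : a₂ = -t * u ^ 2 := by rw [ht]; field_simp
  have ht0 : t ≠ 0 := by
    rintro rfl
    exact ha₂ (by rw [h2]; ring)
  rw [h2] at h3
  have h1 : a₁ = (1 - t) * u := by
    have : t ^ 2 * u ^ 5 * (a₁ - (1 - t) * u) = 0 := by
      rw [h3, h2] at h
      linear_combination -h
    have h0 : t ^ 2 * u ^ 5 ≠ 0 := by positivity
    linear_combination (mul_eq_zero.1 this).resolve_left h0
  subst h1 h2 h3
  have hinj : ∀ {a b : K}, a ≠ b → a / u ^ 2 ≠ b / u ^ 2 := fun hab h ↦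
    hab ((div_left_inj' (pow_ne_zero 2 hu0)).1 h)
  refine exists_noncusp_of_tate (t := t) ht0 (e₁ := e₁ / u ^ 2) (e₂ := e₂ / u ^ 2)
    (e₃ := e₃ / u ^ 2) ?_ ?_ ?_ (hinj h₁₂) (hinj h₁₃) (hinj h₂₃)
  · field_simp
    linear_combination h₁
  · field_simp
    linear_combination h₂ / 2
  · field_simp
    linear_combination h₃

namespace WeierstrassCurve.Affine.Point

variable {K : Type*} [Field K] [DecidableEq K] {W : WeierstrassCurve.Affine K}

lemma eq_some_of_ne_zero {P : W.Point} (hP : P ≠ 0) : ∃ x y h, P = some x y h := by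
  match P with
  | 0 => exact absurd rfl hP
  | some x y h => exact ⟨x, y, h, rfl⟩

lemma two_mul_add_eq_zero {x y : K} {h : W.Nonsingular x y} (h2 : 2 • some x y h = 0) :
    2 * y + W.a₁ * x + W.a₃ = 0 := by
  rw [two_nsmul, add_eq_zero_iff_eq_neg, neg_some, some.injEq] at h2
  rw [← sub_negY, ← h2.2, sub_self]

/-- The `x`-coordinates of the points of order `2`. -/
lemma exists_roots [CharZero K] {T₁ T₂ T₃ : W.Point} (h₁ : T₁ ≠ 0) (h₂ : T₂ ≠ 0) (h₃ : T₃ ≠ 0)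
    (h₁₂ : T₁ ≠ T₂) (h₁₃ : T₁ ≠ T₃) (h₂₃ : T₂ ≠ T₃) (ht₁ : 2 • T₁ = 0) (ht₂ : 2 • T₂ = 0)
    (ht₃ : 2 • T₃ = 0) :
    ∃ e₁ e₂ e₃ : K, e₁ ≠ e₂ ∧ e₁ ≠ e₃ ∧ e₂ ≠ e₃ ∧ 4 * (e₁ + e₂ + e₃) = -W.b₂ ∧
      4 * (e₁ * e₂ + e₁ * e₃ + e₂ * e₃) = 2 * W.b₄ ∧ 4 * (e₁ * e₂ * e₃) = -W.b₆ := by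
  obtain ⟨x₁, y₁, hn₁, rfl⟩ := eq_some_of_ne_zero h₁
  obtain ⟨x₂, y₂, hn₂, rfl⟩ := eq_some_of_ne_zero h₂
  obtain ⟨x₃, y₃, hn₃, rfl⟩ := eq_some_of_ne_zero h₃
  replace ht₁ := two_mul_add_eq_zero ht₁
  replace ht₂ := two_mul_add_eq_zero ht₂
  replace ht₃ := two_mul_add_eq_zero ht₃
  have hne : ∀ {x y x' y' : K} {h : W.Nonsingular x y} {h' : W.Nonsingular x' y'},
      2 * y + W.a₁ * x + W.a₃ = 0 → 2 * y' + W.a₁ * x' + W.a₃ = 0 → some x y h ≠ some x' y' h' →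
      x ≠ x' := by
    rintro x y x' y' h h' hy hy' hne rfl
    have : y = y' := mul_left_cancel₀ two_ne_zero (by linear_combination hy - hy')
    subst this
    exact hne rfl
  have hroot : ∀ {x y : K}, W.Nonsingular x y → 2 * y + W.a₁ * x + W.a₃ = 0 →
      4 * x ^ 3 + W.b₂ * x ^ 2 + 2 * W.b₄ * x + W.b₆ = 0 := by
    intro x y h hy
    rw [← sq_two_mul_add h.1, hy, zero_pow two_ne_zero]
  refine ⟨x₁, x₂, x₃, hne ht₁ ht₂ h₁₂, hne ht₁ ht₃ h₁₃, hne ht₂ ht₃ h₂₃, ?_⟩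
  exact coeff_eq_of_roots (hroot hn₁ ht₁) (hroot hn₂ ht₂) (hroot hn₃ ht₃) (hne ht₁ ht₂ h₁₂)
    (hne ht₁ ht₃ h₁₃) (hne ht₂ ht₃ h₂₃)

/-- The coefficients of a Weierstrass equation after moving a point of order `5` to the origin,
with horizontal tangent. -/
lemma exists_coeff_of_order_five {P : W.Point} (hP : P ≠ 0) (h5 : 5 • P = 0) :
    ∃ x a₁ a₂ a₃ : K, a₂ ≠ 0 ∧ a₃ ≠ 0 ∧ a₃ ^ 2 - a₁ * a₂ * a₃ + a₂ ^ 3 = 0 ∧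
      W.b₂ + 12 * x = a₁ ^ 2 + 4 * a₂ ∧ W.b₄ + x * W.b₂ + 6 * x ^ 2 = a₁ * a₃ ∧
      W.b₆ + 2 * x * W.b₄ + x ^ 2 * W.b₂ + 4 * x ^ 3 = a₃ ^ 2 := by
  have h2 : 2 • P ≠ 0 := by
    intro h
    apply hP
    have : (5 : ℕ) • P = 2 • P + 2 • P + P := by module
    rw [← h5, this, h, zero_add, zero_add]
  have h3 : 3 • P ≠ 0 := by
    intro h
    apply h2
    have : (5 : ℕ) • P = 3 • P + 2 • P := by module
    rw [← h5, this, h, zero_add]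
  obtain ⟨x, y, hn, rfl⟩ := eq_some_of_ne_zero hP
  have hy : y ≠ W.negY x y := by
    intro h
    exact h2 (by rw [two_nsmul, add_self_of_Y_eq h])
  have h2' := add_self_of_Y_ne (h₁ := hn) hy
  have hd : 2 * y + W.a₁ * x + W.a₃ ≠ 0 := by
    rw [← sub_negY]; exact sub_ne_zero.2 hy
  set l := W.slope x x y y with hl
  have hl' : l * (2 * y + W.a₁ * x + W.a₃) = 3 * x ^ 2 + 2 * W.a₂ * x + W.a₄ - W.a₁ * y := by
    rw [hl, slope_of_Y_ne rfl hy, sub_negY, div_mul_cancel₀ _ hd]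
  set x₂ := W.addX x x l with hx₂
  set y₂ := W.addY x x y l with hy₂
  have hx₂' : x₂ = l ^ 2 + W.a₁ * l - W.a₂ - x - x := rfl
  have hy₂' : y₂ = -(l * (x₂ - x) + y) - W.a₁ * x₂ - W.a₃ := rfl
  have hne : x₂ ≠ x := by
    intro h
    rcases Y_eq_of_X_eq (nonsingular_add hn hn fun hxy ↦ hy hxy.2).1 hn.1 h with h' | h'
    · apply hP
      have : some x y hn + some x y hn = some x y hn := by
        rw [h2', some.injEq]; exact ⟨h, h'⟩
      simp at this
    · apply h3
      have : some x y hn + some x y hn = -some x y hn := by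
        rw [h2', neg_some, some.injEq]; exact ⟨h, h'⟩
      rw [succ_nsmul, two_nsmul, this, neg_add_cancel]
  have h3' : some x₂ y₂ (nonsingular_add hn hn fun hxy ↦ hy hxy.2) + some x y hn =
      -some x₂ y₂ (nonsingular_add hn hn fun hxy ↦ hy hxy.2) := by
    rw [← h2', eq_neg_iff_add_eq_zero, ← h5]
    module
  rw [add_of_X_ne hne, neg_some, some.injEq, slope_of_X_ne hne] at h3'
  have hx := h3'.1
  have ha₂ : x - x₂ ≠ 0 := sub_ne_zero.2 hne.symm
  have hB := sq_two_mul_add hn.1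
  -- In the new form y² + a₁xy + a₃y = x³ + a₂x² the double of the origin has abscissa -a₂, so a₂ =
  -- x - x₂. The cubic relation expresses x(3P) = x(2P).
  refine ⟨x, W.a₁ + 2 * l, x - x₂, 2 * y + W.a₁ * x + W.a₃, ha₂, hd, ?_, ?_, ?_, ?_⟩
  · have hs : (y₂ - y) / (x₂ - x) = (y - y₂) / (x - x₂) := by
      rw [← neg_sub y, ← neg_sub x, neg_div_neg_eq]
    rw [addX, hs] at hx
    have hxx : (y - y₂) ^ 2 + W.a₁ * (y - y₂) * (x - x₂) =
        (W.a₂ + x + 2 * x₂) * (x - x₂) ^ 2 := by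
      field_simp at hx
      linear_combination hx
    have : y - y₂ = (2 * y + W.a₁ * x + W.a₃) - (W.a₁ + l) * (x - x₂) := by rw [hy₂']; ring
    rw [this] at hxx
    linear_combination hxx + (x - x₂) ^ 2 * hx₂'
  · rw [hx₂', b₂]; ring
  · rw [b₂, b₄]; linear_combination -2 * hl'
  · rw [hB]; ring

end WeierstrassCurve.Affine.Point

theorem AppearsAsTorsion.exists_not_isCusp {K : Type*} [Field K] [CharZero K] [DecidableEq K]
    (h : AppearsAsTorsion K 2 10) : ∃ P : (X1_2_10 K).toAffine.Point, ¬ X1_2_10.IsCusp P := by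
  obtain ⟨W, -, ⟨e⟩⟩ := h
  let g : ZMod 2 × ZMod 10 → W.toAffine.Point := fun a ↦ e.symm a
  have hg : Function.Injective g := Subtype.val_injective.comp e.symm.injective
  have hg0 : g 0 = 0 := by simp [g]
  have hsmul : ∀ (n : ℕ) a, n • g a = g (n • a) := fun n a ↦ by
    simp only [g]
    rw [map_nsmul]
    rfl
  have hne : ∀ {a b}, a ≠ b → g a ≠ g b := fun hab h ↦ hab (hg h)
  have hne0 : ∀ {a}, a ≠ 0 → g a ≠ 0 := fun ha h ↦ ha (hg (h.trans hg0.symm))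
  obtain ⟨e₁, e₂, e₃, h₁₂, h₁₃, h₂₃, h₁, h₂, h₃⟩ := Point.exists_roots (T₁ := g (1, 0))
    (T₂ := g (0, 5)) (T₃ := g (1, 5)) (hne0 (by decide)) (hne0 (by decide)) (hne0 (by decide))
    (hne (by decide)) (hne (by decide)) (hne (by decide))
    (by rw [hsmul, ← hg0]; rfl) (by rw [hsmul, ← hg0]; rfl) (by rw [hsmul, ← hg0]; rfl)
  obtain ⟨x, a₁, a₂, a₃, ha₂, ha₃, h5, hb₂, hb₄, hb₆⟩ := Point.exists_coeff_of_order_five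
    (P := g (0, 2)) (hne0 (by decide)) (by rw [hsmul, ← hg0]; rfl)
  obtain ⟨X, Y, hXY, hc⟩ := exists_noncusp_of_coeff ha₂ ha₃ h5 (e₁ := e₁ - x) (e₂ := e₂ - x)
    (e₃ := e₃ - x) (by linear_combination h₁ - hb₂)
    (by linear_combination h₂ - 2 * x * h₁ + 2 * hb₄)
    (by linear_combination h₃ - x * h₂ + x ^ 2 * h₁ - hb₆)
    (by simpa using h₁₂) (by simpa using h₁₃) (by simpa using h₂₃)
  exact ⟨X1_2_10.pt X Y hXY, hc⟩

end

/-! ### Discriminants of quadratic fields -/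

section

open NumberField

theorem exists_intCast_of_isIntegral {K : Type*} [Field K] [CharZero K] {q : ℚ}
    (h : IsIntegral ℤ (q : K)) : ∃ n : ℤ, (q : K) = n := by
  have : IsIntegral ℤ q := by
    rw [← isIntegral_algebraMap_iff (algebraMap ℚ K).injective]
    simpa using h
  obtain ⟨n, rfl⟩ := IsIntegrallyClosed.isIntegral_iff.1 this
  exact ⟨n, by simp⟩

/-- An integral basis of a quadratic field, and the discriminant in terms of it. -/
theorem exists_basis_discr_eq {K : Type*} [Field K] [NumberField K]
    (hK : Module.finrank ℚ K = 2) {σ : K ≃ₐ[ℚ] K} (hσ1 : σ ≠ 1)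
    (hσ : ∀ g : K ≃ₐ[ℚ] K, g = 1 ∨ g = σ) :
    ∃ b : Module.Basis (Fin 2) ℤ (𝓞 K), (discr K : K) =
      ((b 0 : K) * σ (b 1) - σ (b 0) * (b 1 : K)) ^ 2 := by
  let b : Module.Basis (Fin 2) ℤ (𝓞 K) := Module.finBasisOfFinrankEq ℤ (𝓞 K)
    (by rw [RingOfIntegers.rank, hK])
  refine ⟨b, ?_⟩
  have : Algebra.IsQuadraticExtension ℚ K := ⟨hK⟩
  classical
  have huniv : (Finset.univ : Finset (K ≃ₐ[ℚ] K)) = {1, σ} := by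
    ext g; simpa using hσ g
  have htr : ∀ x : 𝓞 K, ((Algebra.trace ℤ (𝓞 K) x : ℤ) : K) = x + σ x := by
    intro x
    have h1 := trace_eq_sum_automorphisms (K := ℚ) (L := K) (x : K)
    rw [huniv, Finset.sum_pair hσ1.symm, ← Algebra.coe_trace_int] at h1
    simpa using h1
  rw [← discr_eq_discr K b, Algebra.discr_def, Matrix.det_fin_two]
  simp only [Algebra.traceMatrix_apply, Algebra.traceForm_apply]
  push_cast
  rw [htr, htr, htr, htr]
  push_cast
  rw [map_mul, map_mul, map_mul, map_mul]
  ring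

/-- For an integral basis b₀, b₁ the discriminant is (b₀σb₁ - σb₀b₁)² = m² - 4N(b₀)N(b₁) with m =
b₀σb₁ + σb₀b₁ an integer, which is Stickelberger's congruence. -/
theorem quadratic_discr {K : Type*} [Field K] [NumberField K] (hK : Module.finrank ℚ K = 2) :
    (∃ s : K, s ^ 2 = discr K) ∧ (∀ q : ℚ, q ^ 2 ≠ discr K) ∧
      (discr K % 4 = 0 ∨ discr K % 4 = 1) := by
  obtain ⟨σ, hσ1, hσ, hσσ, hfix⟩ := exists_quadratic_automorphism hK
  obtain ⟨b, hb⟩ := exists_basis_discr_eq hK hσ1 hσ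
  set s := (b 0 : K) * σ (b 1) - σ (b 0) * (b 1 : K) with hs
  have hσs : σ s = -s := by rw [hs, map_sub, map_mul, map_mul, hσσ, hσσ]; ring
  have hs0 : s ≠ 0 := by
    intro h0
    apply discr_ne_zero K
    rw [h0, zero_pow two_ne_zero] at hb
    exact_mod_cast hb
  have hint : ∀ x : 𝓞 K, IsIntegral ℤ (σ (x : K)) := fun x ↦ x.isIntegral_coe.map σ
  have hZ : ∀ x : K, IsIntegral ℤ x → σ x = x → ∃ n : ℤ, x = n := by
    intro x hx hx'
    obtain ⟨q, rfl⟩ := hfix x hx'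
    exact exists_intCast_of_isIntegral hx
  refine ⟨⟨s, hb.symm⟩, fun q hq ↦ ?_, ?_⟩
  · have h1 : (q : K) ^ 2 = s ^ 2 := by rw [← hb]; exact_mod_cast congrArg (Rat.cast : ℚ → K) hq
    have h2 : σ s = s := by
      rcases sq_eq_sq_iff_eq_or_eq_neg.1 h1 with h | h
      · rw [← h]; simp
      · rw [← neg_eq_iff_eq_neg.2 h]; simp
    rw [hσs, neg_eq_self] at h2
    exact hs0 h2
  · obtain ⟨m, hm⟩ := hZ ((b 0 : K) * σ (b 1) + σ (b 0) * (b 1 : K))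
      (((b 0).isIntegral_coe.mul (hint _)).add ((hint _).mul (b 1).isIntegral_coe))
      (by rw [map_add, map_mul, map_mul, hσσ, hσσ]; ring)
    obtain ⟨n₀, hn₀⟩ := hZ ((b 0 : K) * σ (b 0)) ((b 0).isIntegral_coe.mul (hint _))
      (by rw [map_mul, hσσ]; ring)
    obtain ⟨n₁, hn₁⟩ := hZ ((b 1 : K) * σ (b 1)) ((b 1).isIntegral_coe.mul (hint _))
      (by rw [map_mul, hσσ]; ring)
    have h4 : discr K = m ^ 2 - 4 * (n₀ * n₁) := by
      have : (discr K : K) = m ^ 2 - 4 * (n₀ * n₁) := by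
        rw [hb, hs, ← hm, ← hn₀, ← hn₁]; ring
      exact_mod_cast this
    rcases Int.even_or_odd' m with ⟨k, rfl | rfl⟩
    · left
      rw [h4, show (2 * k) ^ 2 - 4 * (n₀ * n₁) = 4 * (k ^ 2 - n₀ * n₁) by ring]
      exact Int.mul_emod_right _ _
    · right
      rw [h4, show (2 * k + 1) ^ 2 - 4 * (n₀ * n₁) = 1 + 4 * (k ^ 2 + k - n₀ * n₁) by ring]
      simp

theorem exists_sqrt_of_abs_discr_le {K : Type*} [Field K] [NumberField K]
    (hK : Module.finrank ℚ K = 2) (h : |discr K| ≤ 8) :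
    ∃ d : ℤ, (d ∈ ({-1, 2, -3, 5, -7} : Set ℤ) ∨ d = -2) ∧ ∃ s : K, s ^ 2 = d := by
  obtain ⟨⟨s, hs⟩, hsq, h4⟩ := quadratic_discr hK
  generalize discr K = D at *
  rw [abs_le] at h
  have h0 : D ≠ 0 := fun h ↦ hsq 0 (by rw [h]; norm_num)
  have h1 : D ≠ 1 := fun h ↦ hsq 1 (by rw [h]; norm_num)
  have h2 : D ≠ 4 := fun h ↦ hsq 2 (by rw [h]; norm_num)
  have : D = -3 ∨ D = 5 ∨ D = -7 ∨ D = -4 ∨ D = 8 ∨ D = -8 := by omega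
  rcases this with rfl | rfl | rfl | rfl | rfl | rfl
  · exact ⟨_, by simp, s, hs⟩
  · exact ⟨_, by simp, s, hs⟩
  · exact ⟨_, by simp, s, hs⟩
  · exact ⟨-1, by simp, s / 2, by rw [div_pow, hs]; norm_num⟩
  · exact ⟨2, by simp, s / 2, by rw [div_pow, hs]; norm_num⟩
  · exact ⟨-2, by simp, s / 2, by rw [div_pow, hs]; norm_num⟩

/-- The order ℤ[s] has discriminant 4d, which is the field discriminant times the square of the
index. -/
theorem abs_discr_le_of_sqrt {K : Type*} [Field K] [NumberField K]
    (hK : Module.finrank ℚ K = 2) {d : ℤ} (hd : ∀ q : ℚ, q ^ 2 ≠ d) {s : K} (hs : s ^ 2 = d) :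
    |discr K| ≤ |4 * d| := by
  obtain ⟨σ, hσ1, hσ, hσσ, hfix⟩ := exists_quadratic_automorphism hK
  obtain ⟨b, hb⟩ := exists_basis_discr_eq hK hσ1 hσ
  have hσs : σ s = -s := by
    have h1 : σ s ^ 2 = s ^ 2 := by rw [← map_pow, hs]; simp
    rcases sq_eq_sq_iff_eq_or_eq_neg.1 h1 with h2 | h2
    · obtain ⟨q, rfl⟩ := hfix s h2
      exact absurd (by exact_mod_cast hs) (hd q)
    · exact h2
  have hd0 : d ≠ 0 := fun h ↦ hd 0 (by rw [h]; norm_num)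
  have hrep : ∀ x : K, IsIntegral ℤ x → ∃ m n : ℤ, x = m * (b 0 : K) + n * (b 1 : K) := by
    intro x hx
    have h1 := b.sum_repr ⟨x, hx⟩
    rw [Fin.sum_univ_two] at h1
    have h2 : x = algebraMap (𝓞 K) K _ := congrArg (algebraMap (𝓞 K) K) h1.symm
    exact ⟨b.repr ⟨x, hx⟩ 0, b.repr ⟨x, hx⟩ 1, h2.trans (by simp)⟩
  obtain ⟨m, n, h1⟩ := hrep 1 isIntegral_one
  obtain ⟨k, l, h2⟩ := hrep s (IsIntegral.of_pow (n := 2) two_pos (by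
    rw [hs]; exact isIntegral_algebraMap (R := ℤ)))
  have h3 : (1 : K) = m * σ (b 0 : K) + n * σ (b 1 : K) := by
    have := congrArg σ h1
    simpa using this
  have h4 : -s = k * σ (b 0 : K) + l * σ (b 1 : K) := by
    rw [← hσs]
    have := congrArg σ h2
    simpa using this
  have h5 : 4 * d = (m * l - n * k) ^ 2 * discr K := by
    have h6 : -2 * s = (m * l - n * k) * ((b 0 : K) * σ (b 1) - σ (b 0) * (b 1 : K)) := by
      calc -2 * s = 1 * -s - s * 1 := by ring
        _ = (m * (b 0 : K) + n * (b 1 : K)) * (k * σ (b 0 : K) + l * σ (b 1 : K)) -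
            (k * (b 0 : K) + l * (b 1 : K)) * (m * σ (b 0 : K) + n * σ (b 1 : K)) := by
          rw [← h1, ← h2, ← h3, ← h4]
        _ = _ := by ring
    have h7 : (4 * d : K) = (m * l - n * k) ^ 2 * discr K := by
      rw [hb, ← mul_pow, ← h6, ← hs]; ring
    exact_mod_cast h7
  have h8 : m * l - n * k ≠ 0 := by
    intro h0
    rw [h0] at h5
    omega
  rw [h5, abs_mul]
  refine le_mul_of_one_le_left (abs_nonneg _) ?_
  rw [abs_of_nonneg (sq_nonneg _)]
  exact Int.add_one_le_iff.2 (sq_pos_iff.2 h8)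

theorem QSqrt.finrank_eq_two {d : ℤ} (hd : ∀ q : ℚ, q ^ 2 ≠ d) :
    Module.finrank ℚ (QSqrt d) = 2 := by
  obtain ⟨z, hz⟩ := IsAlgClosed.exists_pow_nat_eq (d : ℂ) (n := 2) (by norm_num)
  have hirr : Irreducible (Polynomial.X ^ 2 - Polynomial.C (d : ℚ)) :=
    X_pow_sub_C_irreducible_of_prime Nat.prime_two hd
  have hmin : minpoly ℚ z = Polynomial.X ^ 2 - Polynomial.C (d : ℚ) :=
    (minpoly.eq_of_irreducible_of_monic hirr (by simp [hz])
      (Polynomial.monic_X_pow_sub_C _ two_ne_zero)).symm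
  have hint : IsIntegral ℚ z := by
    by_contra h
    rw [minpoly.eq_zero h] at hmin
    exact hirr.ne_zero hmin.symm
  have hadj : QSqrt d = IntermediateField.adjoin ℚ {z} := by
    apply le_antisymm
    · rw [QSqrt, IntermediateField.adjoin_le_iff]
      intro w hw
      have hzm := IntermediateField.mem_adjoin_simple_self ℚ z
      rcases sq_eq_sq_iff_eq_or_eq_neg.1 (hw.trans hz.symm) with rfl | rfl
      · exact hzm
      · exact neg_mem hzm
    · rw [IntermediateField.adjoin_le_iff, Set.singleton_subset_iff]
      exact IntermediateField.subset_adjoin ℚ _ hz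
  rw [hadj, IntermediateField.adjoin.finrank hint, hmin, Polynomial.natDegree_X_pow_sub_C]

theorem QSqrt.nonempty_ringEquiv {K : Type*} [Field K] [NumberField K]
    (hK : Module.finrank ℚ K = 2) {d : ℤ} (hd : ∀ q : ℚ, q ^ 2 ≠ d) {s : K} (hs : s ^ 2 = d) :
    Nonempty (K ≃+* QSqrt d) := by
  let φ : K →ₐ[ℚ] ℂ := IsAlgClosed.lift
  have hle : QSqrt d ≤ φ.fieldRange := by
    rw [QSqrt, IntermediateField.adjoin_le_iff]
    intro w hw
    have hφ : φ s ^ 2 = d := by rw [← map_pow, hs]; simp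
    rcases sq_eq_sq_iff_eq_or_eq_neg.1 (hw.trans hφ.symm) with rfl | rfl
    · exact ⟨s, rfl⟩
    · exact ⟨-s, by simp⟩
  let e : K ≃ₐ[ℚ] φ.fieldRange := AlgEquiv.ofInjectiveField φ
  have hfin : Module.finrank ℚ φ.fieldRange = 2 := by rw [← e.toLinearEquiv.finrank_eq, hK]
  have : FiniteDimensional ℚ φ.fieldRange := Module.finite_of_finrank_eq_succ hfin
  have heq := IntermediateField.eq_of_le_of_finrank_eq hle (by rw [hfin, finrank_eq_two hd])
  exact ⟨(e.trans (IntermediateField.equivOfEq heq.symm)).toRingEquiv⟩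

end

/-! ### The explicit curve and its torsion -/

section

open WeierstrassCurve WeierstrassCurve.Affine

namespace WeierstrassCurve.Affine.Point

variable {F : Type*} [Field F] [DecidableEq F] {W : WeierstrassCurve.Affine F}

lemma some_add_some_eq {x₁ y₁ x₂ y₂ : F} {h₁ : W.Nonsingular x₁ y₁} {h₂ : W.Nonsingular x₂ y₂}
    (hx : x₁ ≠ x₂) {l x₃ y₃ : F} (hl : l * (x₁ - x₂) = y₁ - y₂)
    (hx₃ : x₃ = l ^ 2 + W.a₁ * l - W.a₂ - x₁ - x₂)
    (hy₃ : y₃ = -(l * (x₃ - x₁) + y₁) - W.a₁ * x₃ - W.a₃) :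
    ∃ h, some x₁ y₁ h₁ + some x₂ y₂ h₂ = some x₃ y₃ h := by
  have hsl : W.slope x₁ x₂ y₁ y₂ = l := by
    rw [slope_of_X_ne hx, div_eq_iff (sub_ne_zero.2 hx), hl]
  subst hsl hx₃ hy₃
  exact ⟨_, add_of_X_ne hx⟩

lemma two_nsmul_some_eq {x y : F} {h : W.Nonsingular x y} {l x₃ y₃ : F}
    (hy : 2 * y + W.a₁ * x + W.a₃ ≠ 0)
    (hl : l * (2 * y + W.a₁ * x + W.a₃) = 3 * x ^ 2 + 2 * W.a₂ * x + W.a₄ - W.a₁ * y)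
    (hx₃ : x₃ = l ^ 2 + W.a₁ * l - W.a₂ - x - x)
    (hy₃ : y₃ = -(l * (x₃ - x) + y) - W.a₁ * x₃ - W.a₃) :
    ∃ h', 2 • some x y h = some x₃ y₃ h' := by
  rw [← sub_negY] at hy hl
  have hne : y ≠ W.negY x y := sub_ne_zero.1 hy
  have hsl : W.slope x x y y = l := by rw [slope_of_Y_ne rfl hne, div_eq_iff hy, hl]
  subst hsl hx₃ hy₃
  exact ⟨_, (two_nsmul _).trans (add_self_of_Y_ne hne)⟩

lemma two_nsmul_some_eq_zero {x y : F} {h : W.Nonsingular x y}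
    (hy : 2 * y + W.a₁ * x + W.a₃ = 0) : 2 • some x y h = 0 := by
  rw [← sub_negY, sub_eq_zero] at hy
  exact (two_nsmul _).trans (add_self_of_Y_eq hy)

end WeierstrassCurve.Affine.Point

/-- `-2` is a square in `ℚ_[17]`. -/
theorem Padic.exists_sq_eq_neg_two [Fact (Nat.Prime 17)] : ∃ r : ℚ_[17], r ^ 2 = -2 := by
  -- 51 and 14 are the value and the derivative of X² + 2 at the approximate root 7.
  have h1 : ‖(51 : ℤ_[17])‖ < 1 := by
    have := (PadicInt.norm_int_lt_one_iff_dvd (p := 17) 51).2 (by norm_num)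
    simpa using this
  have h2 : ‖(14 : ℤ_[17])‖ = 1 := by
    have := (PadicInt.norm_natCast_eq_one_iff (p := 17) (n := 14)).2 (by norm_num)
    simpa using this
  obtain ⟨z, hz, -⟩ := hensels_lemma (p := 17) (R := ℤ_[17])
    (F := Polynomial.X ^ 2 + Polynomial.C 2) (a := 7) (by
      simp only [map_add, map_pow, Polynomial.aeval_X, Polynomial.aeval_C,
        Polynomial.derivative_X_pow, Polynomial.derivative_C]
      norm_num
      rw [h2]
      norm_num
      exact h1)
  refine ⟨z, ?_⟩
  have : z ^ 2 + 2 = 0 := by simpa using hz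
  have h3 : (z : ℚ_[17]) ^ 2 + 2 = 0 := by exact_mod_cast congrArg (Subtype.val) this
  linear_combination h3

/-- An embedding of `ℚ(√d)` into a field containing a square root of `d`. -/
theorem QSqrt.nonempty_ringHom {L : Type*} [Field L] [CharZero L] {d : ℤ} {r : L} (hr : r ^ 2 = d) :
    Nonempty (QSqrt d →+* L) := by
  have : Nonempty (QSqrt d →ₐ[ℚ] L) := by
    refine IntermediateField.nonempty_algHom_adjoin_of_splits fun z hz ↦ ?_
    have hz' : Polynomial.aeval z (Polynomial.X ^ 2 - Polynomial.C (d : ℚ)) = 0 := by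
      have : z ^ 2 = d := hz
      simp [this]
    refine ⟨⟨_, Polynomial.monic_X_pow_sub_C _ two_ne_zero, hz'⟩, ?_⟩
    have hfac : (Polynomial.X ^ 2 - Polynomial.C (d : ℚ)).map (algebraMap ℚ L) =
        (Polynomial.X - Polynomial.C r) * (Polynomial.X - Polynomial.C (-r)) := by
      rw [Polynomial.map_sub, Polynomial.map_pow, Polynomial.map_X, Polynomial.map_C, map_intCast,
        ← hr, map_neg, map_pow]
      ring
    refine Polynomial.Splits.of_dvd (g := (Polynomial.X ^ 2 - Polynomial.C (d : ℚ)).map (algebraMap ℚ L))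
      ?_ ?_ (Polynomial.map_dvd _ (minpoly.dvd ℚ z hz'))
    · rw [hfac]
      exact (Polynomial.Splits.X_sub_C _).mul (Polynomial.Splits.X_sub_C _)
    · rw [hfac]
      exact mul_ne_zero (Polynomial.X_sub_C_ne_zero _) (Polynomial.X_sub_C_ne_zero _)
  exact this.map AlgHom.toRingHom

namespace exampleCurve

lemma Δ_ne_zero : exampleCurve.Δ ≠ 0 := by
  simp only [exampleCurve, Δ, b₂, b₄, b₆, b₈]
  norm_num

instance isElliptic : exampleCurve.IsElliptic where
  isUnit := Δ_ne_zero.isUnit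

lemma nonsingular_iff {x y : QSqrt (-2)} : exampleCurve.toAffine.Nonsingular x y ↔
    y ^ 2 + 5 / 11 * x * y + 6 / 121 * y = x ^ 3 + 6 / 121 * x ^ 2 := by
  rw [← equation_iff_nonsingular, equation_iff]
  simp [exampleCurve]

/-- The reduction of `exampleCurve` at a prime above `17`. -/
def reduction : WeierstrassCurve (ZMod 17) := ⟨2, 3, 3, 0, 0⟩

lemma reduction_nonsingular {x y : ZMod 17} (h : reduction.toAffine.Equation x y) :
    reduction.toAffine.Nonsingular x y := by
  have : Fact (Nat.Prime 17) := ⟨by norm_num⟩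
  refine (equation_iff_nonsingular_of_Δ_ne_zero ?_).1 h
  simp only [reduction, Δ, b₂, b₄, b₆, b₈]
  decide

lemma card_reduction :
    Nat.card (Option {xy : ZMod 17 × ZMod 17 // reduction.toAffine.Equation xy.1 xy.2}) = 20 := by
  have h : ∀ xy : ZMod 17 × ZMod 17, reduction.toAffine.Equation xy.1 xy.2 ↔
      xy.2 ^ 2 + 2 * xy.1 * xy.2 + 3 * xy.2 = xy.1 ^ 3 + 3 * xy.1 ^ 2 := by
    intro xy
    rw [equation_iff]
    simp [reduction]
  rw [Nat.card_congr (Equiv.optionCongr (Equiv.subtypeEquivRight h)), Nat.card_eq_fintype_card]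
  decide +kernel

/-- Since 17 splits, ℚ(√-2) embeds in ℚ₁₇ and the residue field is only 𝔽₁₇, where 1/11 = 14. -/
lemma finite_torsion : Finite (AddCommGroup.torsion exampleCurve.toAffine.Point) ∧
    Nat.card (AddCommGroup.torsion exampleCurve.toAffine.Point) ≤ 20 := by
  classical
  have hinv : ∀ j : ZMod 17, 11 * j = 1 → j = 14 := by decide
  have h5 : (5 * 14 : ZMod 17) = 2 := by decide
  have h6 : (6 * 14 ^ 2 : ZMod 17) = 3 := by decide
  have : Fact (Nat.Prime 17) := ⟨by norm_num⟩
  obtain ⟨r, hr⟩ := Padic.exists_sq_eq_neg_two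
  obtain ⟨φ⟩ := QSqrt.nonempty_ringHom (d := -2) (r := r) (by rw [hr]; norm_num)
  have h11 : IsUnit (11 : ℤ_[17]) := by
    rw [PadicInt.isUnit_iff]
    have := (PadicInt.norm_natCast_eq_one_iff (p := 17) (n := 11)).2 (by norm_num)
    simpa using this
  obtain ⟨i, hi⟩ := h11.exists_right_inv
  let W : WeierstrassCurve ℤ_[17] := ⟨5 * i, 6 * i ^ 2, 6 * i ^ 2, 0, 0⟩
  have hi' : algebraMap ℤ_[17] ℚ_[17] i = 1 / 11 := by
    rw [eq_div_iff (by norm_num), mul_comm]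
    have := congrArg (algebraMap ℤ_[17] ℚ_[17]) hi
    rwa [map_mul, map_ofNat, map_one] at this
  have hW : exampleCurve.map φ = W.map (algebraMap ℤ_[17] ℚ_[17]) := by
    ext <;> simp only [exampleCurve, W, WeierstrassCurve.map, map_div₀, map_mul, map_pow, map_ofNat,
      map_zero, hi'] <;> norm_num
  have hred : W.map PadicInt.toZMod = reduction := by
    have h14 : PadicInt.toZMod i = 14 := by
      have h1 := congrArg (PadicInt.toZMod (p := 17)) hi
      rw [map_mul, map_one, map_ofNat] at h1
      exact hinv _ h1
    ext <;> simp only [reduction, W, WeierstrassCurve.map, map_mul, map_pow, map_ofNat, map_zero,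
      h14, h5, h6]
  have key := Point.exists_injective_reduction W (by norm_num) (by
    rw [hred]
    exact fun x y ↦ reduction_nonsingular)
  rw [hred] at key
  obtain ⟨f, hf⟩ := key
  let g : AddCommGroup.torsion exampleCurve.toAffine.Point →
      AddCommGroup.torsion (W.map (algebraMap ℤ_[17] ℚ_[17])).toAffine.Point :=
    fun P ↦ ⟨Point.mapHom φ hW P, (Point.mapHom φ hW).isOfFinAddOrder P.2⟩
  have hg : Function.Injective g := fun P R h ↦
    Subtype.ext (Point.mapHom_injective φ hW (congrArg Subtype.val h))
  have hfg := hf.comp hg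
  exact ⟨Finite.of_injective _ hfg, (Nat.card_le_card_of_injective _ hfg).trans card_reduction.le⟩

/-- A point of order `10`. -/
noncomputable def ptQ : exampleCurve.toAffine.Point :=
  .some (6 / 11) (-72 / 121) (nonsingular_iff.2 (by norm_num))

lemma addOrderOf_ptQ : addOrderOf ptQ = 10 := by
  obtain ⟨h₂, h2⟩ : ∃ h, 2 • ptQ = .some (12 / 121) (-144 / 1331) h :=
    Point.two_nsmul_some_eq (l := -15 / 11) (by norm_num [exampleCurve]) (by norm_num [exampleCurve])
      (by norm_num [exampleCurve]) (by norm_num [exampleCurve])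
  obtain ⟨h₄, h4⟩ : ∃ h, 4 • ptQ = .some (-6 / 121) (-36 / 1331) h := by
    have h22 : 4 • ptQ = 2 • 2 • ptQ := mul_smul 2 2 ptQ
    rw [h22, h2]
    exact Point.two_nsmul_some_eq (l := -8 / 11) (by norm_num [exampleCurve]) (by norm_num [exampleCurve])
      (by norm_num [exampleCurve]) (by norm_num [exampleCurve])
  obtain ⟨h₅, h5⟩ : ∃ h, 5 • ptQ = .some (-3 / 44) (-9 / 968) h := by
    rw [succ_nsmul, h4]
    exact Point.some_add_some_eq (l := -21 / 22) (by norm_num) (by norm_num)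
      (by norm_num [exampleCurve]) (by norm_num [exampleCurve])
  refine addOrderOf_eq_of_nsmul_and_div_prime_nsmul (by norm_num) ?_ ?_
  · rw [show 10 = 2 * 5 from rfl, mul_smul, h5]
    exact Point.two_nsmul_some_eq_zero (by norm_num [exampleCurve])
  · intro p hp hdvd
    have : p = 2 ∨ p = 5 := by
      have h10 : p ∣ 2 * 5 := hdvd
      rcases (hp.dvd_mul).1 h10 with h | h
      · exact .inl ((Nat.prime_dvd_prime_iff_eq hp Nat.prime_two).1 h)
      · exact .inr ((Nat.prime_dvd_prime_iff_eq hp Nat.prime_five).1 h)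
    rcases this with rfl | rfl
    · rw [show 10 / 2 = 5 from rfl, h5]; exact Point.some_ne_zero _
    · rw [show 10 / 5 = 2 from rfl, h2]; exact Point.some_ne_zero _

lemma nonsingular_ptP {s : QSqrt (-2)} (hs : s ^ 2 = -2) :
    exampleCurve.toAffine.Nonsingular ((-2 - 8 * s) / 121) ((20 * s - 28) / 1331) := by
  rw [nonsingular_iff]
  linear_combination (512 * s - 400) / 1331 ^ 2 * hs

/-- A point of order `2`. -/
noncomputable def ptP {s : QSqrt (-2)} (hs : s ^ 2 = -2) : exampleCurve.toAffine.Point :=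
  .some _ _ (nonsingular_ptP hs)

lemma two_nsmul_ptP {s : QSqrt (-2)} (hs : s ^ 2 = -2) : 2 • ptP hs = 0 :=
  Point.two_nsmul_some_eq_zero (by simp only [exampleCurve]; ring)

/-- Multiples of the rational point `ptQ` are fixed by conjugation, and `ptP` is not. -/
lemma ptP_notMem {s : QSqrt (-2)} (hs : s ^ 2 = -2) : ptP hs ∉ AddSubgroup.zmultiples ptQ := by
  have hd : ∀ q : ℚ, q ^ 2 ≠ (-2 : ℤ) := fun q h ↦ by
    push_cast at h
    nlinarith [sq_nonneg q]
  obtain ⟨q, rfl⟩ := nonempty_quadraticConj (QSqrt.finrank_eq_two hd) hd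
    (by rw [hs]; norm_num : s ^ 2 = ((-2 : ℤ) : QSqrt (-2)))
  have hmap : exampleCurve.map q.σ = exampleCurve := by
    ext <;> simp only [exampleCurve, WeierstrassCurve.map, map_div₀, map_ofNat, map_zero]
  have hQ : Point.mapHom q.σ hmap ptQ = ptQ := by
    rw [ptQ, Point.mapHom_some, Point.some.injEq]
    simp only [map_div₀, map_neg, map_ofNat, and_self]
  rintro ⟨k, hk⟩
  have hP : Point.mapHom q.σ hmap (ptP hs) = ptP hs := by
    rw [← hk]
    simp only
    rw [map_zsmul, hQ]
  rw [ptP, Point.mapHom_some, Point.some.injEq] at hP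
  have h1 := hP.1
  rw [map_div₀, map_sub, map_mul, q.σ_s, map_neg, map_ofNat, map_ofNat, map_ofNat] at h1
  exact q.s_ne_zero (by linear_combination 121 / 16 * h1)

theorem closure_eq_torsion {s : QSqrt (-2)} (hs : s ^ 2 = -2) :
    AddSubgroup.closure {ptP hs, ptQ} = AddCommGroup.torsion exampleCurve.toAffine.Point ∧
      Nonempty (AddCommGroup.torsion exampleCurve.toAffine.Point ≃+ ZMod 2 × ZMod 10) := by
  obtain ⟨hfin, hcard⟩ := finite_torsion
  have hP : ptP hs ∈ AddSubgroup.closure {ptP hs, ptQ} := AddSubgroup.subset_closure (by simp)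
  have hQ : ptQ ∈ AddSubgroup.closure {ptP hs, ptQ} := AddSubgroup.subset_closure (by simp)
  have hle : AddSubgroup.closure {ptP hs, ptQ} ≤ AddCommGroup.torsion exampleCurve.toAffine.Point := by
    rw [AddSubgroup.closure_le]
    rintro R (rfl | rfl)
    · exact isOfFinAddOrder_iff_nsmul_eq_zero.2 ⟨2, two_pos, two_nsmul_ptP hs⟩
    · exact addOrderOf_pos_iff.1 (by rw [addOrderOf_ptQ]; norm_num)
  obtain ⟨e⟩ : Nonempty (AddSubgroup.closure {ptP hs, ptQ} ≃+ ZMod 2 × ZMod 10) := by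
    refine AddCommGroup.nonempty_addEquiv_zmod_two_prod (a := ⟨_, hP⟩) (b := ⟨_, hQ⟩)
      (Subtype.ext (two_nsmul_ptP hs)) ?_ (by rw [← addOrderOf_ptQ, ← AddSubgroup.addOrderOf_coe]) ?_
    · rintro ⟨k, hk⟩
      exact ptP_notMem hs ⟨k, congrArg Subtype.val hk⟩
    · rintro ⟨R, hR⟩
      obtain ⟨i, j, h⟩ := AddSubgroup.mem_closure_pair.1 hR
      exact ⟨i, j, Subtype.ext h.symm⟩
  have heq : AddSubgroup.closure {ptP hs, ptQ} = AddCommGroup.torsion exampleCurve.toAffine.Point := by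
    refine AddSubgroup.eq_of_le_of_card_ge hle (hcard.trans ?_)
    rw [Nat.card_congr e.toEquiv, Nat.card_prod, Nat.card_zmod, Nat.card_zmod]
  exact ⟨heq, ⟨heq ▸ e⟩⟩

theorem appearsAsTorsion : AppearsAsTorsion (QSqrt (-2)) 2 10 := by
  obtain ⟨s, hs⟩ := QSqrt.exists_sq_eq (-2)
  exact ⟨exampleCurve, isElliptic, (closure_eq_torsion (by rw [hs]; norm_num)).2⟩

end exampleCurve

end

theorem theorem9 :
    -- `ℚ(√-2)` is the unique quadratic field of smallest `|Δ|` over which `ℤ/2 ⊕ ℤ/10` appears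
    (Module.finrank ℚ (QSqrt (-2)) = 2 ∧
      AppearsAsTorsion (QSqrt (-2)) 2 10 ∧
      ∀ (K : Type*) [Field K] [NumberField K] [DecidableEq K],
        Module.finrank ℚ K = 2 → AppearsAsTorsion K 2 10 →
          |NumberField.discr (QSqrt (-2))| ≤ |NumberField.discr K| ∧
          (|NumberField.discr K| = |NumberField.discr (QSqrt (-2))| →
            Nonempty (K ≃+* QSqrt (-2)))) ∧
    -- `X₁(2,10)` over `ℚ(√-7)`
    ((X1_2_10 (QSqrt (-7))).mordellWeilRank = 0 ∧
      Nonempty ((X1_2_10 (QSqrt (-7))).toAffine.Point ≃+ ZMod 6) ∧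
      ∀ P : (X1_2_10 (QSqrt (-7))).toAffine.Point, X1_2_10.IsCusp P) ∧
    -- `X₁(2,10)` over `ℚ(√5)`
    ((X1_2_10 (QSqrt 5)).mordellWeilRank = 0 ∧
      Nonempty ((X1_2_10 (QSqrt 5)).toAffine.Point ≃+ ZMod 2 × ZMod 6) ∧
      ∀ P : (X1_2_10 (QSqrt 5)).toAffine.Point, X1_2_10.IsCusp P) ∧
    -- `X₁(2,10)` over `ℚ(√-2)`
    (X1_2_10 (QSqrt (-2))).mordellWeilRank = 1 ∧
    -- the explicit curve over `ℚ(√-2)`, with generators of its torsion group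
    (exampleCurve.IsElliptic ∧
      Nonempty (AddCommGroup.torsion exampleCurve.toAffine.Point ≃+ ZMod 2 × ZMod 10) ∧
      ∀ s : QSqrt (-2), s ^ 2 = -2 →
        ∃ (hP : exampleCurve.toAffine.Nonsingular
              ((-2 - 8 * s) / 121) ((20 * s - 28) / 1331))
          (hQ : exampleCurve.toAffine.Nonsingular (6 / 11) (-72 / 121)),
          AddSubgroup.closure
              {WeierstrassCurve.Affine.Point.some _ _ hP,
                WeierstrassCurve.Affine.Point.some _ _ hQ} =
            AddCommGroup.torsion exampleCurve.toAffine.Point) := by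
  have hsq : ∀ d : ℤ, ¬ IsSquare d → ∀ q : ℚ, q ^ 2 ≠ d := fun d hd q h ↦
    hd (Rat.isSquare_intCast_iff.1 ⟨q, by rw [← h, sq]⟩)
  have hconj : ∀ d : ℤ, ¬ IsSquare d → Nonempty (QuadraticConj (QSqrt d) d) := fun d hd ↦ by
    obtain ⟨s, hs⟩ := QSqrt.exists_sq_eq d
    obtain ⟨q, -⟩ := nonempty_quadraticConj (QSqrt.finrank_eq_two (hsq d hd)) (hsq d hd) hs
    exact ⟨q⟩
  have hd2 := hsq (-2) (by decide)
  have hK2 := QSqrt.finrank_eq_two hd2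
  obtain ⟨s₂, hs₂⟩ := QSqrt.exists_sq_eq (-2)
  obtain ⟨q₂⟩ := hconj (-2) (by decide)
  obtain ⟨q₅⟩ := hconj 5 (by decide +kernel)
  obtain ⟨q₇⟩ := hconj (-7) (by decide)
  have h8 : |NumberField.discr (QSqrt (-2))| ≤ 8 := abs_discr_le_of_sqrt hK2 hd2 hs₂
  refine ⟨⟨hK2, exampleCurve.appearsAsTorsion, ?_⟩,
    ⟨X1_2_10.mordellWeilRank_eq_zero q₇ (by simp), X1_2_10.nonempty_addEquiv_zmod_six q₇ (by simp) ?_,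
      X1_2_10.isCusp_of_twist q₇ (by simp)⟩,
    ⟨X1_2_10.mordellWeilRank_eq_zero q₅ (by simp), X1_2_10.nonempty_addEquiv_zmod_two_prod_six q₅,
      X1_2_10.isCusp_of_twist q₅ (by simp)⟩,
    X1_2_10.mordellWeilRank_eq_one q₂, exampleCurve.isElliptic,
    (exampleCurve.closure_eq_torsion (by rw [hs₂]; norm_num)).2, fun s hs ↦
      ⟨exampleCurve.nonsingular_ptP hs, _, (exampleCurve.closure_eq_torsion hs).1⟩⟩
  · intro K _ _ _ hK hA
    -- Only the bound |Δ| ≤ 8 for ℚ(√-2) is needed: a field within it carrying the group must be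
    -- ℚ(√-2), and all others are strictly beyond.
    by_cases hle : |NumberField.discr K| ≤ 8
    · obtain ⟨d, hd | rfl, s, hs⟩ := exists_sqrt_of_abs_discr_le hK hle
      · obtain ⟨P, hP⟩ := hA.exists_not_isCusp
        have hd' : ¬ IsSquare d := by
          rcases hd with rfl | rfl | rfl | rfl | rfl <;> decide +kernel
        obtain ⟨q, -⟩ := nonempty_quadraticConj hK (hsq d hd') hs
        exact absurd (X1_2_10.isCusp_of_twist q hd P) hP
      · obtain ⟨e⟩ := QSqrt.nonempty_ringEquiv hK hd2 hs
        rw [NumberField.discr_eq_discr_of_ringEquiv K e]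
        exact ⟨le_rfl, fun _ ↦ ⟨e⟩⟩
    · exact ⟨by omega, fun h ↦ absurd (h.trans_le h8) hle⟩
  · intro v hv
    push_cast at hv
    nlinarith [sq_nonneg v]
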